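/- There is a universal constant $C>0$ with the following property. For all $M>0$ and $\eta>0$ there is $w>0$ depending only on $M$ and $\eta$ such that for every real random variable $\xi$ with zero mean and unit variance there is $N_0\in\mathbb N$ depending only on $M$, $\eta$ and the distribution of $\xi$ for which the following holds. Let $N\ge N_0$, $1\le n\le N$, and let $A=(a_{ij})$ be an $N\times n$ random matrix with i.i.d. entries distributed as $\xi$. Let $\tilde A=(\tilde a_{ij})$ be the $N\times n$ matrix with entries $\tilde a_{ij}=a_{ij}\chi_{\{|a_{ij}|\le M\}}-\mathbb E\bigl(a_{ij}\chi_{\{|a_{ij}|\le M\}}\bigr)$, and let $\theta=\xi\chi_{\{|\xi|>M\}}+\mathbb E\bigl(\xi\chi_{\{|\xi|\le M\}}\bigr)$, where $\chi_{\mathcal E}$ denotes the indicator of the event $\mathcal E$. Then $$\mathbb P\Bigl\{s_n(A)\ge s_n(\tilde A)-\eta\sqrt N-C\sqrt{N\,\mathbb E\theta^2}\Bigr\}\ge 1-\exp(-wN),$$ where $s_n(B)$ denotes the $n$-th largest (that is, the smallest) singular value of an $N\times n$ real matrix $B$, i.e. the smallest eigenvalue of $\sqrt{B^TB}$. -/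

import Mathlib

open MeasureTheory ProbabilityTheory

/-- The `k`-th largest singular value `s_k(B)` (counted from `k = 1`) of a real `N × n` matrix `B`.
Mathlib's sequence of singular values is also non-increasing with multiplicities, but starts at
index `0`. -/
noncomputable def singularValue {N n : ℕ} (B : Matrix (Fin N) (Fin n) ℝ) (k : ℕ) : ℝ :=
  (Matrix.toEuclideanLin B).singularValues (k - 1)

/-- The random variable `ξ χ_{|ξ| ≤ M}`. -/
noncomputable def cutBelow {Ω : Type*} (M : ℝ) (ξ : Ω → ℝ) : Ω → ℝ :=
  Set.indicator {ω | |ξ ω| ≤ M} ξ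

/-- The random variable `ξ χ_{|ξ| > M}`. -/
noncomputable def cutAbove {Ω : Type*} (M : ℝ) (ξ : Ω → ℝ) : Ω → ℝ :=
  Set.indicator {ω | M < |ξ ω|} ξ

/-- The centered `M`-truncation `ξ χ_{|ξ| ≤ M} - E(ξ χ_{|ξ| ≤ M})` of `ξ`. -/
noncomputable def centeredTruncation {Ω : Type*} [MeasurableSpace Ω] (P : Measure Ω) (M : ℝ)
    (ξ : Ω → ℝ) : Ω → ℝ :=
  fun ω => cutBelow M ξ ω - ∫ ω', cutBelow M ξ ω' ∂P

/-- The tail `θ = ξ χ_{|ξ| > M} + E(ξ χ_{|ξ| ≤ M})` of `ξ`. -/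
noncomputable def truncationTail {Ω : Type*} [MeasurableSpace Ω] (P : Measure Ω) (M : ℝ)
    (ξ : Ω → ℝ) : Ω → ℝ :=
  fun ω => cutAbove M ξ ω + ∫ ω', cutBelow M ξ ω' ∂P

/-- `a = (a_{ij})` is an `N × n` random matrix on `(Ω, P)` with i.i.d. entries of law `ν`. -/
structure IsIIDMatrix {Ω : Type*} [MeasurableSpace Ω] (P : Measure Ω) (ν : Measure ℝ) {N n : ℕ}
    (a : Fin N → Fin n → Ω → ℝ) : Prop where
  hasLaw : ∀ i j, HasLaw (a i j) ν P
  indep : iIndepFun (fun p : Fin N × Fin n => a p.1 p.2) P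

/-! Both singular values are compared with √N - √n. Put σ² = E θ². Off an event of exponentially
small probability, s_n(A) ≥ √N - √n - (η/2 + 2σ)√N when the right side is nonnegative
(`exists_lower_tail`; otherwise the bound is trivial), and s_n(Ã) ≤ √N - √n + (η/2)√N
(`exists_upper_tail`). Subtracting gives the claim with C = 2. Both tails are phrased for the Gram
matrix Σ xₖxₖᵀ of the rows.

Lower tail: a barrier argument. Rows are added one at a time, keeping a barrier u below the spectrum
of the current matrix S with tr R + K tr R² ≤ φ, where R = (S - u)⁻¹ has eigenvalues b_j. Moving the
barrier by δ raises this potential by about δ D with D = Σ (b_j² + 2K b_j³). A new row x lowers it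
by at least about W D / (1 + φ), where W is the quadratic form of x with these weights normalized to
sum one. Hence a shift of about W / (1 + φ) is affordable. Taking K of order N makes every b_j
small, so that xᵀRx and, after a cutoff, K xᵀR²x obey a weak law of large numbers needing two
moments only; this is what makes N₀ depend on the distribution. The form W itself need not
concentrate: only the mean of min(W, Δ) matters, and it is at least 1 - 2σ² - O(1/Δ) with a constant
depending on M alone. A Chernoff bound for the shifts, which lie in [0, Δ], then has a rate
depending on M and η alone. With β slightly below 1 - 2σ² and p = √(βN) - √n, the barrier starts at
-√n p, the potential is about √n/p, and N mean shifts β/(1 + φ) bring it close to p².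

Upper tail: the self-consistent equation for m = tr (XᵀX - w)⁻¹, where X has the bounded entries, of
variance a ≤ 1, and w is of order N. Removing single rows shows that w m + n - N + N/(1 + a m) is
small against N in mean, and it moves by O(1) when one row changes, so bounded differences give
exponential concentration. If all eigenvalues exceeded (√N - √n)² + ηN, then m at a point slightly
below them would be nearly a real number μ ≥ 0. The inequality N(1 - 1/(1 + μ)) ≤ n + (√N - √n)² μ
(`marchenkoPastur_edge`) then forces μ, and with it n/N, to be small. When n/N is small, one column
of X already yields the bound. -/

/-! ### Spectral calculus and rank-one updates -/

section SpectralCalculus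

open Matrix

variable {n : ℕ} {𝕜 : Type*} [Field 𝕜] [Algebra ℝ 𝕜]

/-- The matrix `U diag(g) Uᵀ` over `𝕜`, where `U` is a real matrix. -/
noncomputable def specMat (U : Matrix (Fin n) (Fin n) ℝ) (g : Fin n → 𝕜) :
    Matrix (Fin n) (Fin n) 𝕜 :=
  U.map (algebraMap ℝ 𝕜) * diagonal g * Uᵀ.map (algebraMap ℝ 𝕜)

/-- A real vector viewed over `𝕜`. -/
def liftVec (𝕜 : Type*) [Field 𝕜] [Algebra ℝ 𝕜] (x : Fin n → ℝ) : Fin n → 𝕜 :=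
  fun i => algebraMap ℝ 𝕜 (x i)

theorem map_transpose_mul_map {U : Matrix (Fin n) (Fin n) ℝ} (hU : Uᵀ * U = 1) :
    Uᵀ.map (algebraMap ℝ 𝕜) * U.map (algebraMap ℝ 𝕜) = 1 := by
  rw [← Matrix.map_mul, hU, Matrix.map_one _ (map_zero _) (map_one _)]

theorem specMat_mul {U : Matrix (Fin n) (Fin n) ℝ} (hU : Uᵀ * U = 1) (g h : Fin n → 𝕜) :
    specMat U g * specMat U h = specMat U (g * h) := by
  have h1 := map_transpose_mul_map (𝕜 := 𝕜) hU
  unfold specMat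
  calc _ = U.map (algebraMap ℝ 𝕜) * diagonal g *
        (Uᵀ.map (algebraMap ℝ 𝕜) * U.map (algebraMap ℝ 𝕜)) * diagonal h *
          Uᵀ.map (algebraMap ℝ 𝕜) := by simp only [Matrix.mul_assoc]
    _ = _ := by
      rw [h1, Matrix.mul_one, Matrix.mul_assoc _ (diagonal g), diagonal_mul_diagonal]; rfl

theorem specMat_const {U : Matrix (Fin n) (Fin n) ℝ} (hU : Uᵀ * U = 1) (c : 𝕜) :
    specMat U (fun _ => c) = c • (1 : Matrix (Fin n) (Fin n) 𝕜) := by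
  have h1 := mul_eq_one_comm.mp (map_transpose_mul_map (𝕜 := 𝕜) hU)
  have : (diagonal fun _ : Fin n => c) = c • (1 : Matrix (Fin n) (Fin n) 𝕜) := by
    rw [← Matrix.diagonal_one, ← Matrix.diagonal_smul]; congr 1; ext; simp
  unfold specMat
  rw [this]
  simp [h1]

theorem specMat_sub (U : Matrix (Fin n) (Fin n) ℝ) (g h : Fin n → 𝕜) :
    specMat U g - specMat U h = specMat U (g - h) := by
  unfold specMat
  rw [← Matrix.sub_mul, ← Matrix.mul_sub, Matrix.diagonal_sub]; rfl

theorem specMat_inv {U : Matrix (Fin n) (Fin n) ℝ} (hU : Uᵀ * U = 1) {g : Fin n → 𝕜}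
    (hg : ∀ j, g j ≠ 0) : (specMat U g)⁻¹ = specMat U g⁻¹ := by
  apply Matrix.inv_eq_right_inv
  rw [specMat_mul hU]
  have : g * g⁻¹ = fun _ => 1 := by ext j; simp [hg j]
  rw [this, specMat_const hU, one_smul]

theorem isUnit_specMat {U : Matrix (Fin n) (Fin n) ℝ} (hU : Uᵀ * U = 1) {g : Fin n → 𝕜}
    (hg : ∀ j, g j ≠ 0) : IsUnit (specMat U g) := by
  rw [Matrix.isUnit_iff_isUnit_det]
  apply Matrix.isUnit_det_of_right_inverse (B := specMat U g⁻¹)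
  rw [specMat_mul hU]
  have : g * g⁻¹ = fun _ => 1 := by ext j; simp [hg j]
  rw [this, specMat_const hU, one_smul]

theorem trace_specMat {U : Matrix (Fin n) (Fin n) ℝ} (hU : Uᵀ * U = 1) (g : Fin n → 𝕜) :
    (specMat U g).trace = ∑ j, g j := by
  unfold specMat
  rw [Matrix.trace_mul_comm, ← Matrix.mul_assoc, map_transpose_mul_map hU, Matrix.one_mul,
    Matrix.trace_diagonal]

theorem transpose_specMat (U : Matrix (Fin n) (Fin n) ℝ) (g : Fin n → 𝕜) :
    (specMat U g)ᵀ = specMat U g := by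
  unfold specMat
  simp [Matrix.transpose_mul, Matrix.transpose_map, Matrix.mul_assoc]

theorem dotProduct_specMat_mulVec (U : Matrix (Fin n) (Fin n) ℝ) (g : Fin n → 𝕜) (x : Fin n → ℝ) :
    liftVec 𝕜 x ⬝ᵥ specMat U g *ᵥ liftVec 𝕜 x
      = ∑ j, g j * algebraMap ℝ 𝕜 ((Uᵀ *ᵥ x) j ^ 2) := by
  have h1 : Uᵀ.map (algebraMap ℝ 𝕜) *ᵥ liftVec 𝕜 x = liftVec 𝕜 (Uᵀ *ᵥ x) := by
    ext i; simp [Matrix.mulVec, dotProduct, liftVec, map_sum]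
  have h2 : liftVec 𝕜 x ᵥ* U.map (algebraMap ℝ 𝕜) = liftVec 𝕜 (Uᵀ *ᵥ x) := by
    rw [← h1, ← Matrix.vecMul_transpose]; simp [Matrix.transpose_map]
  unfold specMat
  rw [← Matrix.mulVec_mulVec, ← Matrix.mulVec_mulVec, Matrix.dotProduct_mulVec, h1, h2]
  simp only [dotProduct, Matrix.mulVec_diagonal, liftVec]
  refine Finset.sum_congr rfl fun j _ => ?_
  rw [map_pow]; ring

/-- Every real symmetric matrix has a spectral decomposition. -/
theorem exists_eq_specMat {S : Matrix (Fin n) (Fin n) ℝ} (hS : Sᵀ = S) :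
    ∃ (U : Matrix (Fin n) (Fin n) ℝ) (lam : Fin n → ℝ), Uᵀ * U = 1 ∧ S = specMat U lam := by
  have hH : S.IsHermitian := by
    rw [Matrix.IsHermitian, Matrix.conjTranspose_eq_transpose_of_trivial, hS]
  refine ⟨hH.eigenvectorUnitary, hH.eigenvalues, ?_, ?_⟩
  · have := Unitary.coe_star_mul_self hH.eigenvectorUnitary
    rwa [Matrix.star_eq_conjTranspose, Matrix.conjTranspose_eq_transpose_of_trivial] at this
  · conv_lhs => rw [hH.spectral_theorem]
    rw [Unitary.conjStarAlgAut_apply]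
    unfold specMat
    rw [Matrix.star_eq_conjTranspose, Matrix.conjTranspose_eq_transpose_of_trivial]
    simp

theorem map_specMat (U : Matrix (Fin n) (Fin n) ℝ) (lam : Fin n → ℝ) :
    (specMat U lam).map (algebraMap ℝ 𝕜) = specMat U (fun j => algebraMap ℝ 𝕜 (lam j)) := by
  unfold specMat
  rw [Matrix.map_mul, Matrix.map_mul, Matrix.diagonal_map (map_zero _)]
  simp

theorem map_specMat_sub_smul {U : Matrix (Fin n) (Fin n) ℝ} (hU : Uᵀ * U = 1)
    (lam : Fin n → ℝ) (w : 𝕜) :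
    (specMat U lam).map (algebraMap ℝ 𝕜) - w • 1
      = specMat U (fun j => algebraMap ℝ 𝕜 (lam j) - w) := by
  rw [map_specMat, ← specMat_const hU, specMat_sub]; rfl

/-- Inverse of a symmetric rank-one perturbation (Sherman–Morrison). -/
theorem inv_add_vecMulVec {F : Type*} [Field F] {M : Matrix (Fin n) (Fin n) F}
    (hM : IsUnit M) (hs : Mᵀ = M)
    (x : Fin n → F) (hq : 1 + x ⬝ᵥ M⁻¹ *ᵥ x ≠ 0) :
    (M + vecMulVec x x)⁻¹
      = M⁻¹ - (1 + x ⬝ᵥ M⁻¹ *ᵥ x)⁻¹ • vecMulVec (M⁻¹ *ᵥ x) (M⁻¹ *ᵥ x) := by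
  have hdet : IsUnit M.det := (Matrix.isUnit_iff_isUnit_det _).mp hM
  have hMM : M * M⁻¹ = 1 := Matrix.mul_nonsing_inv _ hdet
  have hBt : M⁻¹ᵀ = M⁻¹ := by rw [Matrix.transpose_nonsing_inv, hs]
  apply Matrix.inv_eq_right_inv
  set q := x ⬝ᵥ M⁻¹ *ᵥ x with hqdef
  have h1 : M * vecMulVec (M⁻¹ *ᵥ x) (M⁻¹ *ᵥ x) = vecMulVec x (M⁻¹ *ᵥ x) := by
    rw [Matrix.mul_vecMulVec, Matrix.mulVec_mulVec, hMM, Matrix.one_mulVec]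
  have h2 : vecMulVec x x * M⁻¹ = vecMulVec x (M⁻¹ *ᵥ x) := by
    rw [Matrix.vecMulVec_mul, ← Matrix.mulVec_transpose, hBt]
  have h3 : vecMulVec x x * vecMulVec (M⁻¹ *ᵥ x) (M⁻¹ *ᵥ x) = q • vecMulVec x (M⁻¹ *ᵥ x) := by
    rw [Matrix.vecMulVec_mul_vecMulVec]
    ext i j
    simp [Matrix.vecMulVec_apply, hqdef]
    ring
  rw [Matrix.add_mul, Matrix.mul_sub, Matrix.mul_sub, Matrix.mul_smul, Matrix.mul_smul, hMM, h1, h2,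
    h3, smul_smul]
  have h4 : (1 + q)⁻¹ * q = 1 - (1 + q)⁻¹ := by field_simp; ring
  rw [h4, sub_smul, one_smul]
  abel

/-- Sherman–Morrison read in the eigenbasis of the base matrix. Over ℝ the two traces give the
change of the barrier potential; over ℂ the trace and the quadratic form give the leave-one-row-out
identities for the resolvent. -/
theorem trace_inv_add_vecMulVec {U : Matrix (Fin n) (Fin n) ℝ} (hU : Uᵀ * U = 1) {g : Fin n → 𝕜}
    (hg : ∀ j, g j ≠ 0) (x : Fin n → ℝ)
    (hq : 1 + ∑ j, (g j)⁻¹ * algebraMap ℝ 𝕜 ((Uᵀ *ᵥ x) j ^ 2) ≠ 0) :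
    ((specMat U g + vecMulVec (liftVec 𝕜 x) (liftVec 𝕜 x))⁻¹).trace
      = ∑ j, (g j)⁻¹ - (∑ j, (g j)⁻¹ ^ 2 * algebraMap ℝ 𝕜 ((Uᵀ *ᵥ x) j ^ 2))
          / (1 + ∑ j, (g j)⁻¹ * algebraMap ℝ 𝕜 ((Uᵀ *ᵥ x) j ^ 2)) ∧
    liftVec 𝕜 x ⬝ᵥ (specMat U g + vecMulVec (liftVec 𝕜 x) (liftVec 𝕜 x))⁻¹ *ᵥ liftVec 𝕜 x
      = 1 - 1 / (1 + ∑ j, (g j)⁻¹ * algebraMap ℝ 𝕜 ((Uᵀ *ᵥ x) j ^ 2)) ∧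
    ((specMat U g + vecMulVec (liftVec 𝕜 x) (liftVec 𝕜 x))⁻¹ *
        (specMat U g + vecMulVec (liftVec 𝕜 x) (liftVec 𝕜 x))⁻¹).trace
      = ∑ j, (g j)⁻¹ ^ 2 - 2 * (∑ j, (g j)⁻¹ ^ 3 * algebraMap ℝ 𝕜 ((Uᵀ *ᵥ x) j ^ 2))
          / (1 + ∑ j, (g j)⁻¹ * algebraMap ℝ 𝕜 ((Uᵀ *ᵥ x) j ^ 2))
        + (∑ j, (g j)⁻¹ ^ 2 * algebraMap ℝ 𝕜 ((Uᵀ *ᵥ x) j ^ 2)) ^ 2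
          / (1 + ∑ j, (g j)⁻¹ * algebraMap ℝ 𝕜 ((Uᵀ *ᵥ x) j ^ 2)) ^ 2 := by
  set X := liftVec 𝕜 x with hX
  set y : Fin n → 𝕜 := fun j => algebraMap ℝ 𝕜 ((Uᵀ *ᵥ x) j ^ 2) with hy
  have hB : (specMat U g)⁻¹ = specMat U g⁻¹ := specMat_inv hU hg
  have hBt := transpose_specMat U g⁻¹
  have hqf : ∀ k : Fin n → 𝕜, X ⬝ᵥ specMat U k *ᵥ X = ∑ j, k j * y j :=
    fun k => dotProduct_specMat_mulVec U k x
  have hq' : X ⬝ᵥ (specMat U g)⁻¹ *ᵥ X = ∑ j, (g j)⁻¹ * y j := by rw [hB, hqf]; rfl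
  have hinv := inv_add_vecMulVec (isUnit_specMat hU hg) (transpose_specMat U g) X
    (by rw [hq']; exact hq)
  rw [hq', hB] at hinv
  set q := ∑ j, (g j)⁻¹ * y j with hqd
  have hdot : ∀ (k : Fin n → 𝕜), (specMat U g⁻¹ *ᵥ X) ⬝ᵥ specMat U k *ᵥ X
      = ∑ j, (g j)⁻¹ * k j * y j := by
    intro k
    have : specMat U g⁻¹ *ᵥ X = X ᵥ* specMat U g⁻¹ := by
      rw [← Matrix.mulVec_transpose, hBt]
    rw [this, ← Matrix.dotProduct_mulVec, Matrix.mulVec_mulVec, specMat_mul hU, hqf]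
    rfl
  have hr : (specMat U g⁻¹ *ᵥ X) ⬝ᵥ (specMat U g⁻¹ *ᵥ X) = ∑ j, (g j)⁻¹ ^ 2 * y j := by
    rw [hdot]; simp [sq]
  have hs : (specMat U g⁻¹ *ᵥ X) ⬝ᵥ specMat U g⁻¹ *ᵥ specMat U g⁻¹ *ᵥ X
      = ∑ j, (g j)⁻¹ ^ 3 * y j := by
    rw [Matrix.mulVec_mulVec, specMat_mul hU, hdot]
    refine Finset.sum_congr rfl fun j _ => ?_
    simp only [Pi.mul_apply, Pi.inv_apply]; ring
  set r := ∑ j, (g j)⁻¹ ^ 2 * y j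
  set s := ∑ j, (g j)⁻¹ ^ 3 * y j
  have hq1 : 1 + q ≠ 0 := hq
  refine ⟨?_, ?_, ?_⟩
  · rw [hinv, Matrix.trace_sub, trace_specMat hU, Matrix.trace_smul, Matrix.trace_vecMulVec, hr]
    simp [div_eq_inv_mul]
  · rw [hinv, Matrix.sub_mulVec, dotProduct_sub, hqf, Matrix.smul_mulVec, dotProduct_smul,
      Matrix.vecMulVec_mulVec]
    have e1 : (specMat U g⁻¹ *ᵥ X) ⬝ᵥ X = q := by rw [dotProduct_comm, hqf]; rfl
    have e2 : X ⬝ᵥ specMat U g⁻¹ *ᵥ X = q := by rw [hqf]; rfl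
    have e3 : ∑ j, g⁻¹ j * y j = q := rfl
    simp only [e3, e1, dotProduct_smul, op_smul_eq_smul, e2, smul_eq_mul]
    field_simp
    ring
  · rw [hinv]
    set b := specMat U g⁻¹ *ᵥ X
    have t1 : specMat U g⁻¹ * vecMulVec b b = vecMulVec (specMat U g⁻¹ *ᵥ b) b := by
      rw [Matrix.mul_vecMulVec]
    have t2 : vecMulVec b b * specMat U g⁻¹ = vecMulVec b (specMat U g⁻¹ *ᵥ b) := by
      rw [Matrix.vecMulVec_mul, ← Matrix.mulVec_transpose, hBt]
    have t3 : (vecMulVec b b * vecMulVec b b).trace = r ^ 2 := by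
      rw [Matrix.vecMulVec_mul_vecMulVec, Matrix.trace_vecMulVec, hr]
      simp only [dotProduct_smul, hr, smul_eq_mul]
      ring
    have t4 : (specMat U g⁻¹ * specMat U g⁻¹).trace = ∑ j, (g j)⁻¹ ^ 2 := by
      rw [specMat_mul hU, trace_specMat hU]; simp [sq]
    rw [Matrix.sub_mul, Matrix.mul_sub, Matrix.mul_sub]
    simp only [Matrix.mul_smul, Matrix.smul_mul, Matrix.trace_sub, Matrix.trace_smul, t3, t4, t1,
      t2, Matrix.trace_vecMulVec, smul_eq_mul]
    rw [dotProduct_comm (specMat U g⁻¹ *ᵥ b) b, hs]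
    field_simp
    ring

end SpectralCalculus

/-! ### Fubini on finite powers and bounded measurable functions -/

section ProductIntegrals

theorem lintegral_pi_insertNth {E : Type*} [MeasurableSpace E] (μ : Measure E)
    [IsProbabilityMeasure μ] {N : ℕ} (i : Fin (N + 1)) {f : (Fin (N + 1) → E) → ENNReal}
    (hf : Measurable f) :
    ∫⁻ X, f X ∂(Measure.pi fun _ : Fin (N + 1) => μ)
      = ∫⁻ x, ∫⁻ Y, f (i.insertNth x Y) ∂(Measure.pi fun _ : Fin N => μ) ∂μ := by
  have h := (measurePreserving_piFinSuccAbove (fun _ : Fin (N + 1) => μ) i).symm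
  rw [← h.lintegral_comp hf, lintegral_prod _ (by fun_prop)]
  rfl

theorem lintegral_pi_insertNth_symm {E : Type*} [MeasurableSpace E] (μ : Measure E)
    [IsProbabilityMeasure μ] {N : ℕ} (i : Fin (N + 1)) {f : (Fin (N + 1) → E) → ENNReal}
    (hf : Measurable f) :
    ∫⁻ X, f X ∂(Measure.pi fun _ : Fin (N + 1) => μ)
      = ∫⁻ Y, ∫⁻ x, f (i.insertNth x Y) ∂μ ∂(Measure.pi fun _ : Fin N => μ) := by
  have h := (measurePreserving_piFinSuccAbove (fun _ : Fin (N + 1) => μ) i).symm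
  rw [← h.lintegral_comp hf, lintegral_prod_symm _ (by fun_prop)]
  rfl

theorem integral_pi_cons {E : Type*} [MeasurableSpace E] (μ : Measure E)
    [IsProbabilityMeasure μ] {N : ℕ} {f : (Fin (N + 1) → E) → ℝ}
    (hf : Integrable f (Measure.pi fun _ : Fin (N + 1) => μ)) :
    ∫ X, f X ∂(Measure.pi fun _ : Fin (N + 1) => μ)
      = ∫ x, ∫ Y, f (Fin.cons x Y) ∂(Measure.pi fun _ : Fin N => μ) ∂μ := by
  have h := (measurePreserving_piFinSuccAbove (fun _ : Fin (N + 1) => μ) 0).symm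
  rw [← h.integral_comp', integral_prod]
  · simp [MeasurableEquiv.piFinSuccAbove_symm_apply, Fin.insertNthEquiv]
  · exact (h.integrable_comp_emb (MeasurableEquiv.measurableEmbedding _)).mpr hf

/-- Bounded measurable real functions. -/
def BddMeas {E : Type*} [MeasurableSpace E] (f : E → ℝ) : Prop :=
  Measurable f ∧ ∃ C, ∀ x, |f x| ≤ C

namespace BddMeas

variable {E : Type*} [MeasurableSpace E] {f g : E → ℝ}

theorem const (c : ℝ) : BddMeas (fun _ : E => c) := ⟨measurable_const, |c|, fun _ => le_rfl⟩

theorem add (hf : BddMeas f) (hg : BddMeas g) : BddMeas (fun x => f x + g x) := by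
  obtain ⟨hf, C, hC⟩ := hf
  obtain ⟨hg, D, hD⟩ := hg
  exact ⟨hf.add hg, C + D, fun x => (abs_add_le _ _).trans (add_le_add (hC x) (hD x))⟩

theorem mul (hf : BddMeas f) (hg : BddMeas g) : BddMeas (fun x => f x * g x) := by
  obtain ⟨hf, C, hC⟩ := hf
  obtain ⟨hg, D, hD⟩ := hg
  refine ⟨hf.mul hg, C * D, fun x => ?_⟩
  rw [abs_mul]
  exact mul_le_mul (hC x) (hD x) (abs_nonneg _) ((abs_nonneg _).trans (hC x))

theorem sub (hf : BddMeas f) (hg : BddMeas g) : BddMeas (fun x => f x - g x) := by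
  simpa [sub_eq_add_neg] using hf.add ((const (-1)).mul hg)

theorem pow (hf : BddMeas f) (k : ℕ) : BddMeas (fun x => f x ^ k) := by
  induction k with
  | zero => simpa using const (E := E) 1
  | succ k ih => simpa [pow_succ] using ih.mul hf

theorem sum {ι : Type*} (s : Finset ι) {F : ι → E → ℝ} (hF : ∀ i, BddMeas (F i)) :
    BddMeas (fun x => ∑ i ∈ s, F i x) := by
  classical
  induction s using Finset.induction_on with
  | empty => simpa using const (E := E) 0
  | insert a s ha ih => simpa [Finset.sum_insert ha] using (hF a).add ih

theorem comp {E' : Type*} [MeasurableSpace E'] (hf : BddMeas f) {φ : E' → E}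
    (hφ : Measurable φ) : BddMeas (fun x => f (φ x)) :=
  ⟨hf.1.comp hφ, hf.2.imp fun _ h _ => h _⟩

theorem integrable (hf : BddMeas f) (μ : Measure E) [IsFiniteMeasure μ] : Integrable f μ := by
  obtain ⟨hf, C, hC⟩ := hf
  exact Integrable.of_bound hf.aestronglyMeasurable C (Filter.Eventually.of_forall fun x => hC x)

theorem memLp (hf : BddMeas f) (μ : Measure E) [IsFiniteMeasure μ] (p : ENNReal) :
    MemLp f p μ := by
  obtain ⟨hf, C, hC⟩ := hf
  exact MemLp.of_bound hf.aestronglyMeasurable C (Filter.Eventually.of_forall fun x => hC x)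

theorem integral_affine_sq (hf : BddMeas f) (hg : BddMeas g) (μ : Measure E)
    [IsProbabilityMeasure μ] (c b : ℝ) :
    ∫ x, (c + b * f x + g x) ^ 2 ∂μ = c ^ 2 + 2 * c * b * ∫ x, f x ∂μ + 2 * c * ∫ x, g x ∂μ
      + b ^ 2 * ∫ x, f x ^ 2 ∂μ + 2 * b * ∫ x, f x * g x ∂μ + ∫ x, g x ^ 2 ∂μ := by
  have e : ∀ x, (c + b * f x + g x) ^ 2 = c ^ 2 + 2 * c * b * f x + 2 * c * g x
      + b ^ 2 * f x ^ 2 + 2 * b * (f x * g x) + g x ^ 2 := fun x => by ring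
  simp_rw [e]
  have i0 : Integrable (fun _ : E => c ^ 2) μ := integrable_const _
  have i1 := (hf.integrable μ).const_mul (2 * c * b)
  have i2 := (hg.integrable μ).const_mul (2 * c)
  have i3 := ((hf.pow 2).integrable μ).const_mul (b ^ 2)
  have i4 := ((hf.mul hg).integrable μ).const_mul (2 * b)
  have i5 := (hg.pow 2).integrable μ
  rw [integral_add ((((i0.fun_add i1).fun_add i2).fun_add i3).fun_add i4) i5,
    integral_add (((i0.fun_add i1).fun_add i2).fun_add i3) i4,
    integral_add ((i0.fun_add i1).fun_add i2) i3,
    integral_add (i0.fun_add i1) i2, integral_add i0 i1]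
  simp only [integral_const_mul]
  simp

theorem integral_combination {f₁ f₂ f₃ : E → ℝ} (h₁ : BddMeas f₁) (h₂ : BddMeas f₂)
    (h₃ : BddMeas f₃) (μ : Measure E) [IsProbabilityMeasure μ] (c₁ c₂ c₃ c : ℝ) :
    ∫ x, (c₁ * f₁ x + c₂ * f₂ x + c₃ * f₃ x + c) ∂μ
      = c₁ * ∫ x, f₁ x ∂μ + c₂ * ∫ x, f₂ x ∂μ + c₃ * ∫ x, f₃ x ∂μ + c := by
  have i1 := (h₁.integrable μ).const_mul c₁
  have i2 := (h₂.integrable μ).const_mul c₂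
  have i3 := (h₃.integrable μ).const_mul c₃
  rw [integral_add ((i1.fun_add i2).fun_add i3) (integrable_const _),
    integral_add (i1.fun_add i2) i3,
    integral_add i1 i2]
  simp only [integral_const_mul]
  simp

end BddMeas

end ProductIntegrals

/-! ### Mean and variance of quadratic forms in i.i.d. variables -/

section QuadraticForms

open Matrix

variable {ν : Measure ℝ} [IsProbabilityMeasure ν]

theorem integral_pi_eval (n : ℕ) (i : Fin n) {h : ℝ → ℝ} (hh : AEStronglyMeasurable h ν) :
    ∫ x, h (x i) ∂(Measure.pi fun _ : Fin n => ν) = ∫ t, h t ∂ν :=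
  integral_comp_eval (μ := fun _ : Fin n => ν) (f := h) hh

theorem integral_pi_mul_eval {n : ℕ} {h : ℝ → ℝ} (hm : Measurable h) (hh : MemLp h 2 ν)
    (h0 : ∫ t, h t ∂ν = 0) (i j : Fin n) :
    Integrable (fun x : Fin n → ℝ => h (x i) * h (x j)) (Measure.pi fun _ : Fin n => ν) ∧
    ∫ x, h (x i) * h (x j) ∂(Measure.pi fun _ : Fin n => ν)
      = if i = j then ∫ t, h t ^ 2 ∂ν else 0 := by
  have hi : ∀ i : Fin n, MemLp (fun x : Fin n → ℝ => h (x i)) 2 (Measure.pi fun _ : Fin n => ν) :=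
    fun i => hh.comp_measurePreserving (measurePreserving_eval (fun _ : Fin n => ν) i)
  refine ⟨(hi i).integrable_mul (hi j), ?_⟩
  split_ifs with hij
  · subst hij
    simp only [← sq]
    exact integral_pi_eval n i (h := fun t => h t ^ 2) (by fun_prop)
  · have hind := (iIndepFun_pi (μ := fun _ : Fin n => ν) (X := fun _ => h)
      (fun _ => hm.aemeasurable)).indepFun hij
    rw [hind.integral_fun_mul_eq_mul_integral (hi i).1 (hi j).1,
      integral_pi_eval n i hm.aestronglyMeasurable, h0, zero_mul]

theorem integral_quadForm {n : ℕ} {h : ℝ → ℝ} (hm : Measurable h) (hh : MemLp h 2 ν)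
    (h0 : ∫ t, h t ∂ν = 0) (D : Matrix (Fin n) (Fin n) ℝ) :
    Integrable (fun x : Fin n → ℝ => ∑ i, ∑ j, D i j * (h (x i) * h (x j)))
      (Measure.pi fun _ : Fin n => ν) ∧
    ∫ x, ∑ i, ∑ j, D i j * (h (x i) * h (x j)) ∂(Measure.pi fun _ : Fin n => ν)
      = (∫ t, h t ^ 2 ∂ν) * D.trace := by
  have h1 : ∀ i j : Fin n, Integrable (fun x : Fin n → ℝ => D i j * (h (x i) * h (x j)))
      (Measure.pi fun _ : Fin n => ν) :=
    fun i j => (integral_pi_mul_eval hm hh h0 i j).1.const_mul _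
  refine ⟨integrable_finsetSum _ fun i _ => integrable_finsetSum _ fun j _ => h1 i j, ?_⟩
  rw [integral_finsetSum _ fun i _ => integrable_finsetSum _ fun j _ => h1 i j]
  have h2 : ∀ i : Fin n, ∫ x, ∑ j, D i j * (h (x i) * h (x j)) ∂(Measure.pi fun _ : Fin n => ν)
      = (∫ t, h t ^ 2 ∂ν) * D i i := by
    intro i
    rw [integral_finsetSum _ fun j _ => h1 i j]
    simp_rw [integral_const_mul, (integral_pi_mul_eval hm hh h0 _ _).2]
    simp [mul_comm]
  simp_rw [h2, ← Finset.mul_sum]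
  rfl

/-- Variance bound for quadratic forms in bounded i.i.d. centred variables. -/
theorem integral_quadForm_sub_sq_le {g : ℝ → ℝ} (hm : Measurable g) {L : ℝ}
    (hL : ∀ t, |g t| ≤ L) (h0 : ∫ t, g t ∂ν = 0) {n : ℕ} (D : Matrix (Fin n) (Fin n) ℝ)
    (hD : Dᵀ = D) :
    ∫ x, (∑ i, ∑ j, D i j * (g (x i) * g (x j)) - (∫ t, g t ^ 2 ∂ν) * D.trace) ^ 2
        ∂(Measure.pi fun _ : Fin n => ν)
      ≤ 2 * L ^ 4 * ∑ i, ∑ j, D i j ^ 2 := by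
  have hgb : BddMeas g := ⟨hm, L, hL⟩
  have hL0 : 0 ≤ L := (abs_nonneg _).trans (hL 0)
  set a := ∫ t, g t ^ 2 ∂ν with ha
  have hsq : ∀ t, g t ^ 2 ≤ L ^ 2 := fun t => by
    rw [← sq_abs]; exact pow_le_pow_left₀ (abs_nonneg _) (hL t) 2
  have ha0 : 0 ≤ a := integral_nonneg fun t => sq_nonneg _
  have haL : a ≤ L ^ 2 := by
    have := integral_mono ((hgb.pow 2).integrable ν) (integrable_const (L ^ 2)) hsq
    simpa using this
  have hqb : ∀ {m : ℕ} (D : Matrix (Fin m) (Fin m) ℝ),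
      BddMeas (fun x : Fin m → ℝ => ∑ i, ∑ j, D i j * (g (x i) * g (x j))) := fun D =>
    BddMeas.sum _ fun i => BddMeas.sum _ fun j => (BddMeas.const _).mul
      ((hgb.comp (measurable_pi_apply i)).mul (hgb.comp (measurable_pi_apply j)))
  induction n with
  | zero => simp
  | succ n ih =>
    set D' : Matrix (Fin n) (Fin n) ℝ := fun i j => D i.succ j.succ with hD'
    have hD's : D'ᵀ = D' := by ext i j; exact congrFun (congrFun hD _) _
    have hsym : ∀ i j, D i j = D j i := fun i j => (congrFun (congrFun hD j) i)
    set d : Fin n → ℝ := fun j => D 0 j.succ with hd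
    set ℓ : (Fin n → ℝ) → ℝ := fun z => ∑ j, d j * g (z j) with hℓ
    set B : (Fin n → ℝ) → ℝ := fun z =>
      ∑ i, ∑ j, D' i j * (g (z i) * g (z j)) - a * D'.trace with hB
    have hℓb : BddMeas ℓ := BddMeas.sum _ fun j => (BddMeas.const _).mul
      (hgb.comp (measurable_pi_apply j))
    have hBb : BddMeas B := (hqb D').sub (BddMeas.const _)
    set P := Measure.pi fun _ : Fin n => ν with hP
    have hiℓ : ∫ z, ℓ z ∂P = 0 := by
      rw [hℓ, integral_finsetSum _ fun j _ => ((BddMeas.const _).mul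
        (hgb.comp (measurable_pi_apply j))).integrable _]
      refine Finset.sum_eq_zero fun j _ => ?_
      rw [integral_const_mul, integral_pi_eval n j hm.aestronglyMeasurable, h0, mul_zero]
    have hiB : ∫ z, B z ∂P = 0 := by
      rw [hB, integral_sub ((hqb D').integrable _) (integrable_const _),
        (integral_quadForm hm (hgb.memLp ν 2) h0 D').2]
      simp [ha]
    have hiℓ2 : ∫ z, ℓ z ^ 2 ∂P = a * ∑ j, d j ^ 2 := by
      have := (integral_quadForm hm (hgb.memLp ν 2) h0 (Matrix.vecMulVec d d)).2
      rw [Matrix.trace_vecMulVec] at this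
      rw [show (∑ j, d j ^ 2) = d ⬝ᵥ d by simp [dotProduct, sq], ← this]
      refine integral_congr_ae (Filter.Eventually.of_forall fun z => ?_)
      simp only [hℓ, sq, Finset.sum_mul_sum, Matrix.vecMulVec_apply]
      refine Finset.sum_congr rfl fun i _ => Finset.sum_congr rfl fun j _ => by ring
    have hsplit : ∀ t z, (∑ i, ∑ j, D i j * (g ((Fin.cons t z : Fin (n + 1) → ℝ) i) *
        g ((Fin.cons t z : Fin (n + 1) → ℝ) j)) - a * D.trace)
        = D 0 0 * (g t ^ 2 - a) + 2 * g t * ℓ z + B z := by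
      intro t z
      simp only [Fin.sum_univ_succ, Fin.cons_zero, Fin.cons_succ, Matrix.trace, Matrix.diag,
        Finset.sum_add_distrib, hℓ, hB, hd, hD', mul_add, Finset.mul_sum]
      have : ∀ i : Fin n, D i.succ 0 * (g (z i) * g t) = D 0 i.succ * (g t * g (z i)) :=
        fun i => by rw [hsym i.succ 0]; ring
      have h2 : ∀ i : Fin n, 2 * g t * (D 0 i.succ * g (z i))
        = D 0 i.succ * (g t * g (z i)) + D 0 i.succ * (g t * g (z i)) := fun i => by ring
      simp_rw [this, h2, Finset.sum_add_distrib]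
      ring
    rw [integral_pi_cons ν ((((hqb D).sub (BddMeas.const _)).pow 2).integrable _)]
    simp_rw [hsplit]
    -- Splitting off the first coordinate: `ℓ` and `B` have mean zero, which kills their linear
    -- terms, and the remaining cross term `∫ ℓ B` is multiplied by `g t`, so it vanishes after
    -- integration in `t`.
    have hinner : ∀ t, ∫ z, (D 0 0 * (g t ^ 2 - a) + 2 * g t * ℓ z + B z) ^ 2 ∂P
        = (D 0 0) ^ 2 * (g t ^ 2 - a) ^ 2 + 4 * (a * ∑ j, d j ^ 2) * g t ^ 2
          + 4 * (∫ z, ℓ z * B z ∂P) * g t + ∫ z, B z ^ 2 ∂P := by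
      intro t
      rw [hℓb.integral_affine_sq hBb, hiℓ, hiB, hiℓ2]
      ring
    refine (integral_congr_ae (Filter.Eventually.of_forall hinner)).trans_le ?_
    rw [BddMeas.integral_combination (((hgb.pow 2).sub (BddMeas.const a)).pow 2) (hgb.pow 2) hgb, h0,
      ← ha]
    have hvar : ∫ t, (g t ^ 2 - a) ^ 2 ∂ν ≤ L ^ 4 := by
      have := integral_mono (μ := ν) ((((hgb.pow 2).sub (BddMeas.const a)).pow 2).integrable ν)
        (integrable_const (L ^ 4)) (fun t => by
          have h1 := hsq t
          have h2 := sq_nonneg (g t)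
          show (g t ^ 2 - a) ^ 2 ≤ L ^ 4
          have : |g t ^ 2 - a| ≤ L ^ 2 := abs_le.mpr ⟨by linarith, by linarith⟩
          calc (g t ^ 2 - a) ^ 2 = |g t ^ 2 - a| ^ 2 := (sq_abs _).symm
            _ ≤ (L ^ 2) ^ 2 := pow_le_pow_left₀ (abs_nonneg _) this 2
            _ = L ^ 4 := by ring)
      simpa using this
    have hih := ih D' hD's
    have hd2 : 0 ≤ ∑ j, d j ^ 2 := Finset.sum_nonneg fun _ _ => sq_nonneg _
    have hsum : ∑ i, ∑ j, D i j ^ 2 = D 0 0 ^ 2 + 2 * ∑ j, d j ^ 2 + ∑ i, ∑ j, D' i j ^ 2 := by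
      simp only [Fin.sum_univ_succ, Finset.sum_add_distrib, hd, hD']
      have : ∀ i : Fin n, D i.succ 0 ^ 2 = D 0 i.succ ^ 2 := fun i => by rw [hsym i.succ 0]
      simp_rw [this]; ring
    rw [hsum]
    have haa : a * a ≤ L ^ 4 := by nlinarith
    have t1 : D 0 0 ^ 2 * ∫ t, (g t ^ 2 - a) ^ 2 ∂ν ≤ D 0 0 ^ 2 * L ^ 4 :=
      mul_le_mul_of_nonneg_left hvar (sq_nonneg _)
    have t2 : a * a * ∑ j, d j ^ 2 ≤ L ^ 4 * ∑ j, d j ^ 2 := mul_le_mul_of_nonneg_right haa hd2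
    have t3 : 0 ≤ D 0 0 ^ 2 * L ^ 4 := by positivity
    have t4 : ∫ z, B z ^ 2 ∂P ≤ 2 * L ^ 4 * ∑ i, ∑ j, D' i j ^ 2 := hih
    linarith

end QuadraticForms

/-! ### Truncation of a standard law -/

section Truncation

variable {ν : Measure ℝ}

/-- Centred laws on `ℝ` with unit variance. -/
structure IsStandardLaw (ν : Measure ℝ) : Prop where
  memLp : MemLp (id : ℝ → ℝ) 2 ν
  mean : ∫ x, x ∂ν = 0
  variance : ∫ x, x ^ 2 ∂ν = 1

theorem measurable_cutBelow (M : ℝ) : Measurable (cutBelow M (id : ℝ → ℝ)) :=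
  measurable_id.indicator (measurableSet_le (by fun_prop) measurable_const)

theorem measurable_cutAbove (M : ℝ) : Measurable (cutAbove M (id : ℝ → ℝ)) :=
  measurable_id.indicator (measurableSet_lt measurable_const (by fun_prop))

theorem cutBelow_add_cutAbove (M x : ℝ) : cutBelow M id x + cutAbove M id x = x := by
  by_cases h : |x| ≤ M
  · simp [cutBelow, cutAbove, Set.indicator, h, not_lt.mpr h]
  · simp [cutBelow, cutAbove, Set.indicator, h, not_le.mp h]

theorem abs_cutBelow_le {M : ℝ} (hM : 0 ≤ M) (x : ℝ) : |cutBelow M id x| ≤ M := by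
  by_cases h : |x| ≤ M <;> simp [cutBelow, Set.indicator, h, hM]

theorem bddMeas_cutBelow {M : ℝ} (hM : 0 ≤ M) : BddMeas (cutBelow M (id : ℝ → ℝ)) :=
  ⟨measurable_cutBelow M, M, abs_cutBelow_le hM⟩

theorem measurable_centeredTruncation (M : ℝ) : Measurable (centeredTruncation ν M id) :=
  (measurable_cutBelow M).sub measurable_const

theorem measurable_truncationTail (M : ℝ) : Measurable (truncationTail ν M id) :=
  (measurable_cutAbove M).add measurable_const

theorem centeredTruncation_add_truncationTail (M x : ℝ) :
    centeredTruncation ν M id x + truncationTail ν M id x = x := by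
  have := cutBelow_add_cutAbove M x
  unfold centeredTruncation truncationTail
  linarith

variable [IsProbabilityMeasure ν]

theorem abs_centeredTruncation_le {M : ℝ} (hM : 0 ≤ M) (x : ℝ) :
    |centeredTruncation ν M id x| ≤ 2 * M := by
  have h1 := abs_cutBelow_le hM x
  have h2 : |∫ ω, cutBelow M id ω ∂ν| ≤ M := by
    have := norm_integral_le_of_norm_le_const (μ := ν) (C := M) (f := cutBelow M (id : ℝ → ℝ))
      (Filter.Eventually.of_forall fun x => abs_cutBelow_le hM x)
    simpa using this
  calc _ ≤ |cutBelow M id x| + |∫ ω, cutBelow M id ω ∂ν| := abs_sub _ _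
    _ ≤ _ := by linarith

theorem integral_centeredTruncation {M : ℝ} (hM : 0 ≤ M) :
    ∫ x, centeredTruncation ν M id x ∂ν = 0 := by
  unfold centeredTruncation
  rw [integral_sub ((bddMeas_cutBelow hM).integrable ν) (integrable_const _)]
  simp

theorem IsStandardLaw.memLp_truncationTail (hν : IsStandardLaw ν) {M : ℝ} (hM : 0 ≤ M) :
    MemLp (truncationTail ν M id) 2 ν := by
  have : truncationTail ν M id = fun x => id x - centeredTruncation ν M id x := by
    ext x; have := centeredTruncation_add_truncationTail (ν := ν) M x; simp only [id]; linarith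
  rw [this]
  exact hν.memLp.sub (BddMeas.memLp ⟨measurable_centeredTruncation M, _,
    abs_centeredTruncation_le hM⟩ ν 2)

theorem IsStandardLaw.integral_truncationTail (hν : IsStandardLaw ν) {M : ℝ} (hM : 0 ≤ M) :
    ∫ x, truncationTail ν M id x ∂ν = 0 := by
  have h1 : ∀ x, truncationTail ν M id x = x - centeredTruncation ν M id x := fun x => by
    have := centeredTruncation_add_truncationTail (ν := ν) M x; linarith
  simp_rw [h1]
  have hi : Integrable (fun x : ℝ => x) ν := hν.memLp.integrable (by norm_num)
  rw [integral_sub hi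
    (BddMeas.integrable ⟨measurable_centeredTruncation M, _, abs_centeredTruncation_le hM⟩ ν),
    hν.mean, integral_centeredTruncation hM, sub_zero]

theorem IsStandardLaw.integral_centeredTruncation_sq_le (hν : IsStandardLaw ν) {M : ℝ}
    (hM : 0 ≤ M) : ∫ x, centeredTruncation ν M id x ^ 2 ∂ν ≤ 1 := by
  have hb := bddMeas_cutBelow hM
  set c := ∫ x, cutBelow M id x ∂ν with hc
  have h1 : ∀ x, centeredTruncation ν M id x ^ 2
      = cutBelow M id x ^ 2 - 2 * c * cutBelow M id x + c ^ 2 := fun x => by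
    simp only [centeredTruncation, ← hc]; ring
  simp_rw [h1]
  have i1 : Integrable (fun x => cutBelow M id x ^ 2 - 2 * c * cutBelow M id x) ν :=
    ((hb.pow 2).integrable ν).sub ((hb.integrable ν).const_mul _)
  rw [integral_add i1
    (integrable_const _), integral_sub ((hb.pow 2).integrable ν) ((hb.integrable ν).const_mul _),
    integral_const_mul, ← hc]
  have h2 : ∫ x, cutBelow M id x ^ 2 ∂ν ≤ ∫ x, x ^ 2 ∂ν := by
    refine integral_mono ((hb.pow 2).integrable ν) hν.memLp.integrable_sq fun x => ?_
    by_cases h : |x| ≤ M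
    · simp [cutBelow, Set.indicator, h]
    · simp [cutBelow, Set.indicator, h]; positivity
  rw [hν.variance] at h2
  simp
  nlinarith [sq_nonneg c]

/-- Dominated convergence. The level depends on the law itself, and this is how the distribution of
ξ enters N₀. -/
theorem IsStandardLaw.exists_integral_truncationTail_sq_le (hν : IsStandardLaw ν) {ε : ℝ}
    (hε : 0 < ε) : ∃ L : ℝ, 0 < L ∧ ∫ x, truncationTail ν L id x ^ 2 ∂ν ≤ ε := by
  have hlim : Filter.Tendsto (fun k : ℕ => ∫ x, cutAbove (k : ℝ) id x ^ 2 ∂ν) Filter.atTop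
      (nhds (∫ _, (0 : ℝ) ∂ν)) := by
    refine tendsto_integral_of_dominated_convergence (fun x => x ^ 2)
      (fun k => ((measurable_cutAbove _).pow_const 2).aestronglyMeasurable)
      hν.memLp.integrable_sq (fun k => Filter.Eventually.of_forall fun x => ?_)
      (Filter.Eventually.of_forall fun x => ?_)
    · by_cases h : (k : ℝ) < |x| <;> simp [cutAbove, Set.indicator, h, sq_nonneg]
    · refine tendsto_const_nhds.congr' ?_
      obtain ⟨k₀, hk₀⟩ := exists_nat_ge |x|
      filter_upwards [Filter.eventually_ge_atTop k₀] with k hk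
      have : ¬ (k : ℝ) < |x| := not_lt.mpr (hk₀.trans (by exact_mod_cast hk))
      simp [cutAbove, Set.indicator, this]
  simp only [integral_zero] at hlim
  obtain ⟨k, hk, hk1⟩ := ((hlim.eventually (gt_mem_nhds hε)).and
    (Filter.eventually_ge_atTop 1)).exists
  have hk0 : (0 : ℝ) < k := by exact_mod_cast hk1
  refine ⟨k, hk0, le_trans ?_ hk.le⟩
  set M : ℝ := (k : ℝ)
  have hb := bddMeas_cutBelow hk0.le
  set c := ∫ x, cutBelow M id x ∂ν with hc
  have ha : MemLp (cutAbove M id) 2 ν := by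
    have : cutAbove M id = fun x => id x - cutBelow M id x := by
      ext x; have := cutBelow_add_cutAbove M x; simp only [id]; linarith
    rw [this]; exact hν.memLp.sub (hb.memLp ν 2)
  -- The added constant only helps: the two cut parts have opposite means, so the second moment of
  -- the tail is that of `cutAbove` minus `c ^ 2`.
  have hca : ∫ x, cutAbove M id x ∂ν = -c := by
    have : ∀ x, cutAbove M id x = x - cutBelow M id x := fun x => by
      have := cutBelow_add_cutAbove M x; linarith
    simp_rw [this]
    have hi : Integrable (fun x : ℝ => x) ν := hν.memLp.integrable (by norm_num)
    rw [integral_sub hi (hb.integrable ν), hν.mean, ← hc, zero_sub]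
  have h1 : ∀ x, truncationTail ν M id x ^ 2
      = cutAbove M id x ^ 2 + 2 * c * cutAbove M id x + c ^ 2 := fun x => by
    simp only [truncationTail, ← hc]; ring
  simp_rw [h1]
  rw [integral_add (ha.integrable_sq.fun_add ((ha.integrable (by norm_num)).const_mul _))
    (integrable_const _), integral_add ha.integrable_sq
    ((ha.integrable (by norm_num)).const_mul _), integral_const_mul, hca]
  simp
  nlinarith [sq_nonneg c]

end Truncation

/-! ### Quadratic forms in spectral coordinates -/

section SpectralQuadraticForms

open Matrix

variable {ν : Measure ℝ} [IsProbabilityMeasure ν]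

/-- The quadratic form `x ↦ xᵀ U diag(d) Uᵀ x`. -/
noncomputable def specQuad {n : ℕ} (U : Matrix (Fin n) (Fin n) ℝ) (d : Fin n → ℝ)
    (x : Fin n → ℝ) : ℝ :=
  ∑ j, d j * (Uᵀ *ᵥ x) j ^ 2

variable {n : ℕ} {U : Matrix (Fin n) (Fin n) ℝ} {d : Fin n → ℝ}

theorem specQuad_nonneg (hd : ∀ j, 0 ≤ d j) (x : Fin n → ℝ) : 0 ≤ specQuad U d x :=
  Finset.sum_nonneg fun j _ => mul_nonneg (hd j) (sq_nonneg _)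

/-- Follows from 2ab ≤ ta² + b²/t in each coordinate. A small `t` keeps the coefficient of the main
part close to one. -/
theorem specQuad_add_le (hd : ∀ j, 0 ≤ d j) (x y : Fin n → ℝ) {t : ℝ} (ht : 0 < t) :
    specQuad U d (x + y) ≤ (1 + t) * specQuad U d x + (1 + 1 / t) * specQuad U d y := by
  simp only [specQuad, Finset.mul_sum, ← Finset.sum_add_distrib, Matrix.mulVec_add, Pi.add_apply]
  refine Finset.sum_le_sum fun j _ => ?_
  set a := (Uᵀ *ᵥ x) j
  set b := (Uᵀ *ᵥ y) j
  have : (a + b) ^ 2 ≤ (1 + t) * a ^ 2 + (1 + 1 / t) * b ^ 2 := by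
    have h : (1 + t) * a ^ 2 + (1 + 1 / t) * b ^ 2 - (a + b) ^ 2 = (t * a - b) ^ 2 / t := by
      field_simp; ring
    have h2 : 0 ≤ (t * a - b) ^ 2 / t := by positivity
    linarith
  nlinarith [mul_le_mul_of_nonneg_left this (hd j)]

theorem specQuad_eq_sum (x : Fin n → ℝ) :
    specQuad U d x = ∑ i, ∑ j, specMat (𝕜 := ℝ) U d i j * (x i * x j) := by
  have h := dotProduct_specMat_mulVec (𝕜 := ℝ) U d x
  have h2 : liftVec ℝ x = x := rfl
  rw [h2] at h
  have h3 : specQuad U d x = ∑ j, d j * algebraMap ℝ ℝ ((Uᵀ *ᵥ x) j ^ 2) := rfl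
  rw [h3, ← h]
  simp only [dotProduct, Matrix.mulVec, Finset.mul_sum]
  refine Finset.sum_congr rfl fun i _ => Finset.sum_congr rfl fun j _ => by ring

/-- The Frobenius norm is invariant under orthogonal conjugation; this turns the variance bound for
quadratic forms into a condition on the weights. -/
theorem sum_sq_specMat (hU : Uᵀ * U = 1) :
    ∑ i, ∑ j, specMat (𝕜 := ℝ) U d i j ^ 2 = ∑ j, d j ^ 2 := by
  have h := trace_specMat (𝕜 := ℝ) hU (d * d)
  rw [← specMat_mul hU] at h
  have h2 : ∑ j, d j ^ 2 = ∑ j, (d * d) j := by simp [sq]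
  rw [h2, ← h]
  simp only [Matrix.trace, Matrix.diag, Matrix.mul_apply]
  refine Finset.sum_congr rfl fun i _ => Finset.sum_congr rfl fun j _ => ?_
  rw [sq]
  congr 1
  exact congrFun (congrFun (transpose_specMat (𝕜 := ℝ) U d) j) i

theorem measurable_specQuad (U : Matrix (Fin n) (Fin n) ℝ) (d : Fin n → ℝ) :
    Measurable (specQuad U d) := by
  have : specQuad U d = fun x => ∑ i, ∑ j, specMat (𝕜 := ℝ) U d i j * (x i * x j) := by
    ext x; exact specQuad_eq_sum x
  rw [this]; fun_prop

theorem integral_specQuad {h : ℝ → ℝ} (hm : Measurable h) (hh : MemLp h 2 ν)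
    (h0 : ∫ t, h t ∂ν = 0) (hU : Uᵀ * U = 1) :
    Integrable (fun x : Fin n → ℝ => specQuad U d (fun i => h (x i)))
      (Measure.pi fun _ : Fin n => ν) ∧
    ∫ x, specQuad U d (fun i => h (x i)) ∂(Measure.pi fun _ : Fin n => ν)
      = (∫ t, h t ^ 2 ∂ν) * ∑ j, d j := by
  simp_rw [specQuad_eq_sum]
  rw [← trace_specMat hU d]
  exact integral_quadForm hm hh h0 _

theorem integral_specQuad_sub_sq_le {g : ℝ → ℝ} (hm : Measurable g) {L : ℝ}
    (hL : ∀ t, |g t| ≤ L) (h0 : ∫ t, g t ∂ν = 0) (hU : Uᵀ * U = 1) :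
    Integrable (fun x : Fin n → ℝ => (specQuad U d (fun i => g (x i))
      - (∫ t, g t ^ 2 ∂ν) * ∑ j, d j) ^ 2) (Measure.pi fun _ : Fin n => ν) ∧
    ∫ x, (specQuad U d (fun i => g (x i)) - (∫ t, g t ^ 2 ∂ν) * ∑ j, d j) ^ 2
        ∂(Measure.pi fun _ : Fin n => ν)
      ≤ 2 * L ^ 4 * ∑ j, d j ^ 2 := by
  simp_rw [specQuad_eq_sum]
  rw [← trace_specMat hU d, ← sum_sq_specMat hU]
  have hgb : BddMeas g := ⟨hm, L, hL⟩
  refine ⟨BddMeas.integrable (((BddMeas.sum _ fun i => BddMeas.sum _ fun j =>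
    (BddMeas.const _).mul ((hgb.comp (measurable_pi_apply i)).mul
      (hgb.comp (measurable_pi_apply j)))).sub (BddMeas.const _)).pow 2) _, ?_⟩
  exact integral_quadForm_sub_sq_le hm hL h0 _ (transpose_specMat (𝕜 := ℝ) U d)

/-- The truncated mean of a normalized quadratic form is bounded below in terms of the tail. -/
theorem IsStandardLaw.le_integral_min_specQuad (hν : IsStandardLaw ν) {M : ℝ} (hM : 0 ≤ M)
    (hU : Uᵀ * U = 1) (hd : ∀ j, 0 ≤ d j) (hd1 : ∑ j, d j = 1) {Δ : ℝ} (hΔ : 0 < Δ) :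
    1 - 2 * ∫ x, truncationTail ν M id x ^ 2 ∂ν - 4 * (2 + 4 * (2 * M) ^ 4) / Δ
      ≤ ∫ x, min (specQuad U d x) Δ ∂(Measure.pi fun _ : Fin n => ν) := by
  set P := Measure.pi fun _ : Fin n => ν with hP
  set g := centeredTruncation ν M id with hg
  set θ := truncationTail ν M id with hθ
  have hgm : Measurable g := measurable_centeredTruncation M
  have hgL := abs_centeredTruncation_le (ν := ν) hM
  have hg0 : ∫ x, g x ∂ν = 0 := integral_centeredTruncation hM
  obtain ⟨i1, e1⟩ := integral_specQuad (d := d) measurable_id hν.memLp hν.mean hU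
  obtain ⟨i2, e2⟩ := integral_specQuad (d := d) (measurable_truncationTail M)
    (hν.memLp_truncationTail hM) (hν.integral_truncationTail hM) hU
  obtain ⟨i3, e3⟩ := integral_specQuad_sub_sq_le (d := d) hgm hgL hg0 hU
  set a := ∫ t, g t ^ 2 ∂ν with ha
  have ha1 : a ≤ 1 := hν.integral_centeredTruncation_sq_le hM
  have ha0 : 0 ≤ a := integral_nonneg fun t => sq_nonneg _
  simp only [id, hν.variance, hd1, mul_one] at e1 e2 e3 i3 i1
  have hdsq : ∑ j, d j ^ 2 ≤ 1 := by
    rw [← hd1]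
    refine Finset.sum_le_sum fun j _ => ?_
    have : d j ≤ 1 := hd1 ▸ Finset.single_le_sum (fun j _ => hd j) (Finset.mem_univ j)
    nlinarith [hd j]
  -- With `W`, `Y`, `Z` the forms at x, g(x), θ(x), one has W ≤ 2Y + 2Z, so (W - Δ)₊ ≤ 2Z + (2Y -
  -- Δ)₊ and (2Y - Δ)₊ ≤ 4Y²/Δ. Thus the heavy part `Z` is needed in L¹ only, and the bounded part
  -- `Y` in L².
  have hpt : ∀ x, specQuad U d x - 2 * specQuad U d (fun i => θ (x i))
      - (4 / Δ) * (2 + 2 * (specQuad U d (fun i => g (x i)) - a) ^ 2)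
      ≤ min (specQuad U d x) Δ := by
    intro x
    have hx : x = (fun i => g (x i)) + (fun i => θ (x i)) := by
      ext i; exact (centeredTruncation_add_truncationTail M (x i)).symm
    have hle := specQuad_add_le (U := U) hd (fun i => g (x i)) (fun i => θ (x i)) one_pos
    rw [← hx] at hle
    set W := specQuad U d x
    set Y := specQuad U d (fun i => g (x i))
    have hZ : 0 ≤ specQuad U d (fun i => θ (x i)) := specQuad_nonneg hd _
    set Z := specQuad U d (fun i => θ (x i))
    have hY2 : Y ^ 2 ≤ 2 + 2 * (Y - a) ^ 2 := by nlinarith [sq_nonneg (Y - 2 * a)]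
    have hq : (4 / Δ) * Y ^ 2 ≤ (4 / Δ) * (2 + 2 * (Y - a) ^ 2) :=
      mul_le_mul_of_nonneg_left hY2 (by positivity)
    have hy0 : 0 ≤ (4 / Δ) * Y ^ 2 := by positivity
    rw [le_min_iff]
    constructor
    · linarith
    · have : 2 * Y - Δ ≤ (4 / Δ) * Y ^ 2 := by
        have h : (4 / Δ) * Y ^ 2 - (2 * Y - Δ) = ((2 * Y - Δ / 2) ^ 2 + 3 / 4 * Δ ^ 2) / Δ := by
          field_simp; ring
        have h2 : 0 ≤ ((2 * Y - Δ / 2) ^ 2 + 3 / 4 * Δ ^ 2) / Δ := by positivity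
        linarith
      linarith
  have imin : Integrable (fun x => min (specQuad U d x) Δ) P := by
    refine Integrable.mono' (integrable_const Δ)
      ((measurable_specQuad U d).min measurable_const).aestronglyMeasurable
      (Filter.Eventually.of_forall fun x => ?_)
    rw [Real.norm_of_nonneg (le_min (specQuad_nonneg hd x) hΔ.le)]
    exact min_le_right _ _
  have i5 : Integrable (fun x => specQuad U d x - 2 * specQuad U d (fun i => θ (x i))) P :=
    i1.sub (i2.const_mul 2)
  have i6 : Integrable (fun x => (4 / Δ) * (2 + 2 * (specQuad U d (fun i => g (x i)) - a) ^ 2)) P :=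
    ((integrable_const (2 : ℝ)).add (i3.const_mul 2)).const_mul (4 / Δ)
  have hmono := integral_mono (i5.sub i6) imin hpt
  refine le_trans ?_ hmono
  have heq : ∫ x, (specQuad U d x - 2 * specQuad U d (fun i => θ (x i))
      - (4 / Δ) * (2 + 2 * (specQuad U d (fun i => g (x i)) - a) ^ 2)) ∂P
      = 1 - 2 * ∫ t, θ t ^ 2 ∂ν
        - (4 / Δ) * (2 + 2 * ∫ x, (specQuad U d (fun i => g (x i)) - a) ^ 2 ∂P) := by
    rw [integral_sub i5 i6, integral_sub i1 (i2.const_mul 2),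
      integral_const_mul, integral_const_mul, integral_add (integrable_const (2 : ℝ))
      (i3.const_mul 2), integral_const_mul, e1, e2]
    simp only [integral_const, probReal_univ, one_smul]
    rfl
  refine le_trans ?_ heq.ge
  have hv : ∫ x, (specQuad U d (fun i => g (x i)) - a) ^ 2 ∂P ≤ 2 * (2 * M) ^ 4 := by
    refine e3.trans ?_
    have : 0 ≤ 2 * (2 * M) ^ 4 := by positivity
    nlinarith
  have h5 : (4 / Δ) * (2 + 2 * ∫ x, (specQuad U d (fun i => g (x i)) - a) ^ 2 ∂P)
      ≤ 4 * (2 + 4 * (2 * M) ^ 4) / Δ := by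
    rw [mul_div_right_comm]
    refine mul_le_mul_of_nonneg_left (by linarith) (by positivity)
  linarith

/-- A weak law for quadratic forms: upper tails are negligible when the Frobenius norm is small. -/
theorem IsStandardLaw.exists_specQuad_tail_le (hν : IsStandardLaw ν) {φ ε ε' : ℝ} (hφ : 0 < φ)
    (hε : 0 < ε) (hε' : 0 < ε') :
    ∃ κ : ℝ, 0 < κ ∧ ∀ (n : ℕ) (U : Matrix (Fin n) (Fin n) ℝ) (d : Fin n → ℝ), Uᵀ * U = 1 →
      (∀ j, 0 ≤ d j) → ∑ j, d j ≤ φ → ∑ j, d j ^ 2 ≤ κ →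
      (Measure.pi fun _ : Fin n => ν).real {x | ∑ j, d j + ε < specQuad U d x} ≤ ε' := by
  -- The factor 1 + t costs the bounded part at most ε/4 beyond its mean, and `z` below is the level
  -- at which the heavy part contributes ε/2.
  set t := min 1 (ε / (4 * φ)) with ht
  have ht0 : 0 < t := lt_min one_pos (by positivity)
  have ht1 : t ≤ 1 := min_le_left _ _
  have ht2 : t * φ ≤ ε / 4 := by
    have : t ≤ ε / (4 * φ) := min_le_right _ _
    calc t * φ ≤ ε / (4 * φ) * φ := mul_le_mul_of_nonneg_right this hφ.le
      _ = ε / 4 := by field_simp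
  set z := ε / 2 / (1 + 1 / t) with hz
  have hz0 : 0 < z := by positivity
  obtain ⟨L, hL0, hL⟩ := hν.exists_integral_truncationTail_sq_le
    (ε := ε' / 2 * z / φ) (by positivity)
  refine ⟨ε' / 2 * (ε / 8) ^ 2 / (2 * (2 * L) ^ 4), by positivity, ?_⟩
  intro n U d hU hd hdφ hdκ
  set P := Measure.pi fun _ : Fin n => ν with hP
  set g := centeredTruncation ν L id with hg
  set θ := truncationTail ν L id with hθ
  obtain ⟨i2, e2⟩ := integral_specQuad (d := d) (measurable_truncationTail L)
    (hν.memLp_truncationTail hL0.le) (hν.integral_truncationTail hL0.le) hU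
  obtain ⟨i3, e3⟩ := integral_specQuad_sub_sq_le (d := d) (measurable_centeredTruncation L)
    (abs_centeredTruncation_le (ν := ν) hL0.le) (integral_centeredTruncation hL0.le) hU
  set a := ∫ t, g t ^ 2 ∂ν with ha
  have ha1 : a ≤ 1 := hν.integral_centeredTruncation_sq_le hL0.le
  set T := ∑ j, d j with hT
  have hT0 : 0 ≤ T := Finset.sum_nonneg fun j _ => hd j
  have hsub : {x | T + ε < specQuad U d x}
      ⊆ {x | z ≤ specQuad U d (fun i => θ (x i))}
        ∪ {x | (ε / 8) ^ 2 ≤ (specQuad U d (fun i => g (x i)) - a * T) ^ 2} := by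
    intro x hx
    simp only [Set.mem_ofPred_eq] at hx
    by_contra hcon
    simp only [Set.mem_union, Set.mem_ofPred_eq, not_or, not_le] at hcon
    obtain ⟨c1, c2⟩ := hcon
    have hxx : x = (fun i => g (x i)) + (fun i => θ (x i)) := by
      ext i; exact (centeredTruncation_add_truncationTail L (x i)).symm
    have hle := specQuad_add_le (U := U) hd (fun i => g (x i)) (fun i => θ (x i)) ht0
    rw [← hxx] at hle
    have c3 : (1 + 1 / t) * specQuad U d (fun i => θ (x i)) < ε / 2 := by
      rw [hz, lt_div_iff₀ (by positivity)] at c1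
      linarith
    have c4 : specQuad U d (fun i => g (x i)) - a * T < ε / 8 :=
      lt_of_pow_lt_pow_left₀ 2 (by positivity) c2
    have c5 : a * T ≤ T := by nlinarith
    have c6 : (1 + t) * specQuad U d (fun i => g (x i)) ≤ (1 + t) * (T + ε / 8) :=
      mul_le_mul_of_nonneg_left (by linarith) (by linarith)
    have c7 : t * T ≤ t * φ := mul_le_mul_of_nonneg_left hdφ ht0.le
    nlinarith
  have m1 := mul_meas_ge_le_integral_of_nonneg
    (Filter.Eventually.of_forall fun x : Fin n → ℝ => specQuad_nonneg (U := U) hd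
      (fun i => θ (x i))) i2 z
  have m2 := mul_meas_ge_le_integral_of_nonneg
    (Filter.Eventually.of_forall fun x : Fin n → ℝ =>
      sq_nonneg (specQuad U d (fun i => g (x i)) - a * T)) i3 ((ε / 8) ^ 2)
  have hb1 : P.real {x | z ≤ specQuad U d (fun i => θ (x i))} ≤ ε' / 2 := by
    rw [e2] at m1
    have : (∫ t, θ t ^ 2 ∂ν) * T ≤ ε' / 2 * z := by
      calc _ ≤ ε' / 2 * z / φ * φ := mul_le_mul hL hdφ hT0 (by positivity)
        _ = _ := by field_simp
    have h3 := m1.trans this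
    rw [mul_comm] at h3
    exact le_of_mul_le_mul_right h3 hz0
  have hb2 : P.real {x | (ε / 8) ^ 2 ≤ (specQuad U d (fun i => g (x i)) - a * T) ^ 2}
      ≤ ε' / 2 := by
    have : 2 * (2 * L) ^ 4 * ∑ j, d j ^ 2 ≤ ε' / 2 * (ε / 8) ^ 2 := by
      rw [le_div_iff₀ (by positivity)] at hdκ
      linarith
    have h3 := (m2.trans e3).trans this
    rw [mul_comm] at h3
    exact le_of_mul_le_mul_right h3 (by positivity)
  calc P.real {x | T + ε < specQuad U d x}
      ≤ _ := measureReal_mono hsub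
    _ ≤ _ := measureReal_union_le _ _
    _ ≤ ε' := by linarith

end SpectralQuadraticForms

/-! ### Scalar inequalities for the barrier potential -/

section BarrierAlgebra

/-- The right side is the drop of tr R + K tr R² under a rank-one update, with `q`, `r`, `s` the
quadratic forms of R, R², R³ at the new row. The only harmful term is the one with K r². By `hKr`, K
r is at most P up to an error charged to `s`, and the term then merely enlarges the denominator from
1 + q to 1 + q + P. -/
theorem rankOne_decrement_ge {q r s K P ε : ℝ} (hq : 0 ≤ q) (hr : 0 ≤ r) (hs : 0 ≤ s) (hK : 0 ≤ K)
    (hP : 0 ≤ P) (hε : 0 ≤ ε) (hrs : r ^ 2 ≤ s * q) (hKr : K * r ^ 2 ≤ P * r + 2 * ε * (K * s)) :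
    (1 - ε) * (r + 2 * K * s) / (1 + q + P)
      ≤ r / (1 + q) + K * (2 * s / (1 + q) - r ^ 2 / (1 + q) ^ 2) := by
  set p := 1 + q with hp
  have hp1 : 1 ≤ p := by linarith
  have hp0 : 0 < p := by linarith
  have hKs : 0 ≤ K * s := mul_nonneg hK hs
  have h1 : K * r ^ 2 * (p + P) ≤ p * (P + ε) * (r + 2 * K * s) := by
    have a1 : K * r ^ 2 * p ≤ (P * r + 2 * ε * (K * s)) * p :=
      mul_le_mul_of_nonneg_right hKr hp0.le
    have a2 : K * r ^ 2 * P ≤ K * (s * p) * P :=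
      mul_le_mul_of_nonneg_right (mul_le_mul_of_nonneg_left
        (hrs.trans (mul_le_mul_of_nonneg_left (by linarith) hs)) hK) hP
    have a3 : 0 ≤ p * ε * r := by positivity
    have a4 : 0 ≤ p * P * (K * s) := by positivity
    nlinarith
  have h2 : r / p + K * (2 * s / p - r ^ 2 / p ^ 2) - (1 - ε) * (r + 2 * K * s) / (p + P)
      = (p * (P + ε) * (r + 2 * K * s) - K * r ^ 2 * (p + P)
        + p * ε * (p - 1) * (r + 2 * K * s)) / (p ^ 2 * (p + P)) := by
    have : p + P ≠ 0 := by positivity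
    field_simp
    ring
  have h3 : 0 ≤ p * ε * (p - 1) * (r + 2 * K * s) := by
    have : 0 ≤ p - 1 := by linarith
    have : 0 ≤ r + 2 * K * s := by linarith
    positivity
  have h4 : 0 ≤ (p * (P + ε) * (r + 2 * K * s) - K * r ^ 2 * (p + P)
        + p * ε * (p - 1) * (r + 2 * K * s)) / (p ^ 2 * (p + P)) :=
    div_nonneg (by linarith) (by positivity)
  linarith

/-- Cauchy–Schwarz, since b² is the geometric mean of b³ and b. -/
theorem sq_sum_mul_sq_le {ι : Type*} [Fintype ι] {b y : ι → ℝ} (hb : ∀ j, 0 ≤ b j)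
    (hy : ∀ j, 0 ≤ y j) :
    (∑ j, b j ^ 2 * y j) ^ 2 ≤ (∑ j, b j ^ 3 * y j) * ∑ j, b j * y j := by
  refine Finset.sum_sq_le_sum_mul_sum_of_sq_le_mul _
    (fun j _ => mul_nonneg (pow_nonneg (hb j) 3) (hy j)) (fun j _ => mul_nonneg (hb j) (hy j))
    fun j _ => le_of_eq (by ring)

/-- Primed sums belong to the shifted barrier and agree with the unprimed ones up to powers of η.
The part `rb` of `r` from small resolvent eigenvalues is controlled by its mean, the rest is at most
`G * s`. Hence P = η²(Kρ + ε) is admissible, and the potential bound T + Kρ ≤ φ turns the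
denominator into η²(1 + φ + 2ε). -/
theorem rankOne_decrement_ge_shift {T ρ D q' r r' s s' rb K ε G φ δ η : ℝ} (hK : 0 < K)
    (hε : 0 ≤ ε) (hε8 : ε ≤ 1 / 8) (hG : 0 < G) (hη1 : 1 ≤ η) (hη2 : η ≤ 2)
    (hT0 : 0 ≤ T) (hρ0 : 0 ≤ ρ) (hD0 : 0 ≤ D) (hδ : 0 ≤ δ) (hφ : T + K * ρ ≤ φ)
    (hs0 : 0 ≤ s) (hq'0 : 0 ≤ q') (hr'0 : 0 ≤ r') (hs's : s ≤ s') (hr'r : r ≤ r')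
    (hq' : q' ≤ η * (T + ε)) (hrη : r' ≤ η ^ 2 * r) (hrrb : r ≤ rb + G * s)
    (hrs : r' ^ 2 ≤ s' * q') (h2 : K * rb ≤ K * ρ + ε) (h3 : G * r ≤ ε)
    (hδW : δ * D ≤ (1 - 8 * ε) / (η ^ 4 * (1 + φ + 2 * ε)) * (r + 2 * K * s)) :
    δ * η ^ 2 * D ≤ r' / (1 + q') + K * (2 * s' / (1 + q') - r' ^ 2 / (1 + q') ^ 2) := by
  have hKρ : 0 ≤ K * ρ := mul_nonneg hK.le hρ0
  have hφ0 : 0 ≤ φ := by linarith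
  have hη0 : 0 ≤ η := by linarith
  have hKs : 0 ≤ K * s := mul_nonneg hK.le hs0
  have hKs' : K * s ≤ K * s' := mul_le_mul_of_nonneg_left hs's hK.le
  have hη20 : 0 ≤ η ^ 2 := sq_nonneg η
  have hP : 0 ≤ η ^ 2 * (K * ρ + ε) := mul_nonneg hη20 (by linarith)
  have hKr : K * r' ^ 2 ≤ η ^ 2 * (K * ρ + ε) * r' + 2 * (8 * ε) * (K * s') := by
    have e1 : r' ≤ η ^ 2 * (rb + G * s) := hrη.trans (mul_le_mul_of_nonneg_left hrrb hη20)
    have e2 : K * r' * r' ≤ K * r' * (η ^ 2 * (rb + G * s)) :=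
      mul_le_mul_of_nonneg_left e1 (mul_nonneg hK.le hr'0)
    have e3 : η ^ 2 * r' * (K * rb) ≤ η ^ 2 * r' * (K * ρ + ε) :=
      mul_le_mul_of_nonneg_left h2 (mul_nonneg hη20 hr'0)
    have e4 : G * r' ≤ η ^ 2 * ε := by
      calc G * r' ≤ G * (η ^ 2 * r) := mul_le_mul_of_nonneg_left hrη hG.le
        _ = η ^ 2 * (G * r) := by ring
        _ ≤ _ := mul_le_mul_of_nonneg_left h3 hη20
    have e5 : η ^ 2 * (K * s) * (G * r') ≤ η ^ 2 * (K * s) * (η ^ 2 * ε) :=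
      mul_le_mul_of_nonneg_left e4 (mul_nonneg hη20 hKs)
    have e6 : η ^ 2 * (K * s) * (η ^ 2 * ε) ≤ 2 * (8 * ε) * (K * s') := by
      have h4 : η ^ 4 ≤ 2 ^ 4 := pow_le_pow_left₀ hη0 hη2 4
      calc η ^ 2 * (K * s) * (η ^ 2 * ε) = η ^ 4 * (ε * (K * s)) := by ring
        _ ≤ 2 ^ 4 * (ε * (K * s)) := mul_le_mul_of_nonneg_right h4 (mul_nonneg hε hKs)
        _ ≤ 2 ^ 4 * (ε * (K * s')) :=
          mul_le_mul_of_nonneg_left (mul_le_mul_of_nonneg_left hKs' hε) (by norm_num)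
        _ = _ := by ring
    calc K * r' ^ 2 = K * r' * r' := by ring
      _ ≤ K * r' * (η ^ 2 * (rb + G * s)) := e2
      _ = η ^ 2 * r' * (K * rb) + η ^ 2 * (K * s) * (G * r') := by ring
      _ ≤ η ^ 2 * r' * (K * ρ + ε) + 2 * (8 * ε) * (K * s') := add_le_add e3 (e5.trans e6)
      _ = _ := by ring
  have hdec := rankOne_decrement_ge hq'0 hr'0 (hs0.trans hs's) hK.le hP (ε := 8 * ε)
    (by linarith) hrs hKr
  refine le_trans ?_ hdec
  have hden : 1 + q' + η ^ 2 * (K * ρ + ε) ≤ η ^ 2 * (1 + φ + 2 * ε) := by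
    have e2 : η * (T + ε) ≤ η ^ 2 * (T + ε) :=
      mul_le_mul_of_nonneg_right (by nlinarith) (by linarith)
    have e3 : 1 ≤ η ^ 2 := by nlinarith
    have e4 : η ^ 2 * (T + K * ρ) ≤ η ^ 2 * φ := mul_le_mul_of_nonneg_left hφ hη20
    linarith
  have e0 : 0 ≤ 1 - 8 * ε := by linarith
  have e1 : (1 - 8 * ε) * (r + 2 * K * s) ≤ (1 - 8 * ε) * (r' + 2 * K * s') := by
    refine mul_le_mul_of_nonneg_left ?_ e0
    linarith
  have hpos : 0 < 1 + q' + η ^ 2 * (K * ρ + ε) := by linarith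
  have hpos2 : 0 < η ^ 4 * (1 + φ + 2 * ε) := mul_pos (by positivity) (by linarith)
  rw [le_div_iff₀ hpos]
  refine le_trans ?_ e1
  calc δ * η ^ 2 * D * (1 + q' + η ^ 2 * (K * ρ + ε))
      ≤ δ * η ^ 2 * D * (η ^ 2 * (1 + φ + 2 * ε)) :=
        mul_le_mul_of_nonneg_left hden (mul_nonneg (mul_nonneg hδ hη20) hD0)
    _ = δ * D * (η ^ 4 * (1 + φ + 2 * ε)) := by ring
    _ ≤ (1 - 8 * ε) / (η ^ 4 * (1 + φ + 2 * ε)) * (r + 2 * K * s)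
        * (η ^ 4 * (1 + φ + 2 * ε)) := mul_le_mul_of_nonneg_right hδW hpos2.le
    _ = _ := by rw [mul_right_comm, div_mul_cancel₀ _ hpos2.ne']

/-- First-order cost of moving the barrier: b² + 2K b³ is the derivative of b + K b² under the
shift, and η² absorbs the higher orders. -/
theorem shifted_term_le {b β δ K η : ℝ} (hb : 0 ≤ b) (hβ : 0 ≤ β) (hδ : 0 ≤ δ) (hK : 0 ≤ K)
    (hη : 1 ≤ η) (h : β - b = δ * (b * β)) (hβη : β ≤ η * b) :
    β + K * β ^ 2 ≤ b + K * b ^ 2 + δ * η ^ 2 * (b ^ 2 + 2 * K * b ^ 3) := by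
  have hη0 : 0 ≤ η - 1 := by linarith
  have h1 : b * β ≤ b * (η * b) := mul_le_mul_of_nonneg_left hβη hb
  have h2 : b * β ≤ η ^ 2 * b ^ 2 := by
    have h7 : 0 ≤ (η - 1) * η * b ^ 2 := by positivity
    linarith
  have e1 : β - b ≤ δ * (η ^ 2 * b ^ 2) := by
    rw [h]; exact mul_le_mul_of_nonneg_left h2 hδ
  have h8 : β + b ≤ 2 * η * b := by
    have : 0 ≤ (η - 1) * b := mul_nonneg hη0 hb
    linarith
  have h9 : b * β * (β + b) ≤ b * (η * b) * (2 * η * b) :=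
    mul_le_mul h1 h8 (by positivity) (by positivity)
  have e2 : β ^ 2 - b ^ 2 ≤ δ * (b * (η * b) * (2 * η * b)) := by
    have h6 : β ^ 2 - b ^ 2 = δ * (b * β * (β + b)) := by
      calc β ^ 2 - b ^ 2 = (β - b) * (β + b) := by ring
        _ = _ := by rw [h]; ring
    rw [h6]; exact mul_le_mul_of_nonneg_left h9 hδ
  have e3 := mul_le_mul_of_nonneg_left e2 hK
  linarith

/-- The potential `∑ (c - δ)⁻¹ + K ∑ (c - δ)⁻²` after a rank-one update and a shift by `δ`. -/
theorem potential_update_le {ι : Type*} [Fintype ι] {c y : ι → ℝ} (hc : ∀ j, 0 < c j)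
    (hy : ∀ j, 0 ≤ y j) {K φ ε δ G : ℝ} (hK : 0 < K) (hε : 0 ≤ ε) (hε8 : ε ≤ 1 / 8) (hδ : 0 ≤ δ)
    (hG : 0 < G) (hδc : ∀ j, δ * (c j)⁻¹ ≤ ε)
    (hφ : ∑ j, (c j)⁻¹ + K * ∑ j, (c j)⁻¹ ^ 2 ≤ φ)
    (h1 : ∑ j, (c j)⁻¹ * y j ≤ ∑ j, (c j)⁻¹ + ε)
    (h2 : K * ∑ j, (if G * (c j)⁻¹ ≤ 1 then (c j)⁻¹ ^ 2 else 0) * y j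
      ≤ K * ∑ j, (c j)⁻¹ ^ 2 + ε)
    (h3 : G * ∑ j, (c j)⁻¹ ^ 2 * y j ≤ ε)
    (hδW : δ * ∑ j, ((c j)⁻¹ ^ 2 + 2 * K * (c j)⁻¹ ^ 3) ≤
      (1 - 8 * ε) / ((1 + 2 * ε) ^ 4 * (1 + φ + 2 * ε))
        * ∑ j, ((c j)⁻¹ ^ 2 + 2 * K * (c j)⁻¹ ^ 3) * y j) :
    (∀ j, 0 < c j - δ) ∧
    ∑ j, (c j - δ)⁻¹ - (∑ j, (c j - δ)⁻¹ ^ 2 * y j) / (1 + ∑ j, (c j - δ)⁻¹ * y j)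
      + K * (∑ j, (c j - δ)⁻¹ ^ 2
        - 2 * (∑ j, (c j - δ)⁻¹ ^ 3 * y j) / (1 + ∑ j, (c j - δ)⁻¹ * y j)
        + (∑ j, (c j - δ)⁻¹ ^ 2 * y j) ^ 2 / (1 + ∑ j, (c j - δ)⁻¹ * y j) ^ 2) ≤ φ := by
  set η := 1 + 2 * ε with hη
  have hη1 : 1 ≤ η := by linarith
  have hη2 : η ≤ 2 := by linarith
  set b : ι → ℝ := fun j => (c j)⁻¹ with hb
  set β : ι → ℝ := fun j => (c j - δ)⁻¹ with hβ
  have hb0 : ∀ j, 0 < b j := fun j => inv_pos.mpr (hc j)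
  have hcb : ∀ j, c j * b j = 1 := fun j => mul_inv_cancel₀ (hc j).ne'
  have hcδ : ∀ j, 0 < c j - δ := fun j => by
    have h := mul_le_mul_of_nonneg_right (hδc j) (hc j).le
    rw [mul_assoc, inv_mul_cancel₀ (hc j).ne', mul_one] at h
    nlinarith [hc j]
  have hβ0 : ∀ j, 0 < β j := fun j => inv_pos.mpr (hcδ j)
  have hβb : ∀ j, β j - b j = δ * (b j * β j) := fun j => by
    have := (hcδ j).ne'
    have := (hc j).ne'
    simp only [hβ, hb]; field_simp; ring
  have hbβ : ∀ j, b j ≤ β j := fun j => by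
    have h : 0 ≤ δ * (b j * β j) := mul_nonneg hδ (mul_pos (hb0 j) (hβ0 j)).le
    have := hβb j
    linarith
  have hβη : ∀ j, β j ≤ η * b j := fun j => by
    have h : δ * (b j * β j) ≤ ε * β j := by
      rw [← mul_assoc]; exact mul_le_mul_of_nonneg_right (hδc j) (hβ0 j).le
    have h' := hβb j
    have : (1 - ε) * β j ≤ b j := by linarith
    have h6 : η * ((1 - ε) * β j) ≤ η * b j := mul_le_mul_of_nonneg_left this (by linarith)
    have h7 : β j ≤ η * ((1 - ε) * β j) := by
      have : 1 ≤ η * (1 - ε) := by rw [hη]; nlinarith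
      nlinarith [hβ0 j]
    linarith
  refine ⟨hcδ, ?_⟩
  set T := ∑ j, b j
  set ρ := ∑ j, b j ^ 2
  set D := ∑ j, (b j ^ 2 + 2 * K * b j ^ 3) with hD
  set q := ∑ j, b j * y j
  set r := ∑ j, b j ^ 2 * y j with hr
  set s := ∑ j, b j ^ 3 * y j with hs
  set q' := ∑ j, β j * y j with hq'
  set r' := ∑ j, β j ^ 2 * y j with hr'
  set s' := ∑ j, β j ^ 3 * y j with hs'
  set rb := ∑ j, (if G * b j ≤ 1 then b j ^ 2 else 0) * y j with hrb
  have hT0 : 0 ≤ T := Finset.sum_nonneg fun j _ => (hb0 j).le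
  have hρ0 : 0 ≤ ρ := Finset.sum_nonneg fun j _ => sq_nonneg _
  have hφ0 : 0 ≤ φ := le_trans (by positivity) hφ
  have hs0 : 0 ≤ s := Finset.sum_nonneg fun j _ => mul_nonneg (pow_pos (hb0 j) 3).le (hy j)
  have hr0 : 0 ≤ r := Finset.sum_nonneg fun j _ => mul_nonneg (sq_nonneg _) (hy j)
  have hq'0 : 0 ≤ q' := Finset.sum_nonneg fun j _ => mul_nonneg (hβ0 j).le (hy j)
  have hr'0 : 0 ≤ r' := Finset.sum_nonneg fun j _ => mul_nonneg (sq_nonneg _) (hy j)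
  have hs's : s ≤ s' := Finset.sum_le_sum fun j _ =>
    mul_le_mul_of_nonneg_right (pow_le_pow_left₀ (hb0 j).le (hbβ j) 3) (hy j)
  have hr'r : r ≤ r' := Finset.sum_le_sum fun j _ =>
    mul_le_mul_of_nonneg_right (pow_le_pow_left₀ (hb0 j).le (hbβ j) 2) (hy j)
  have hqη : q' ≤ η * q := by
    rw [hq', Finset.mul_sum]
    refine Finset.sum_le_sum fun j _ => ?_
    rw [← mul_assoc]; exact mul_le_mul_of_nonneg_right (hβη j) (hy j)
  have hrη : r' ≤ η ^ 2 * r := by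
    rw [hr', hr, Finset.mul_sum]
    refine Finset.sum_le_sum fun j _ => ?_
    rw [← mul_assoc, ← mul_pow]
    exact mul_le_mul_of_nonneg_right (pow_le_pow_left₀ (hβ0 j).le (hβη j) 2) (hy j)
  -- Where `G * b j` exceeds one, `b j ^ 2` is at most `G * b j ^ 3`.
  have hrrb : r ≤ rb + G * s := by
    rw [hr, hrb, hs, Finset.mul_sum, ← Finset.sum_add_distrib]
    refine Finset.sum_le_sum fun j _ => ?_
    split_ifs with h
    · have : 0 ≤ G * (b j ^ 3 * y j) := by have := hb0 j; have := hy j; positivity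
      linarith
    · have h6 : 0 ≤ (G * b j - 1) * (b j ^ 2 * y j) :=
        mul_nonneg (by linarith) (mul_nonneg (sq_nonneg _) (hy j))
      nlinarith
  have hpot : ∑ j, β j + K * ∑ j, β j ^ 2 ≤ T + K * ρ + δ * η ^ 2 * D := by
    rw [hD, Finset.mul_sum, Finset.mul_sum, Finset.mul_sum, ← Finset.sum_add_distrib,
      ← Finset.sum_add_distrib, ← Finset.sum_add_distrib]
    refine Finset.sum_le_sum fun j _ => ?_
    exact shifted_term_le (hb0 j).le (hβ0 j).le hδ hK.le hη1 (hβb j) (hβη j)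
  have hA : r + 2 * K * s = ∑ j, (b j ^ 2 + 2 * K * b j ^ 3) * y j := by
    rw [hr, hs, Finset.mul_sum, ← Finset.sum_add_distrib]
    exact Finset.sum_congr rfl fun j _ => by ring
  have hD0 : 0 ≤ D := Finset.sum_nonneg fun j _ => by have := hb0 j; positivity
  rw [← hA] at hδW
  have hdec := rankOne_decrement_ge_shift hK hε hε8 hG hη1 hη2 hT0 hρ0 hD0 hδ hφ hs0 hq'0 hr'0
    hs's hr'r (hqη.trans (mul_le_mul_of_nonneg_left h1 (by linarith))) hrη hrrb
    (sq_sum_mul_sq_le (fun j => (hβ0 j).le) hy) h2 h3 hδW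
  have hfin : ∑ j, β j - r' / (1 + q') + K * (∑ j, β j ^ 2 - 2 * s' / (1 + q')
      + r' ^ 2 / (1 + q') ^ 2) = (∑ j, β j + K * ∑ j, β j ^ 2)
        - (r' / (1 + q') + K * (2 * s' / (1 + q') - r' ^ 2 / (1 + q') ^ 2)) := by ring
  refine hfin.trans_le ?_
  linarith

/-- A rank-one update without a shift never raises the potential, because r² ≤ s q makes the
positive term r²/(1 + q)² smaller than 2s/(1 + q). This covers the exceptional rows, for which the
barrier stays put. -/
theorem potential_rankOne_le {ι : Type*} [Fintype ι] {c y : ι → ℝ} (hc : ∀ j, 0 < c j)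
    (hy : ∀ j, 0 ≤ y j) {K φ : ℝ} (hK : 0 < K)
    (hφ : ∑ j, (c j)⁻¹ + K * ∑ j, (c j)⁻¹ ^ 2 ≤ φ) :
    ∑ j, (c j)⁻¹ - (∑ j, (c j)⁻¹ ^ 2 * y j) / (1 + ∑ j, (c j)⁻¹ * y j)
      + K * (∑ j, (c j)⁻¹ ^ 2 - 2 * (∑ j, (c j)⁻¹ ^ 3 * y j) / (1 + ∑ j, (c j)⁻¹ * y j)
        + (∑ j, (c j)⁻¹ ^ 2 * y j) ^ 2 / (1 + ∑ j, (c j)⁻¹ * y j) ^ 2) ≤ φ := by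
  have hb0 : ∀ j, 0 < (c j)⁻¹ := fun j => inv_pos.mpr (hc j)
  have hrs := sq_sum_mul_sq_le (fun j => (hb0 j).le) hy
  set q := ∑ j, (c j)⁻¹ * y j
  set r := ∑ j, (c j)⁻¹ ^ 2 * y j
  set s := ∑ j, (c j)⁻¹ ^ 3 * y j
  have hq0 : 0 ≤ q := Finset.sum_nonneg fun j _ => mul_nonneg (hb0 j).le (hy j)
  have hs0 : 0 ≤ s := Finset.sum_nonneg fun j _ => mul_nonneg (pow_pos (hb0 j) 3).le (hy j)
  have hr0 : 0 ≤ r := Finset.sum_nonneg fun j _ => mul_nonneg (sq_nonneg _) (hy j)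
  have h1 : r ^ 2 / (1 + q) ^ 2 ≤ 2 * s / (1 + q) := by
    rw [div_le_div_iff₀ (by positivity) (by positivity)]
    have : r ^ 2 ≤ 2 * s * (1 + q) := by nlinarith
    calc r ^ 2 * (1 + q) ≤ 2 * s * (1 + q) * (1 + q) :=
          mul_le_mul_of_nonneg_right this (by positivity)
      _ = _ := by ring
  have h2 : 0 ≤ r / (1 + q) := by positivity
  nlinarith

end BarrierAlgebra

/-! ### The random barrier step -/

section Barrier

open Matrix

variable {n : ℕ}

/-- `S` dominates `t` times the identity as a quadratic form. -/
def LowerBounded (S : Matrix (Fin n) (Fin n) ℝ) (t : ℝ) : Prop :=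
  ∀ x : Fin n → ℝ, t * (x ⬝ᵥ x) ≤ x ⬝ᵥ S *ᵥ x

/-- The barrier `u` lies below the spectrum of `S` and the potential of `S` at `u` is at most `φ`. -/
structure BelowBarrier (K φ : ℝ) (S : Matrix (Fin n) (Fin n) ℝ) (u : ℝ) : Prop where
  symm : Sᵀ = S
  lt : ∀ x : Fin n → ℝ, x ≠ 0 → u * (x ⬝ᵥ x) < x ⬝ᵥ S *ᵥ x
  potential : ((S - u • (1 : Matrix (Fin n) (Fin n) ℝ))⁻¹).trace
    + K * ((S - u • (1 : Matrix (Fin n) (Fin n) ℝ))⁻¹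
      * (S - u • (1 : Matrix (Fin n) (Fin n) ℝ))⁻¹).trace ≤ φ

theorem BelowBarrier.lowerBounded {K φ : ℝ} {S : Matrix (Fin n) (Fin n) ℝ} {u : ℝ}
    (h : BelowBarrier K φ S u) : LowerBounded S u := fun x => by
  by_cases hx : x = 0
  · simp [hx]
  · exact (h.lt x hx).le

variable {U : Matrix (Fin n) (Fin n) ℝ} {lam : Fin n → ℝ}

theorem dotProduct_specMat_real (U : Matrix (Fin n) (Fin n) ℝ) (lam x : Fin n → ℝ) :
    x ⬝ᵥ specMat (𝕜 := ℝ) U lam *ᵥ x = specQuad U lam x :=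
  dotProduct_specMat_mulVec (𝕜 := ℝ) U lam x

theorem dotProduct_self_eq_sum (hU : Uᵀ * U = 1) (x : Fin n → ℝ) :
    x ⬝ᵥ x = ∑ j, (Uᵀ *ᵥ x) j ^ 2 := by
  have h := dotProduct_specMat_real U (fun _ => 1) x
  rw [specMat_const (𝕜 := ℝ) hU, one_smul, Matrix.one_mulVec] at h
  rw [h, specQuad]
  simp

theorem transpose_mulVec_col (hU : Uᵀ * U = 1) (j : Fin n) :
    Uᵀ *ᵥ (U *ᵥ Pi.single j 1) = Pi.single j 1 := by
  rw [Matrix.mulVec_mulVec, hU, Matrix.one_mulVec]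

theorem specQuad_col (hU : Uᵀ * U = 1) (d : Fin n → ℝ) (j : Fin n) :
    specQuad U d (U *ᵥ Pi.single j 1) = d j := by
  rw [specQuad, transpose_mulVec_col hU]
  rw [Finset.sum_eq_single j] <;> simp +contextual

theorem dotProduct_col_self (hU : Uᵀ * U = 1) (j : Fin n) :
    (U *ᵥ Pi.single j 1) ⬝ᵥ (U *ᵥ Pi.single j 1) = 1 := by
  rw [dotProduct_self_eq_sum hU, transpose_mulVec_col hU]
  rw [Finset.sum_eq_single j] <;> simp +contextual

theorem LowerBounded.le_eigenvalue (hU : Uᵀ * U = 1) {t : ℝ}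
    (h : LowerBounded (specMat (𝕜 := ℝ) U lam) t) (j : Fin n) : t ≤ lam j := by
  have := h (U *ᵥ Pi.single j 1)
  rwa [dotProduct_specMat_real, specQuad_col hU, dotProduct_col_self hU, mul_one] at this

theorem specMat_sub_smul (hU : Uᵀ * U = 1) (lam : Fin n → ℝ) (u : ℝ) :
    specMat (𝕜 := ℝ) U lam - u • 1 = specMat U (fun j => lam j - u) :=
  map_specMat_sub_smul (𝕜 := ℝ) hU lam u

/-- In the eigenbasis the matrix condition becomes a scalar one, so the scalar inequalities for the
potential apply with c_j = λ_j - u. -/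
theorem belowBarrier_specMat_iff (hU : Uᵀ * U = 1) {K φ u : ℝ} :
    BelowBarrier K φ (specMat (𝕜 := ℝ) U lam) u ↔
      (∀ j, 0 < lam j - u) ∧ ∑ j, (lam j - u)⁻¹ + K * ∑ j, (lam j - u)⁻¹ ^ 2 ≤ φ := by
  have hpot : ∀ (_ : ∀ j, 0 < lam j - u),
      ((specMat (𝕜 := ℝ) U lam - u • 1)⁻¹).trace = ∑ j, (lam j - u)⁻¹ ∧
      ((specMat (𝕜 := ℝ) U lam - u • 1)⁻¹ * (specMat (𝕜 := ℝ) U lam - u • 1)⁻¹).trace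
        = ∑ j, (lam j - u)⁻¹ ^ 2 := by
    intro h
    rw [specMat_sub_smul hU, specMat_inv (𝕜 := ℝ) hU fun j => (h j).ne',
      specMat_mul (𝕜 := ℝ) hU, trace_specMat (𝕜 := ℝ) hU, trace_specMat (𝕜 := ℝ) hU]
    simp [sq]
  constructor
  · intro h
    have hpos : ∀ j, 0 < lam j - u := fun j => by
      have hne : U *ᵥ Pi.single j 1 ≠ 0 := fun h0 => by
        have := dotProduct_col_self hU j
        rw [h0] at this
        simp at this
      have := h.lt _ hne
      rw [dotProduct_specMat_real, specQuad_col hU, dotProduct_col_self hU, mul_one] at this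
      linarith
    obtain ⟨h1, h2⟩ := hpot hpos
    exact ⟨hpos, by rw [← h1, ← h2]; exact h.potential⟩
  · rintro ⟨hpos, hφ⟩
    obtain ⟨h1, h2⟩ := hpot hpos
    refine ⟨transpose_specMat (𝕜 := ℝ) U lam, fun x hx => ?_, by rw [h1, h2]; exact hφ⟩
    rw [dotProduct_specMat_real, dotProduct_self_eq_sum hU, specQuad, Finset.mul_sum, ← sub_pos,
      ← Finset.sum_sub_distrib]
    have hterm : ∀ j, lam j * (Uᵀ *ᵥ x) j ^ 2 - u * (Uᵀ *ᵥ x) j ^ 2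
        = (lam j - u) * (Uᵀ *ᵥ x) j ^ 2 := fun j => by ring
    simp_rw [hterm]
    have hex : ∃ j, (Uᵀ *ᵥ x) j ≠ 0 := by
      by_contra hcon
      push Not at hcon
      apply hx
      have h0 : Uᵀ *ᵥ x = 0 := funext hcon
      have : U *ᵥ (Uᵀ *ᵥ x) = x := by
        rw [Matrix.mulVec_mulVec, mul_eq_one_comm.mp hU, Matrix.one_mulVec]
      rw [← this, h0, Matrix.mulVec_zero]
    obtain ⟨j, hj⟩ := hex
    exact Finset.sum_pos' (fun i _ => mul_nonneg (hpos i).le (sq_nonneg _))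
      ⟨j, Finset.mem_univ j, mul_pos (hpos j) (by positivity)⟩

/-- Rank-one update together with a shift of the barrier. -/
theorem belowBarrier_add_vecMulVec (hU : Uᵀ * U = 1) {K φ u δ : ℝ} (x : Fin n → ℝ)
    (hpos : ∀ j, 0 < lam j - u - δ)
    (hφ : ∑ j, (lam j - u - δ)⁻¹
      - (∑ j, (lam j - u - δ)⁻¹ ^ 2 * (Uᵀ *ᵥ x) j ^ 2)
          / (1 + ∑ j, (lam j - u - δ)⁻¹ * (Uᵀ *ᵥ x) j ^ 2)
      + K * (∑ j, (lam j - u - δ)⁻¹ ^ 2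
        - 2 * (∑ j, (lam j - u - δ)⁻¹ ^ 3 * (Uᵀ *ᵥ x) j ^ 2)
          / (1 + ∑ j, (lam j - u - δ)⁻¹ * (Uᵀ *ᵥ x) j ^ 2)
        + (∑ j, (lam j - u - δ)⁻¹ ^ 2 * (Uᵀ *ᵥ x) j ^ 2) ^ 2
          / (1 + ∑ j, (lam j - u - δ)⁻¹ * (Uᵀ *ᵥ x) j ^ 2) ^ 2) ≤ φ) :
    BelowBarrier K φ (specMat (𝕜 := ℝ) U lam + vecMulVec x x) (u + δ) := by
  have hne : ∀ j, lam j - u - δ ≠ 0 := fun j => (hpos j).ne'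
  have hq : 0 ≤ ∑ j, (lam j - u - δ)⁻¹ * (Uᵀ *ᵥ x) j ^ 2 :=
    Finset.sum_nonneg fun j _ => mul_nonneg (inv_pos.mpr (hpos j)).le (sq_nonneg _)
  have hsub : specMat (𝕜 := ℝ) U lam + vecMulVec x x - (u + δ) • 1
      = specMat (𝕜 := ℝ) U (fun j => lam j - u - δ) + vecMulVec x x := by
    rw [add_sub_right_comm, specMat_sub_smul hU]
    simp only [sub_sub]
  obtain ⟨h1, -, h2⟩ := trace_inv_add_vecMulVec (𝕜 := ℝ) hU hne x (by
    show 1 + ∑ j, (lam j - u - δ)⁻¹ * (Uᵀ *ᵥ x) j ^ 2 ≠ 0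
    linarith)
  have hbase : BelowBarrier 0 (∑ j, (lam j - (u + δ))⁻¹) (specMat (𝕜 := ℝ) U lam) (u + δ) :=
    (belowBarrier_specMat_iff hU).mpr ⟨fun j => by have := hpos j; linarith, by simp⟩
  refine ⟨?_, fun z hz => ?_, ?_⟩
  · rw [Matrix.transpose_add, transpose_specMat (𝕜 := ℝ), Matrix.transpose_vecMulVec]
  · have h3 := hbase.lt z hz
    have h4 : z ⬝ᵥ vecMulVec x x *ᵥ z = (z ⬝ᵥ x) ^ 2 := by
      rw [Matrix.vecMulVec_mulVec]
      simp [dotProduct_smul, dotProduct_comm x z, sq]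
    rw [Matrix.add_mulVec, dotProduct_add, h4]
    nlinarith [sq_nonneg (z ⬝ᵥ x)]
  · rw [hsub]
    have h1' : ((specMat (𝕜 := ℝ) U (fun j => lam j - u - δ) + vecMulVec x x)⁻¹).trace = _ := h1
    have h2' : ((specMat (𝕜 := ℝ) U (fun j => lam j - u - δ) + vecMulVec x x)⁻¹
      * (specMat (𝕜 := ℝ) U (fun j => lam j - u - δ) + vecMulVec x x)⁻¹).trace = _ := h2
    rw [h1', h2']
    exact hφ

/-- One step of the barrier argument: the shift is a bounded random variable whose mean is
controlled from below. -/
theorem IsStandardLaw.exists_barrier_step {ν : Measure ℝ} [IsProbabilityMeasure ν]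
    (hν : IsStandardLaw ν) {M Φ ε ε' Δ : ℝ} (hM : 0 ≤ M) (hΦ : 0 < Φ) (hε : 0 < ε)
    (hε8 : ε ≤ 1 / 8) (hε' : 0 < ε') (hΔ : 0 < Δ) :
    ∃ K₀ : ℝ, 0 < K₀ ∧ ∀ K : ℝ, K₀ ≤ K → ∀ (n : ℕ), 1 ≤ n → ∀ (φ : ℝ), 0 < φ → φ ≤ Φ →
      ∀ (S : Matrix (Fin n) (Fin n) ℝ) (u : ℝ), BelowBarrier K φ S u →
      ∃ δ : (Fin n → ℝ) → ℝ, Measurable δ ∧ (∀ x, 0 ≤ δ x) ∧ (∀ x, δ x ≤ Δ) ∧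
        (∀ x, BelowBarrier K φ (S + vecMulVec x x) (u + δ x)) ∧
        (1 - 8 * ε) / ((1 + 2 * ε) ^ 4 * (1 + φ + 2 * ε))
          * (1 - 2 * ∫ x, truncationTail ν M id x ^ 2 ∂ν - 4 * (2 + 4 * (2 * M) ^ 4) / Δ
            - 3 * ε' * Δ) ≤ ∫ x, δ x ∂(Measure.pi fun _ : Fin n => ν) := by
  obtain ⟨κ, hκ, hW⟩ := hν.exists_specQuad_tail_le hΦ hε hε'
  -- In order, the three terms ensure Σ b_j² ≤ κ, Σ b₂_j² ≤ κ for the cut weights, and Δ b_j ≤ ε.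
  -- All of them rest on K Σ b_j² ≤ Φ.
  refine ⟨max (Φ / κ) (max (Φ ^ 3 / (ε ^ 2 * ε' ^ 2 * κ)) (Φ * Δ ^ 2 / ε ^ 2)),
    lt_max_of_lt_left (by positivity), ?_⟩
  intro K hK n hn φ hφ hφΦ S u hS
  have hK1 : Φ / κ ≤ K := (le_max_left _ _).trans hK
  have hK2 : Φ ^ 3 / (ε ^ 2 * ε' ^ 2 * κ) ≤ K :=
    ((le_max_left _ _).trans (le_max_right _ _)).trans hK
  have hK3 : Φ * Δ ^ 2 / ε ^ 2 ≤ K := ((le_max_right _ _).trans (le_max_right _ _)).trans hK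
  have hK0 : 0 < K := lt_of_lt_of_le (by positivity) hK1
  obtain ⟨U, lam, hU, rfl⟩ := exists_eq_specMat hS.symm
  obtain ⟨hpos, hpot⟩ := (belowBarrier_specMat_iff hU).mp hS
  set P := Measure.pi fun _ : Fin n => ν with hP
  set b : Fin n → ℝ := fun j => (lam j - u)⁻¹ with hb
  have hb0 : ∀ j, 0 < b j := fun j => inv_pos.mpr (hpos j)
  have hT0 : 0 ≤ ∑ j, b j := Finset.sum_nonneg fun j _ => (hb0 j).le
  have hρ0 : 0 ≤ ∑ j, b j ^ 2 := Finset.sum_nonneg fun j _ => sq_nonneg _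
  have hKρ : K * ∑ j, b j ^ 2 ≤ Φ := by
    have : ∑ j, b j + K * ∑ j, b j ^ 2 ≤ φ := hpot
    linarith
  have hT : ∑ j, b j ≤ Φ := by
    have h1 : ∑ j, b j + K * ∑ j, b j ^ 2 ≤ φ := hpot
    have h2 : 0 ≤ K * ∑ j, b j ^ 2 := mul_nonneg hK0.le hρ0
    linarith
  -- Tuned for Markov's inequality: the mean Σ b_j² of xᵀR²x is at most Φ/K = ε' · (ε/G).
  set G := ε * ε' * K / Φ with hG
  have hG0 : 0 < G := by positivity
  -- The weights K b_j² sum to at most Φ but may be concentrated on few eigenvalues. The cutoff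
  -- gives G² b₂_j² ≤ K² b_j², hence a small Frobenius norm and a weak law.
  set b₂ : Fin n → ℝ := fun j => K * (if G * b j ≤ 1 then b j ^ 2 else 0) with hb₂
  have hb₂0 : ∀ j, 0 ≤ b₂ j := fun j => by
    simp only [hb₂]; split_ifs <;> positivity
  have hb₂le : ∀ j, b₂ j ≤ K * b j ^ 2 := fun j => by
    simp only [hb₂]; split_ifs
    · exact le_rfl
    · rw [mul_zero]; exact mul_nonneg hK0.le (sq_nonneg _)
  have hb₂sum : ∑ j, b₂ j ≤ K * ∑ j, b j ^ 2 := by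
    rw [Finset.mul_sum]; exact Finset.sum_le_sum fun j _ => hb₂le j
  have hb₂sq : ∑ j, b₂ j ^ 2 ≤ κ := by
    have h1 : ∀ j, G ^ 2 * b₂ j ^ 2 ≤ K ^ 2 * b j ^ 2 := fun j => by
      simp only [hb₂]
      split_ifs with h
      · have h0 : 0 ≤ G * b j := mul_nonneg hG0.le (hb0 j).le
        have : (G * b j) ^ 2 ≤ 1 := pow_le_one₀ h0 h
        calc G ^ 2 * (K * b j ^ 2) ^ 2 = (G * b j) ^ 2 * (K ^ 2 * b j ^ 2) := by ring
          _ ≤ 1 * (K ^ 2 * b j ^ 2) := mul_le_mul_of_nonneg_right this (by positivity)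
          _ = _ := one_mul _
      · have := hb0 j
        simp only [mul_zero, ne_eq, OfNat.ofNat_ne_zero, not_false_eq_true, zero_pow]
        positivity
    have h2 : G ^ 2 * ∑ j, b₂ j ^ 2 ≤ K * Φ := by
      rw [Finset.mul_sum]
      refine (Finset.sum_le_sum fun j _ => h1 j).trans ?_
      rw [← Finset.mul_sum, sq, mul_assoc]
      exact mul_le_mul_of_nonneg_left hKρ hK0.le
    have h3 : K * Φ ≤ G ^ 2 * κ := by
      rw [div_le_iff₀ (by positivity)] at hK2
      rw [hG, div_pow, div_mul_eq_mul_div, le_div_iff₀ (by positivity)]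
      calc K * Φ * Φ ^ 2 = K * Φ ^ 3 := by ring
        _ ≤ K * (K * (ε ^ 2 * ε' ^ 2 * κ)) := mul_le_mul_of_nonneg_left hK2 hK0.le
        _ = _ := by ring
    exact le_of_mul_le_mul_left (h2.trans h3) (by positivity)
  have hbsq : ∑ j, b j ^ 2 ≤ κ := by
    rw [div_le_iff₀ hκ] at hK1
    exact le_of_mul_le_mul_left (hKρ.trans hK1) hK0
  have hΔb : ∀ j, Δ * b j ≤ ε := fun j => by
    have h1 : K * b j ^ 2 ≤ Φ := le_trans (mul_le_mul_of_nonneg_left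
      (Finset.single_le_sum (f := fun j => b j ^ 2) (fun j _ => sq_nonneg _)
        (Finset.mem_univ j)) hK0.le) hKρ
    rw [div_le_iff₀ (by positivity)] at hK3
    have h2 : (Δ * b j) ^ 2 ≤ ε ^ 2 := by
      have h3 : K * (Δ * b j) ^ 2 ≤ K * ε ^ 2 := by
        calc K * (Δ * b j) ^ 2 = K * b j ^ 2 * Δ ^ 2 := by ring
          _ ≤ Φ * Δ ^ 2 := mul_le_mul_of_nonneg_right h1 (by positivity)
          _ ≤ _ := hK3
      exact le_of_mul_le_mul_left h3 hK0
    exact le_of_sq_le_sq h2 hε.le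
  have b₁tail := hW n U b hU (fun j => (hb0 j).le) hT hbsq
  have b₂tail := hW n U b₂ hU hb₂0 (hb₂sum.trans hKρ) hb₂sq
  obtain ⟨i3, e3⟩ := integral_specQuad (d := fun j => b j ^ 2) measurable_id hν.memLp hν.mean hU
  simp only [id, hν.variance, one_mul] at i3 e3
  have b₃tail : P.real {x | ε / G ≤ specQuad U (fun j => b j ^ 2) x} ≤ ε' := by
    have h1 := mul_meas_ge_le_integral_of_nonneg
      (Filter.Eventually.of_forall fun x : Fin n → ℝ =>
        specQuad_nonneg (U := U) (d := fun j => b j ^ 2) (fun j => sq_nonneg _) x) i3 (ε / G)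
    have h2 : ∑ j, b j ^ 2 ≤ ε / G * ε' := by
      have : ε / G * ε' = Φ / K := by rw [hG]; field_simp
      rw [this, le_div_iff₀ hK0, mul_comm]; exact hKρ
    have h3 := (h1.trans e3.le).trans h2
    exact le_of_mul_le_mul_left h3 (by positivity)
  set bad : Set (Fin n → ℝ) := ({x | ∑ j, b j + ε < specQuad U b x} ∪
    {x | ∑ j, b₂ j + ε < specQuad U b₂ x}) ∪ {x | ε / G ≤ specQuad U (fun j => b j ^ 2) x}
    with hbad
  have hbadm : MeasurableSet bad :=
    ((measurableSet_lt measurable_const (measurable_specQuad _ _)).union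
      (measurableSet_lt measurable_const (measurable_specQuad _ _))).union
      (measurableSet_le measurable_const (measurable_specQuad _ _))
  have hbadP : P.real bad ≤ 3 * ε' := by
    have h1 := measureReal_union_le (μ := P) ({x | ∑ j, b j + ε < specQuad U b x} ∪
      {x | ∑ j, b₂ j + ε < specQuad U b₂ x}) {x | ε / G ≤ specQuad U (fun j => b j ^ 2) x}
    have h2 := measureReal_union_le (μ := P) {x | ∑ j, b j + ε < specQuad U b x}
      {x | ∑ j, b₂ j + ε < specQuad U b₂ x}
    linarith
  set D := ∑ j, (b j ^ 2 + 2 * K * b j ^ 3) with hD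
  have hterm0 : ∀ j, 0 < b j ^ 2 + 2 * K * b j ^ 3 := fun j => by have := hb0 j; positivity
  have hD0 : 0 < D := Finset.sum_pos (fun j _ => hterm0 j) ⟨⟨0, hn⟩, Finset.mem_univ _⟩
  -- The derivative of the potential under a shift, normalized to sum one: a row x pays for a shift
  -- proportional to `specQuad U H x`.
  set H : Fin n → ℝ := fun j => (b j ^ 2 + 2 * K * b j ^ 3) / D with hH
  have hH0 : ∀ j, 0 ≤ H j := fun j => (div_pos (hterm0 j) hD0).le
  have hH1 : ∑ j, H j = 1 := by rw [hH, ← Finset.sum_div, div_self hD0.ne']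
  set d₁ := (1 - 8 * ε) / ((1 + 2 * ε) ^ 4 * (1 + φ + 2 * ε)) with hd₁
  have hd₁0 : 0 ≤ d₁ := div_nonneg (by linarith) (by positivity)
  have hd₁1 : d₁ ≤ 1 := by
    rw [hd₁, div_le_one (by positivity)]
    have h1 : 1 ≤ (1 + 2 * ε) ^ 4 := one_le_pow₀ (by linarith)
    nlinarith
  have hmin0 : ∀ x, 0 ≤ min (specQuad U H x) Δ := fun x => le_min (specQuad_nonneg hH0 x) hΔ.le
  have hminm : Measurable fun x => min (specQuad U H x) Δ :=
    (measurable_specQuad U H).min measurable_const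
  -- The shift is zero on the bad event, which costs at most 3ε'Δ of the truncated mean, and the cap
  -- at Δ makes the shifts bounded.
  refine ⟨badᶜ.indicator fun x => d₁ * min (specQuad U H x) Δ,
    (hminm.const_mul d₁).indicator hbadm.compl,
    fun x => Set.indicator_nonneg (fun x _ => mul_nonneg hd₁0 (hmin0 x)) x, fun x => ?_,
    fun x => ?_, ?_⟩
  · refine Set.indicator_le' (fun x _ => ?_) (fun _ _ => hΔ.le) x
    calc d₁ * min (specQuad U H x) Δ ≤ 1 * Δ :=
          mul_le_mul hd₁1 (min_le_right _ _) (hmin0 x) zero_le_one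
      _ = Δ := one_mul _
  · by_cases hx : x ∈ bad
    · rw [Set.indicator_of_notMem (by simpa using hx)]
      refine belowBarrier_add_vecMulVec hU x (fun j => by simpa using hpos j) ?_
      simp only [sub_zero]
      exact potential_rankOne_le hpos (fun j => sq_nonneg _) hK0 hpot
    · rw [Set.indicator_of_mem (by simpa using hx)]
      simp only [hbad, Set.mem_union, Set.mem_ofPred_eq, not_or, not_lt, not_le] at hx
      obtain ⟨⟨x1, x2⟩, x3⟩ := hx
      have hδ0 : 0 ≤ d₁ * min (specQuad U H x) Δ := mul_nonneg hd₁0 (hmin0 x)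
      have hδΔ : d₁ * min (specQuad U H x) Δ ≤ Δ :=
        (mul_le_mul hd₁1 (min_le_right _ _) (hmin0 x) zero_le_one).trans_eq (one_mul _)
      have hWD : specQuad U H x * D
          = ∑ j, (b j ^ 2 + 2 * K * b j ^ 3) * (Uᵀ *ᵥ x) j ^ 2 := by
        rw [specQuad, Finset.sum_mul]
        refine Finset.sum_congr rfl fun j _ => ?_
        simp only [hH]
        field_simp
      have hmain := potential_update_le (c := fun j => lam j - u) (y := fun j => (Uᵀ *ᵥ x) j ^ 2)
        hpos (fun j => sq_nonneg _) hK0 hε.le hε8 hδ0 hG0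
        (fun j => (mul_le_mul_of_nonneg_right hδΔ (hb0 j).le).trans (hΔb j)) hpot x1
        (by
          have : K * ∑ j, (if G * b j ≤ 1 then b j ^ 2 else 0) * (Uᵀ *ᵥ x) j ^ 2
              = specQuad U b₂ x := by
            rw [specQuad, Finset.mul_sum]
            exact Finset.sum_congr rfl fun j _ => by simp only [hb₂]; ring
          refine this.trans_le (x2.trans ?_)
          exact add_le_add hb₂sum le_rfl)
        (by
          have h1 : specQuad U (fun j => b j ^ 2) x * G ≤ ε := by
            rw [← le_div_iff₀ hG0]; exact x3.le
          rw [mul_comm] at h1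
          exact h1)
        (by
          have h1 : d₁ * min (specQuad U H x) Δ * D ≤ d₁ * (specQuad U H x * D) := by
            rw [mul_assoc]
            exact mul_le_mul_of_nonneg_left (mul_le_mul_of_nonneg_right (min_le_left _ _) hD0.le)
              hd₁0
          rw [hWD] at h1
          exact h1)
      exact belowBarrier_add_vecMulVec hU x hmain.1 hmain.2
  · have hV := hν.le_integral_min_specQuad hM hU hH0 hH1 hΔ
    have imin : Integrable (fun x => min (specQuad U H x) Δ) P := by
      refine Integrable.mono' (integrable_const Δ) hminm.aestronglyMeasurable
        (Filter.Eventually.of_forall fun x => ?_)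
      rw [Real.norm_of_nonneg (hmin0 x)]
      exact min_le_right _ _
    rw [integral_indicator hbadm.compl, integral_const_mul]
    have hsplit := integral_add_compl hbadm imin
    have hbadint : ∫ x in bad, min (specQuad U H x) Δ ∂P ≤ 3 * ε' * Δ := by
      have h1 : ∫ x in bad, min (specQuad U H x) Δ ∂P ≤ ∫ _ in bad, Δ ∂P :=
        integral_mono imin.integrableOn (integrable_const _) fun x => min_le_right _ _
      rw [setIntegral_const, smul_eq_mul] at h1
      exact h1.trans (mul_le_mul_of_nonneg_right hbadP hΔ.le)
    refine mul_le_mul_of_nonneg_left ?_ hd₁0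
    linarith

end Barrier

/-! ### Lower tail of the smallest eigenvalue -/

section LowerTail

open Matrix

variable {n N : ℕ}

/-- The Gram matrix `∑ₖ xₖ xₖᵀ` of a finite family of vectors. -/
def rowGram (X : Fin N → Fin n → ℝ) : Matrix (Fin n) (Fin n) ℝ := ∑ k, vecMulVec (X k) (X k)

theorem dotProduct_rowGram (X : Fin N → Fin n → ℝ) (x : Fin n → ℝ) :
    x ⬝ᵥ rowGram X *ᵥ x = ∑ k, (X k ⬝ᵥ x) ^ 2 := by
  rw [rowGram, Matrix.sum_mulVec, dotProduct_sum]
  refine Finset.sum_congr rfl fun k _ => ?_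
  rw [Matrix.vecMulVec_mulVec]
  simp [dotProduct_comm x, sq]

theorem rowGram_insertNth (i : Fin (N + 1)) (x : Fin n → ℝ) (Y : Fin N → Fin n → ℝ) :
    rowGram (i.insertNth (α := fun _ => Fin n → ℝ) x Y) = rowGram Y + vecMulVec x x := by
  rw [rowGram, Fin.sum_univ_succAbove _ i]
  simp [rowGram, add_comm]

theorem transpose_rowGram (X : Fin N → Fin n → ℝ) : (rowGram X)ᵀ = rowGram X := by
  simp [rowGram, Matrix.transpose_sum, Matrix.transpose_vecMulVec]

theorem LowerBounded.mono {S : Matrix (Fin n) (Fin n) ℝ} {s t : ℝ} (h : LowerBounded S t)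
    (hst : s ≤ t) : LowerBounded S s := fun x => by
  have h0 : 0 ≤ x ⬝ᵥ x := Finset.sum_nonneg fun i _ => mul_self_nonneg (x i)
  exact (mul_le_mul_of_nonneg_right hst h0).trans (h x)

/-- The intersection over test vectors is uncountable, but each condition is closed in `X`. -/
theorem measurableSet_lowerBounded (S : Matrix (Fin n) (Fin n) ℝ) (t : ℝ) :
    MeasurableSet {X : Fin N → Fin n → ℝ | LowerBounded (S + rowGram X) t} := by
  have h : {X : Fin N → Fin n → ℝ | LowerBounded (S + rowGram X) t}
      = ⋂ x : Fin n → ℝ, {X | t * (x ⬝ᵥ x) ≤ x ⬝ᵥ S *ᵥ x + ∑ k, (X k ⬝ᵥ x) ^ 2} := by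
    ext X
    simp only [LowerBounded, Set.mem_ofPred_eq, Set.mem_iInter, Matrix.add_mulVec, dotProduct_add,
      dotProduct_rowGram]
  rw [h]
  refine IsClosed.measurableSet (isClosed_iInter fun x => isClosed_le continuous_const ?_)
  simp only [dotProduct]
  fun_prop

/-- Because (1 - y + y²/2)(1 + y + y²/2) = 1 + y⁴/4 ≥ 1 and e^y dominates the second factor. -/
theorem exp_neg_le_quadratic {y : ℝ} (hy : 0 ≤ y) : Real.exp (-y) ≤ 1 - y + y ^ 2 / 2 := by
  have h := Real.quadratic_le_exp_of_nonneg hy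
  have h1 : Real.exp (-y) * Real.exp y = 1 := by rw [← Real.exp_add]; simp
  have h2 : 0 < Real.exp (-y) := Real.exp_pos _
  have h3 : 0 ≤ 1 - y + y ^ 2 / 2 := by nlinarith [sq_nonneg (y - 1)]
  have h4 : (1 - y + y ^ 2 / 2) * (1 + y + y ^ 2 / 2) = 1 + y ^ 4 / 4 := by ring
  have h5 : 0 ≤ y ^ 4 / 4 := by positivity
  have h6 : (1 - y + y ^ 2 / 2) * (1 + y + y ^ 2 / 2) ≤ (1 - y + y ^ 2 / 2) * Real.exp y :=
    mul_le_mul_of_nonneg_left h h3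
  have h7 : Real.exp (-y) * Real.exp y ≤ (1 - y + y ^ 2 / 2) * Real.exp y := by linarith
  exact le_of_mul_le_mul_right h7 (Real.exp_pos _)

/-- The shift lies in [0, Δ], so its second moment is at most Δ², and a lower bound on its mean is
all that the one-sided exponential moment needs. -/
theorem integral_exp_neg_le {E : Type*} [MeasurableSpace E] {P : Measure E}
    [IsProbabilityMeasure P] {δ : E → ℝ} (hδm : Measurable δ) {Δ d : ℝ} (hδ0 : ∀ x, 0 ≤ δ x)
    (hδΔ : ∀ x, δ x ≤ Δ) (hd : d ≤ ∫ x, δ x ∂P) {l : ℝ} (hl : 0 ≤ l) :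
    ∫ x, Real.exp (-(l * δ x)) ∂P ≤ Real.exp (-(l * d) + l ^ 2 * Δ ^ 2 / 2) := by
  have hb : BddMeas δ := ⟨hδm, Δ, fun x => by rw [abs_of_nonneg (hδ0 x)]; exact hδΔ x⟩
  have hi := hb.integrable P
  have h1 : ∀ x, Real.exp (-(l * δ x)) ≤ (1 + l ^ 2 * Δ ^ 2 / 2) - l * δ x := fun x => by
    have h := exp_neg_le_quadratic (mul_nonneg hl (hδ0 x))
    have h2 : (l * δ x) ^ 2 ≤ l ^ 2 * Δ ^ 2 := by
      rw [mul_pow]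
      exact mul_le_mul_of_nonneg_left (pow_le_pow_left₀ (hδ0 x) (hδΔ x) 2) (sq_nonneg _)
    linarith
  have hexp : Integrable (fun x => Real.exp (-(l * δ x))) P := by
    refine Integrable.of_bound (by fun_prop) 1 (Filter.Eventually.of_forall fun x => ?_)
    rw [Real.norm_of_nonneg (Real.exp_pos _).le]
    exact Real.exp_le_one_iff.mpr (by have := mul_nonneg hl (hδ0 x); linarith)
  have h2 := integral_mono hexp ((integrable_const _).sub (hi.const_mul l)) h1
  refine h2.trans ?_
  have h3 : ∫ x, ((1 + l ^ 2 * Δ ^ 2 / 2) - l * δ x) ∂P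
      = (1 + l ^ 2 * Δ ^ 2 / 2) - l * ∫ x, δ x ∂P := by
    rw [integral_sub (integrable_const _) (hi.const_mul l), integral_const_mul]
    simp
  refine h3.trans_le ?_
  have h4 := mul_le_mul_of_nonneg_left hd hl
  have h5 := Real.add_one_le_exp (-(l * d) + l ^ 2 * Δ ^ 2 / 2)
  linarith

/-- Iterating a barrier step over independent vectors. -/
theorem measure_not_lowerBounded_le {P : Measure (Fin n → ℝ)} [IsProbabilityMeasure P]
    {K φ Δ d l : ℝ} (hl : 0 ≤ l)
    (hstep : ∀ (S : Matrix (Fin n) (Fin n) ℝ) (u : ℝ), BelowBarrier K φ S u →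
      ∃ δ : (Fin n → ℝ) → ℝ, Measurable δ ∧ (∀ x, 0 ≤ δ x) ∧ (∀ x, δ x ≤ Δ) ∧
        (∀ x, BelowBarrier K φ (S + vecMulVec x x) (u + δ x)) ∧ d ≤ ∫ x, δ x ∂P)
    (N : ℕ) (S : Matrix (Fin n) (Fin n) ℝ) (u t : ℝ) (hS : BelowBarrier K φ S u) :
    (Measure.pi fun _ : Fin N => P) {X | ¬ LowerBounded (S + rowGram X) t}
      ≤ ENNReal.ofReal (Real.exp (l * (t - u))
        * Real.exp (-(l * d) + l ^ 2 * Δ ^ 2 / 2) ^ N) := by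
  induction N generalizing S u with
  | zero =>
    by_cases htu : t ≤ u
    · have : {X : Fin 0 → Fin n → ℝ | ¬ LowerBounded (S + rowGram X) t} = ∅ := by
        ext X
        simp only [Set.mem_ofPred_eq, Set.mem_empty_iff_false, iff_false, not_not]
        simpa [rowGram] using hS.lowerBounded.mono htu
      rw [this]; simp
    -- Here `u < t`, so the claimed bound is at least one.
    · refine prob_le_one.trans ?_
      rw [pow_zero, mul_one, ← ENNReal.ofReal_one]
      refine ENNReal.ofReal_le_ofReal (Real.one_le_exp ?_)
      push Not at htu
      exact mul_nonneg hl (by linarith)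
  | succ N ih =>
    obtain ⟨δ, hδm, hδ0, hδΔ, hδS, hδd⟩ := hstep S u hS
    have hm := (measurableSet_lowerBounded (N := N + 1) S t).compl
    have hset : {X : Fin (N + 1) → Fin n → ℝ | ¬ LowerBounded (S + rowGram X) t}
      = {X | LowerBounded (S + rowGram X) t}ᶜ := rfl
    rw [hset, ← lintegral_indicator_one hm, lintegral_pi_insertNth P 0
      (measurable_one.indicator hm)]
    set c := Real.exp (-(l * d) + l ^ 2 * Δ ^ 2 / 2) with hc
    -- With the first row fixed, the induction hypothesis applies to the updated matrix with barrier
    -- `u + δ x`; the gained shift appears as the factor exp(-l δ(x)).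
    have hinner : ∀ x, ∫⁻ Y, {X : Fin (N + 1) → Fin n → ℝ |
          LowerBounded (S + rowGram X) t}ᶜ.indicator (fun _ => (1 : ENNReal))
            (Fin.insertNth (α := fun _ => Fin n → ℝ) 0 x Y)
          ∂(Measure.pi fun _ : Fin N => P)
        ≤ ENNReal.ofReal (Real.exp (l * (t - u)) * c ^ N * Real.exp (-(l * δ x))) := by
      intro x
      have hm' := (measurableSet_lowerBounded (N := N) (S + vecMulVec x x) t).compl
      have : ∀ Y : Fin N → Fin n → ℝ, {X : Fin (N + 1) → Fin n → ℝ |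
          LowerBounded (S + rowGram X) t}ᶜ.indicator (fun _ => (1 : ENNReal))
            (Fin.insertNth (α := fun _ => Fin n → ℝ) 0 x Y)
          = {X | LowerBounded (S + vecMulVec x x + rowGram X) t}ᶜ.indicator
            (fun _ => (1 : ENNReal)) Y := by
        intro Y
        have h : S + rowGram (Fin.insertNth (α := fun _ => Fin n → ℝ) 0 x Y)
            = S + vecMulVec x x + rowGram Y := by
          rw [rowGram_insertNth, add_assoc, add_comm (vecMulVec x x)]
        have hiff : Fin.insertNth (α := fun _ => Fin n → ℝ) 0 x Y
              ∈ {X : Fin (N + 1) → Fin n → ℝ | LowerBounded (S + rowGram X) t}ᶜ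
            ↔ Y ∈ {X : Fin N → Fin n → ℝ | LowerBounded (S + vecMulVec x x + rowGram X) t}ᶜ := by
          simp only [Set.mem_compl_iff, Set.mem_ofPred_eq, h]
        by_cases hY : Y ∈ {X : Fin N → Fin n → ℝ | LowerBounded (S + vecMulVec x x + rowGram X) t}ᶜ
        · rw [Set.indicator_of_mem hY, Set.indicator_of_mem (hiff.mpr hY)]
        · rw [Set.indicator_of_notMem hY, Set.indicator_of_notMem (mt hiff.mp hY)]
      simp_rw [this]
      rw [show (fun _ : Fin N → Fin n → ℝ => (1 : ENNReal)) = 1 from rfl,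
        lintegral_indicator_one hm']
      refine (ih _ _ (hδS x)).trans (ENNReal.ofReal_le_ofReal (le_of_eq ?_))
      have : Real.exp (l * (t - (u + δ x))) = Real.exp (l * (t - u)) * Real.exp (-(l * δ x)) := by
        rw [← Real.exp_add]; congr 1; ring
      rw [this]; ring
    refine (lintegral_mono hinner).trans ?_
    have hexp : Integrable (fun x => Real.exp (-(l * δ x))) P := by
      refine Integrable.of_bound (by fun_prop) 1 (Filter.Eventually.of_forall fun x => ?_)
      rw [Real.norm_of_nonneg (Real.exp_pos _).le]
      exact Real.exp_le_one_iff.mpr (by have := mul_nonneg hl (hδ0 x); linarith)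
    rw [← ofReal_integral_eq_lintegral_ofReal (hexp.const_mul _)
      (Filter.Eventually.of_forall fun x => by positivity), integral_const_mul]
    refine ENNReal.ofReal_le_ofReal ?_
    rw [pow_succ, ← mul_assoc]
    exact mul_le_mul_of_nonneg_left (integral_exp_neg_le hδm hδ0 hδΔ hδd hl) (by positivity)

theorem belowBarrier_zero {K φ u : ℝ} (hu : u < 0)
    (hφ : (n : ℝ) * (-u)⁻¹ + K * (n * (-u)⁻¹ ^ 2) ≤ φ) :
    BelowBarrier K φ (0 : Matrix (Fin n) (Fin n) ℝ) u := by
  have h0 : specMat (𝕜 := ℝ) (1 : Matrix (Fin n) (Fin n) ℝ) (fun _ => 0) = 0 := by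
    rw [specMat_const (𝕜 := ℝ) (by simp), zero_smul]
  rw [← h0, belowBarrier_specMat_iff (by simp)]
  refine ⟨fun _ => by linarith, ?_⟩
  simpa using hφ

/-- First-order bookkeeping of 19ε = 8ε + 8ε + 3ε: the numerator, the factor (1 + 2ε)⁴, and the
excess 3ε over 1 + φ₀. -/
theorem shift_rate_ge {ε φ₀ : ℝ} (hε : 0 ≤ ε) (hε8 : ε ≤ 1 / 80) (hφ₀ : 0 ≤ φ₀) :
    (1 - 19 * ε) / (1 + φ₀) ≤ (1 - 8 * ε) / ((1 + 2 * ε) ^ 4 * (1 + (φ₀ + ε) + 2 * ε)) := by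
  rw [div_le_div_iff₀ (by positivity) (by positivity)]
  have h1 : (1 - 8 * ε) * (1 + 2 * ε) ^ 4 ≤ 1 := by
    have h2 : (1 + 2 * ε) ^ 2 * (1 - 4 * ε) ≤ 1 := by nlinarith [mul_nonneg hε hε]
    have h3 : (1 + 2 * ε) ^ 4 * (1 - 4 * ε) ^ 2 ≤ 1 := by
      have := mul_le_mul h2 h2 (mul_nonneg (sq_nonneg _) (by linarith)) zero_le_one
      calc _ = (1 + 2 * ε) ^ 2 * (1 - 4 * ε) * ((1 + 2 * ε) ^ 2 * (1 - 4 * ε)) := by ring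
        _ ≤ _ := by linarith
    have h4 : 1 - 8 * ε ≤ (1 - 4 * ε) ^ 2 := by nlinarith [sq_nonneg ε]
    have h5 : (1 - 8 * ε) * (1 + 2 * ε) ^ 4 ≤ (1 - 4 * ε) ^ 2 * (1 + 2 * ε) ^ 4 :=
      mul_le_mul_of_nonneg_right h4 (by positivity)
    linarith
  have h2 : (1 - 3 * ε) * (1 + (φ₀ + ε) + 2 * ε) ≤ 1 + φ₀ := by
    nlinarith [mul_nonneg hε hφ₀, mul_nonneg hε hε]
  have h3 : 1 - 19 * ε ≤ (1 - 8 * ε) * ((1 - 8 * ε) * (1 - 3 * ε)) := by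
    have : (1 - 8 * ε) * ((1 - 8 * ε) * (1 - 3 * ε)) = 1 - 19 * ε + 16 * ε ^ 2 * (7 - 12 * ε) := by
      ring
    have h : 0 ≤ 16 * ε ^ 2 * (7 - 12 * ε) := mul_nonneg (by positivity) (by linarith)
    linarith
  have h8 : 0 ≤ 1 - 8 * ε := by linarith
  have h9 : 0 ≤ (1 - 3 * ε) * (1 + (φ₀ + ε) + 2 * ε) :=
    mul_nonneg (by linarith) (by linarith)
  calc (1 - 19 * ε) * ((1 + 2 * ε) ^ 4 * (1 + (φ₀ + ε) + 2 * ε))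
      ≤ (1 - 8 * ε) * ((1 - 8 * ε) * (1 - 3 * ε))
        * ((1 + 2 * ε) ^ 4 * (1 + (φ₀ + ε) + 2 * ε)) :=
        mul_le_mul_of_nonneg_right h3 (by positivity)
    _ = (1 - 8 * ε) * (((1 - 8 * ε) * (1 + 2 * ε) ^ 4)
        * ((1 - 3 * ε) * (1 + (φ₀ + ε) + 2 * ε))) := by ring
    _ ≤ (1 - 8 * ε) * (1 * (1 + φ₀)) :=
        mul_le_mul_of_nonneg_left (mul_le_mul h1 h2 h9 zero_le_one) h8
    _ = _ := by ring

/-- `β` is the usable mean of the capped form, so N rows act like βN rows and `sβ` replaces √N.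
Since `t ≥ 0` forces η + 2σ ≤ 1, one has 2σ² ≤ σ and √β ≥ β ≥ 1 - σ - 2ε, which leaves a margin
(η/2)√N between `t` and `sβ - sn`; its square is 20εN. -/
theorem effective_dimension_gap {η ε σ t sN sn β sβ : ℝ} (hη : 0 < η) (hη1 : η ≤ 1)
    (hε : ε = η ^ 2 / 80) (hσ0 : 0 ≤ σ) (hsn : 0 < sn) (hsnN : sn ≤ sN) (ht : 0 ≤ t)
    (htt : t ≤ sN - sn - (η + 2 * σ) * sN) (hβ : β = 1 - 2 * σ ^ 2 - 2 * ε) (hsβ0 : 0 ≤ sβ)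
    (hsβ2 : sβ ^ 2 = max β 0 * sN ^ 2) :
    0 < β ∧ sβ ≤ sN ∧ η / 2 * sN ≤ sβ - sn ∧ t ^ 2 + 20 * ε * sN ^ 2 ≤ (sβ - sn) ^ 2 := by
  have hsN0 : 0 < sN := hsn.trans_le hsnN
  have hε0 : 0 < ε := by rw [hε]; positivity
  have hεη : ε ≤ η / 80 := by rw [hε]; gcongr; nlinarith
  have hσ1 : η + 2 * σ ≤ 1 := by
    by_contra hcon
    push Not at hcon
    have : 1 * sN < (η + 2 * σ) * sN := mul_lt_mul_of_pos_right hcon hsN0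
    linarith
  have hσσ : 2 * σ ^ 2 ≤ σ := by nlinarith
  have hβ0 : 0 < β := by linarith
  have hβ1 : β ≤ 1 := by have := sq_nonneg σ; linarith
  rw [max_eq_left hβ0.le] at hsβ2
  have hsβN : sβ ≤ sN := by
    refine le_of_sq_le_sq ?_ hsN0.le
    rw [hsβ2]
    exact mul_le_of_le_one_left (sq_nonneg _) hβ1
  have hsβge : β * sN ≤ sβ := by
    refine le_of_sq_le_sq ?_ hsβ0
    rw [hsβ2, mul_pow, sq β]
    exact mul_le_mul_of_nonneg_right (mul_le_of_le_one_left hβ0.le hβ1) (sq_nonneg _)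
  have hpt : t + η / 2 * sN ≤ sβ - sn := by
    have h1 : (1 - σ - 2 * ε) * sN ≤ β * sN :=
      mul_le_mul_of_nonneg_right (by linarith) hsN0.le
    have h2 : 0 ≤ σ * sN := by positivity
    have h3 : ε * sN ≤ η / 80 * sN := mul_le_mul_of_nonneg_right hεη hsN0.le
    have h4 : 0 ≤ η * sN := by positivity
    linarith
  refine ⟨hβ0, hsβN, by linarith, ?_⟩
  have h1 : (t + η / 2 * sN) ^ 2 ≤ (sβ - sn) ^ 2 := pow_le_pow_left₀ (by positivity) hpt 2
  have h3 : 0 ≤ t * η * sN := by positivity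
  have h4 : 20 * ε * sN ^ 2 = η ^ 2 / 4 * sN ^ 2 := by rw [hε]; ring
  linarith

/-- The mean rise over N rows is (1 - 19ε) p sβ, and p sβ = p² + sn p. From the start -sn p it
reaches p² up to 19εN, which the gap 20εN absorbs, leaving εN for the deviation estimate. -/
theorem barrier_drift_le {ε sn p sβ sN N β t : ℝ} (hε : 0 ≤ ε) (hsn : 0 < sn) (hp0 : 0 < p)
    (hp : p = sβ - sn) (hsβN : sβ ≤ sN) (hsN2 : sN ^ 2 = N) (hsN0 : 0 < sN)
    (hsβ2 : sβ ^ 2 = β * N) (hp2 : t ^ 2 + 20 * ε * N ≤ p ^ 2) :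
    t ^ 2 + sn * p - (1 - 19 * ε) / (1 + sn / p) * β * N ≤ -(ε * N) := by
  have hs : sβ = p + sn := by linarith
  have hsβ0 : 0 < sβ := by linarith
  have hdN : (1 - 19 * ε) / (1 + sn / p) * β * N = (1 - 19 * ε) * (p * sβ) := by
    have h1 : 1 + sn / p = sβ / p := by rw [hs]; field_simp
    rw [h1, mul_assoc, ← hsβ2]
    field_simp
  have hpβ : p * sβ ≤ N := by
    calc p * sβ ≤ sN * sN := mul_le_mul (by linarith) hsβN hsβ0.le hsN0.le
      _ = N := by rw [← hsN2]; ring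
  have h1 : p * sβ = p ^ 2 + sn * p := by rw [hs]; ring
  have h2 : 19 * ε * (p * sβ) ≤ 19 * ε * N := mul_le_mul_of_nonneg_left hpβ (by positivity)
  rw [hdN]
  linarith

/-- Lower tail of the smallest eigenvalue of `XᵀX` for i.i.d. entries with unit variance. -/
theorem exists_lower_tail {M η : ℝ} (hM : 0 < M) (hη : 0 < η) :
    ∃ w : ℝ, 0 < w ∧ ∀ ν : Measure ℝ, IsProbabilityMeasure ν → IsStandardLaw ν →
      ∃ N₀ : ℕ, ∀ N : ℕ, N₀ ≤ N → ∀ n : ℕ, 1 ≤ n → n ≤ N → ∀ t : ℝ, 0 ≤ t →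
        t ≤ √N - √n - (η + 2 * √(∫ x, truncationTail ν M id x ^ 2 ∂ν)) * √N →
        (Measure.pi fun _ : Fin N => Measure.pi fun _ : Fin n => ν)
            {X | ¬ LowerBounded (rowGram X) (t ^ 2)}
          ≤ ENNReal.ofReal (Real.exp (-(w * N))) := by
  wlog hη1 : η ≤ 1 generalizing η
  · obtain ⟨w, hw, h⟩ := this one_pos le_rfl
    refine ⟨w, hw, fun ν i hν => ?_⟩
    obtain ⟨N₀, h⟩ := h ν i hν
    refine ⟨N₀, fun N hN n hn hnN t ht htt => h N hN n hn hnN t ht (htt.trans ?_)⟩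
    push Not at hη1
    have : 0 ≤ (η - 1) * √(N : ℝ) := mul_nonneg (by linarith) (Real.sqrt_nonneg _)
    linarith
  set ε := η ^ 2 / 80 with hε
  have hε0 : 0 < ε := by positivity
  have hε80 : ε ≤ 1 / 80 := by rw [hε]; gcongr; exact pow_le_one₀ hη.le hη1
  set A := 4 * (2 + 4 * (2 * M) ^ 4) with hA
  have hA0 : 0 < A := by positivity
  -- Capping then costs `A / Δ = ε / 2`, and with the next choice of `ε'` the bad event costs `3 *
  -- ε' * Δ = ε / 2`. Neither depends on the law.
  set Δ := 2 * A / ε with hΔ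
  have hΔ0 : 0 < Δ := by positivity
  set ε' := ε / (6 * Δ) with hε'
  have hε'0 : 0 < ε' := by positivity
  refine ⟨ε ^ 2 / (2 * Δ ^ 2), by positivity, ?_⟩
  intro ν _ hν
  obtain ⟨K₀, hK₀, hstep⟩ := hν.exists_barrier_step (M := M) (Φ := 2 / η + 1) hM.le
    (by positivity) hε0 (by linarith) hε'0 hΔ0
  obtain ⟨N₀, hN₀⟩ := exists_nat_ge (K₀ / (ε * η ^ 2 / 4))
  refine ⟨N₀, fun N hN n hn hnN t ht htt => ?_⟩
  set σ := √(∫ x, truncationTail ν M id x ^ 2 ∂ν) with hσ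
  have hσ0 : 0 ≤ σ := Real.sqrt_nonneg _
  have hσ2 : ∫ x, truncationTail ν M id x ^ 2 ∂ν = σ ^ 2 :=
    (Real.sq_sqrt (integral_nonneg fun x => sq_nonneg _)).symm
  have hn0 : (1 : ℝ) ≤ n := by exact_mod_cast hn
  have hnN' : (n : ℝ) ≤ N := by exact_mod_cast hnN
  have hN0 : (0 : ℝ) < N := by linarith
  set sN := √(N : ℝ) with hsN
  set sn := √(n : ℝ) with hsn
  have hsN2 : sN ^ 2 = N := Real.sq_sqrt hN0.le
  have hsn2 : sn ^ 2 = n := Real.sq_sqrt (by linarith)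
  have hsN0 : 0 < sN := Real.sqrt_pos.mpr hN0
  have hsn0 : 0 < sn := Real.sqrt_pos.mpr (by linarith)
  have hsnN : sn ≤ sN := Real.sqrt_le_sqrt hnN'
  clear_value ε' Δ A σ sN sn
  obtain ⟨β, hβ⟩ : ∃ β, β = 1 - 2 * σ ^ 2 - 2 * ε := ⟨_, rfl⟩
  obtain ⟨sβ, hsβ0, hsβ2⟩ : ∃ sβ, 0 ≤ sβ ∧ sβ ^ 2 = max β 0 * sN ^ 2 :=
    ⟨√(max β 0 * sN ^ 2), Real.sqrt_nonneg _, Real.sq_sqrt (by positivity)⟩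
  obtain ⟨hβ0, hsβN, hpη, hp2⟩ :=
    effective_dimension_gap hη hη1 hε hσ0 hsn0 hsnN ht htt hβ hsβ0 hsβ2
  rw [max_eq_left hβ0.le, hsN2] at hsβ2
  rw [hsN2] at hp2
  clear_value ε
  obtain ⟨p, hp⟩ : ∃ p, p = sβ - sn := ⟨_, rfl⟩
  rw [← hp] at hpη hp2
  have hp0 : 0 < p := lt_of_lt_of_le (by positivity) hpη
  obtain ⟨φ₀, hφ₀⟩ : ∃ φ₀, φ₀ = sn / p := ⟨_, rfl⟩
  have hφ₀0 : 0 < φ₀ := by rw [hφ₀]; positivity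
  have hφ₀le : φ₀ ≤ 2 / η := by
    rw [hφ₀, div_le_div_iff₀ hp0 hη]
    nlinarith
  -- Of order N, hence eventually above `K₀`, yet small enough that the quadratic part K/p² of the
  -- initial potential is at most ε.
  obtain ⟨K, hK⟩ : ∃ K : ℝ, K = ε * η ^ 2 / 4 * N := ⟨_, rfl⟩
  have hK0K : K₀ ≤ K := by
    have h1 : (N₀ : ℝ) ≤ N := by exact_mod_cast hN
    have h2 := hN₀.trans h1
    rw [div_le_iff₀ (by positivity)] at h2
    rw [hK]; linarith
  have hK0 : 0 < K := by rw [hK]; positivity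
  have hKp : K ≤ ε * p ^ 2 := by
    have h1 : (η / 2 * sN) ^ 2 ≤ p ^ 2 := pow_le_pow_left₀ (by positivity) hpη 2
    have h2 : K = ε * (η / 2 * sN) ^ 2 := by rw [hK, ← hsN2]; ring
    rw [h2]; exact mul_le_mul_of_nonneg_left h1 hε0.le
  -- All n eigenvalues of the zero matrix lie at distance sn p above the barrier, so the trace term
  -- equals n/(sn p) = sn/p = φ₀.
  have hinit : BelowBarrier K (φ₀ + ε) (0 : Matrix (Fin n) (Fin n) ℝ) (-(sn * p)) := by
    refine belowBarrier_zero (by have := mul_pos hsn0 hp0; linarith) ?_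
    rw [neg_neg, ← hsn2]
    have h1 : sn ^ 2 * (sn * p)⁻¹ = φ₀ := by rw [hφ₀]; field_simp
    have h2 : K * (sn ^ 2 * (sn * p)⁻¹ ^ 2) = K / p ^ 2 := by field_simp
    rw [h1, h2]
    have h3 : K / p ^ 2 ≤ ε := by rw [div_le_iff₀ (by positivity)]; exact hKp
    linarith
  obtain ⟨d, hd⟩ : ∃ d, d = (1 - 19 * ε) / (1 + φ₀) * β := ⟨_, rfl⟩
  have hst : ∀ (S : Matrix (Fin n) (Fin n) ℝ) (u : ℝ), BelowBarrier K (φ₀ + ε) S u →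
      ∃ δ : (Fin n → ℝ) → ℝ, Measurable δ ∧ (∀ x, 0 ≤ δ x) ∧ (∀ x, δ x ≤ Δ) ∧
        (∀ x, BelowBarrier K (φ₀ + ε) (S + vecMulVec x x) (u + δ x)) ∧
        d ≤ ∫ x, δ x ∂(Measure.pi fun _ : Fin n => ν) := by
    intro S u hS
    obtain ⟨δ, h1, h2, h3, h4, h5⟩ := hstep K hK0K n hn (φ₀ + ε) (by linarith)
      (by linarith) S u hS
    refine ⟨δ, h1, h2, h3, h4, le_trans ?_ h5⟩
    have e1 : A / Δ = ε / 2 := by rw [hΔ]; field_simp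
    have e2 : 3 * ε' * Δ = ε / 2 := by rw [hε']; field_simp; norm_num
    rw [← hA, e1, e2, hσ2]
    have e3 : 1 - 2 * σ ^ 2 - ε / 2 - ε / 2 = β + ε := by rw [hβ]; ring
    rw [e3]
    have e4 := shift_rate_ge hε0.le hε80 hφ₀0.le
    have e5 : 0 ≤ (1 - 8 * ε) / ((1 + 2 * ε) ^ 4 * (1 + (φ₀ + ε) + 2 * ε)) :=
      div_nonneg (by linarith) (by positivity)
    rw [hd]
    calc (1 - 19 * ε) / (1 + φ₀) * β
        ≤ (1 - 8 * ε) / ((1 + 2 * ε) ^ 4 * (1 + (φ₀ + ε) + 2 * ε)) * β :=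
          mul_le_mul_of_nonneg_right e4 hβ0.le
      _ ≤ _ := mul_le_mul_of_nonneg_left (by linarith) e5
  -- This `l` minimizes -lε + l²Δ²/2, the exponent per row once the drift is -εN.
  have hmain := measure_not_lowerBounded_le (l := ε / Δ ^ 2) (by positivity) hst N 0
    (-(sn * p)) (t ^ 2) hinit
  simp only [zero_add] at hmain
  refine hmain.trans (ENNReal.ofReal_le_ofReal ?_)
  rw [← Real.exp_nat_mul, ← Real.exp_add]
  refine Real.exp_le_exp.mpr ?_
  have hdN := barrier_drift_le hε0.le hsn0 hp0 hp hsβN hsN2 hsN0 hsβ2 hp2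
  rw [← hφ₀, ← hd] at hdN
  have hl : 0 ≤ ε / Δ ^ 2 := by positivity
  calc ε / Δ ^ 2 * (t ^ 2 - -(sn * p)) + ↑N * (-(ε / Δ ^ 2 * d) + (ε / Δ ^ 2) ^ 2 * Δ ^ 2 / 2)
      = ε / Δ ^ 2 * (t ^ 2 + sn * p - d * N) + N * ((ε / Δ ^ 2) ^ 2 * Δ ^ 2 / 2) := by ring
    _ ≤ ε / Δ ^ 2 * (-(ε * N)) + N * ((ε / Δ ^ 2) ^ 2 * Δ ^ 2 / 2) :=
        add_le_add (mul_le_mul_of_nonneg_left hdN hl) le_rfl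
    _ = _ := by field_simp; ring

end LowerTail

/-! ### Bounded differences inequality -/

section BoundedDifferences

variable {E : Type*} [MeasurableSpace E] {μ : Measure E} [IsProbabilityMeasure μ]

theorem BddMeas.exp (l : ℝ) {f : E → ℝ} (hf : BddMeas f) : BddMeas fun x => Real.exp (l * f x) := by
  obtain ⟨hm, C, hC⟩ := hf
  refine ⟨by fun_prop, Real.exp (|l| * C), fun x => ?_⟩
  rw [abs_of_pos (Real.exp_pos _)]
  refine Real.exp_le_exp.mpr ((le_abs_self _).trans ?_)
  rw [abs_mul]
  exact mul_le_mul_of_nonneg_left (hC x) (abs_nonneg _)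

theorem abs_sub_integral_le {F : E → ℝ} (hF : BddMeas F) {c : ℝ}
    (hc : ∀ x y, |F x - F y| ≤ c) (x : E) : |F x - ∫ y, F y ∂μ| ≤ c := by
  have h : F x - ∫ y, F y ∂μ = ∫ y, (F x - F y) ∂μ := by
    rw [integral_sub (integrable_const _) (hF.integrable μ)]; simp
  rw [h]
  have := norm_integral_le_of_norm_le_const (μ := μ) (f := fun y => F x - F y) (C := c)
    (Filter.Eventually.of_forall fun y => hc x y)
  simpa using this

/-- Hoeffding's lemma on [-c, c]. This interval is longer than the oscillation requires, which is
where the constant is lost. -/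
theorem integral_exp_sub_integral_le {F : E → ℝ} (hF : BddMeas F) {c : ℝ} (hc0 : 0 ≤ c)
    (hc : ∀ x y, |F x - F y| ≤ c) (l : ℝ) :
    ∫ x, Real.exp (l * (F x - ∫ y, F y ∂μ)) ∂μ ≤ Real.exp (l ^ 2 * c ^ 2 / 2) := by
  have hb : BddMeas fun x => F x - ∫ y, F y ∂μ := hF.sub (.const _)
  have h := hasSubgaussianMGF_of_mem_Icc_of_integral_eq_zero (μ := μ) (a := -c) (b := c)
    (X := fun x => F x - ∫ y, F y ∂μ) hb.1.aemeasurable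
    (Filter.Eventually.of_forall fun x => abs_le.mp (abs_sub_integral_le hF hc x))
    (by rw [integral_sub (hF.integrable μ) (integrable_const _)]; simp)
  have h2 := h.mgf_le l
  rw [mgf] at h2
  refine h2.trans_eq ?_
  congr 1
  have : ((‖c - -c‖₊ / 2 : NNReal) : ℝ) = c := by
    push_cast
    rw [Real.norm_of_nonneg (by linarith)]; ring
  rw [NNReal.coe_pow, this]; ring

/-- Exponential moments of a function with bounded differences. -/
theorem integral_exp_sub_integral_pi_le {c : ℝ} (hc0 : 0 ≤ c) (l : ℝ) (N : ℕ)
    (f : (Fin N → E) → ℝ) (hf : BddMeas f)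
    (hc : ∀ X i x, |f (Function.update X i x) - f X| ≤ c) :
    ∫ X, Real.exp (l * (f X - ∫ Y, f Y ∂(Measure.pi fun _ : Fin N => μ)))
        ∂(Measure.pi fun _ : Fin N => μ) ≤ Real.exp (N * (l ^ 2 * c ^ 2 / 2)) := by
  induction N with
  | zero =>
    have h : ∀ X : Fin 0 → E, f X = f Fin.elim0 := fun X => by rw [Subsingleton.elim X Fin.elim0]
    simp_rw [h]
    simp
  | succ N ih =>
    have hcons : Measurable fun p : E × (Fin N → E) => (Fin.cons p.1 p.2 : Fin (N + 1) → E) := by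
      refine measurable_pi_iff.mpr fun i => ?_
      refine Fin.cases ?_ (fun j => ?_) i
      · simpa using measurable_fst
      · simp only [Fin.cons_succ]; fun_prop
    have hfx : ∀ x, BddMeas fun Y : Fin N → E => f (Fin.cons x Y) := fun x =>
      hf.comp (hcons.comp (by fun_prop : Measurable fun Y : Fin N → E => (x, Y)))
    obtain ⟨F, hFd⟩ : ∃ F : E → ℝ,
        ∀ x, F x = ∫ Y, f (Fin.cons x Y) ∂(Measure.pi fun _ : Fin N => μ) := ⟨_, fun _ => rfl⟩
    have hF : BddMeas F := by
      have hF' : F = fun x => ∫ Y, f (Fin.cons x Y) ∂(Measure.pi fun _ : Fin N => μ) := funext hFd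
      obtain ⟨C, hC⟩ := hf.2
      refine ⟨?_, C, fun x => ?_⟩
      · rw [hF']
        exact ((hf.1.comp hcons).stronglyMeasurable.integral_prod_right').measurable
      · rw [hFd]
        have := norm_integral_le_of_norm_le_const (μ := Measure.pi fun _ : Fin N => μ) (C := C)
          (f := fun Y : Fin N → E => f (Fin.cons x Y)) (Filter.Eventually.of_forall fun Y => hC _)
        simpa using this
    have hint : ∫ X, f X ∂(Measure.pi fun _ : Fin (N + 1) => μ) = ∫ x, F x ∂μ := by
      rw [integral_pi_cons μ (hf.integrable _)]
      simp_rw [hFd]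
    have hFc : ∀ x y, |F x - F y| ≤ c := fun x y => by
      rw [hFd, hFd, ← integral_sub ((hfx x).integrable _) ((hfx y).integrable _)]
      have := norm_integral_le_of_norm_le_const (μ := Measure.pi fun _ : Fin N => μ) (C := c)
        (f := fun Y : Fin N → E => f (Fin.cons x Y) - f (Fin.cons y Y))
        (Filter.Eventually.of_forall fun Y => by
          have := hc (Fin.cons y Y) 0 x
          rwa [Fin.update_cons_zero] at this)
      simpa using this
    have hstep : ∀ x, ∫ Y, Real.exp (l * (f (Fin.cons x Y) - F x))
        ∂(Measure.pi fun _ : Fin N => μ) ≤ Real.exp (N * (l ^ 2 * c ^ 2 / 2)) := fun x => by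
      rw [hFd]
      refine ih (fun Y => f (Fin.cons x Y)) (hfx x) fun Y i y => ?_
      have := hc (Fin.cons x Y) i.succ y
      rwa [← Fin.cons_update] at this
    have hb : BddMeas fun X => Real.exp (l * (f X - ∫ x, F x ∂μ)) :=
      (hf.sub (.const _)).exp l
    rw [hint, integral_pi_cons μ (hb.integrable _)]
    -- The exponent splits into the deviation of `f` from its conditional mean `F` given the first
    -- coordinate, and that of `F` from its mean; both have bounded differences.
    have hinner : ∀ x, ∫ Y, Real.exp (l * (f (Fin.cons x Y) - ∫ x, F x ∂μ))
          ∂(Measure.pi fun _ : Fin N => μ)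
        ≤ Real.exp (N * (l ^ 2 * c ^ 2 / 2)) * Real.exp (l * (F x - ∫ x, F x ∂μ)) := fun x => by
      have h : ∀ Y : Fin N → E, Real.exp (l * (f (Fin.cons x Y) - ∫ x, F x ∂μ))
          = Real.exp (l * (f (Fin.cons x Y) - F x)) * Real.exp (l * (F x - ∫ x, F x ∂μ)) :=
        fun Y => by rw [← Real.exp_add]; congr 1; ring
      simp_rw [h]
      rw [integral_mul_const]
      exact mul_le_mul_of_nonneg_right (hstep x) (Real.exp_pos _).le
    have hexpF : BddMeas fun x => Real.exp (l * (F x - ∫ x, F x ∂μ)) := (hF.sub (.const _)).exp l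
    refine (integral_mono_of_nonneg (Filter.Eventually.of_forall fun x =>
      integral_nonneg fun Y => (Real.exp_pos _).le) ((hexpF.integrable μ).const_mul _)
      (Filter.Eventually.of_forall hinner)).trans ?_
    rw [integral_const_mul]
    refine (mul_le_mul_of_nonneg_left (integral_exp_sub_integral_le hF hc0 hFc l)
      (Real.exp_pos _).le).trans_eq ?_
    rw [← Real.exp_add]
    congr 1
    push_cast
    ring

/-- McDiarmid's bounded differences inequality (with a non-optimal constant). -/
theorem measureReal_pi_ge_le_of_bounded_differences {c : ℝ} (hc0 : 0 < c) {N : ℕ} (hN : 0 < N)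
    {f : (Fin N → E) → ℝ} (hf : BddMeas f)
    (hc : ∀ X i x, |f (Function.update X i x) - f X| ≤ c) {s : ℝ} (hs : 0 ≤ s) :
    (Measure.pi fun _ : Fin N => μ).real
        {X | ∫ Y, f Y ∂(Measure.pi fun _ : Fin N => μ) + s ≤ f X}
      ≤ Real.exp (-(s ^ 2 / (2 * N * c ^ 2))) := by
  have hN' : (0 : ℝ) < N := by exact_mod_cast hN
  set l := s / (N * c ^ 2) with hl
  have hl0 : 0 ≤ l := by positivity
  set Z : (Fin N → E) → ℝ := fun X => f X - ∫ Y, f Y ∂(Measure.pi fun _ : Fin N => μ) with hZ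
  have hZb : BddMeas Z := hf.sub (.const _)
  have h := measure_ge_le_exp_mul_mgf (μ := Measure.pi fun _ : Fin N => μ) (X := Z) s hl0
    ((hZb.exp l).integrable _)
  have hset : {X | ∫ Y, f Y ∂(Measure.pi fun _ : Fin N => μ) + s ≤ f X} = {X | s ≤ Z X} := by
    ext X; simp only [Set.mem_ofPred_eq, hZ]; constructor <;> intro h <;> linarith
  rw [hset]
  refine h.trans ((mul_le_mul_of_nonneg_left
    (integral_exp_sub_integral_pi_le hc0.le l N f hf hc) (Real.exp_pos _).le).trans_eq ?_)
  rw [← Real.exp_add]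
  congr 1
  rw [hl]
  field_simp
  ring

end BoundedDifferences

/-! ### Resolvents and the self-consistent equation -/

section Stieltjes

open Matrix

variable {n N : ℕ}

/-- The resolvent `(S - w)⁻¹` of a real matrix at a complex point. -/
noncomputable def resolventAt (S : Matrix (Fin n) (Fin n) ℝ) (w : ℂ) : Matrix (Fin n) (Fin n) ℂ :=
  (S.map (algebraMap ℝ ℂ) - w • 1)⁻¹

/-- The quadratic form of the resolvent at a real vector. -/
noncomputable def resolventForm (S : Matrix (Fin n) (Fin n) ℝ) (w : ℂ) (x : Fin n → ℝ) : ℂ :=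
  liftVec ℂ x ⬝ᵥ resolventAt S w *ᵥ liftVec ℂ x

theorem lowerBounded_rowGram (X : Fin N → Fin n → ℝ) : LowerBounded (rowGram X) 0 := fun x => by
  rw [zero_mul, dotProduct_rowGram]
  exact Finset.sum_nonneg fun k _ => sq_nonneg _

theorem ofReal_sub_ne_zero {w : ℂ} (hw : 0 < w.im) (r : ℝ) : algebraMap ℝ ℂ r - w ≠ 0 := fun h => by
  have := congrArg Complex.im h
  simp at this
  linarith

theorem im_inv_ofReal_sub {w : ℂ} (r : ℝ) :
    ((algebraMap ℝ ℂ r - w)⁻¹).im = w.im * ‖(algebraMap ℝ ℂ r - w)⁻¹‖ ^ 2 := by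
  rw [Complex.inv_im, norm_inv, inv_pow, ← Complex.normSq_eq_norm_sq]
  simp [div_eq_mul_inv]

theorem norm_inv_ofReal_sub_le {w : ℂ} (hw : 0 < w.im) (r : ℝ) :
    ‖(algebraMap ℝ ℂ r - w)⁻¹‖ ≤ w.im⁻¹ := by
  rw [norm_inv]
  refine inv_anti₀ hw ?_
  have := Complex.abs_im_le_norm (algebraMap ℝ ℂ r - w)
  simp only [Complex.coe_algebraMap, Complex.sub_im, Complex.ofReal_im, zero_sub, abs_neg] at this
  exact (le_abs_self _).trans this

section

variable {U : Matrix (Fin n) (Fin n) ℝ} {lam : Fin n → ℝ} {w : ℂ}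

theorem resolvent_specMat (hU : Uᵀ * U = 1) (hw : 0 < w.im) :
    resolventAt (specMat U lam) w = specMat U fun j => (algebraMap ℝ ℂ (lam j) - w)⁻¹ := by
  rw [resolventAt, map_specMat_sub_smul hU, specMat_inv hU fun j => ofReal_sub_ne_zero hw _]
  rfl

theorem trace_resolvent_specMat (hU : Uᵀ * U = 1) (hw : 0 < w.im) :
    (resolventAt (specMat U lam) w).trace = ∑ j, (algebraMap ℝ ℂ (lam j) - w)⁻¹ := by
  rw [resolvent_specMat hU hw, trace_specMat hU]

theorem resolventForm_specMat (hU : Uᵀ * U = 1) (hw : 0 < w.im) (x : Fin n → ℝ) :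
    resolventForm (specMat U lam) w x
      = ∑ j, (algebraMap ℝ ℂ (lam j) - w)⁻¹ * algebraMap ℝ ℂ ((Uᵀ *ᵥ x) j ^ 2) := by
  rw [resolventForm, resolvent_specMat hU hw, dotProduct_specMat_mulVec]

/-- `w (1 + ∑ yⱼ / (lamⱼ - w))` has imaginary part at least `Im w` when `lam, y ≥ 0`. -/
theorem im_le_norm_mul_norm_one_add (hw : 0 < w.im) (hlam : ∀ j, 0 ≤ lam j) {y : Fin n → ℝ}
    (hy : ∀ j, 0 ≤ y j) :
    w.im ≤ ‖w‖ * ‖1 + ∑ j, (algebraMap ℝ ℂ (lam j) - w)⁻¹ * algebraMap ℝ ℂ (y j)‖ := by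
  rw [← norm_mul]
  -- Writing w/(λ - w) = λ/(λ - w) - 1 exhibits a nonnegative imaginary part, as λ, y ≥ 0.
  have h : w * (1 + ∑ j, (algebraMap ℝ ℂ (lam j) - w)⁻¹ * algebraMap ℝ ℂ (y j))
      = w + ∑ j, (algebraMap ℝ ℂ (y j * lam j) * (algebraMap ℝ ℂ (lam j) - w)⁻¹
        - algebraMap ℝ ℂ (y j)) := by
    rw [mul_add, mul_one, Finset.mul_sum]
    congr 1
    refine Finset.sum_congr rfl fun j _ => ?_
    have := ofReal_sub_ne_zero hw (lam j)
    rw [map_mul]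
    field_simp
    ring
  have him : w.im ≤ (w * (1 + ∑ j, (algebraMap ℝ ℂ (lam j) - w)⁻¹ * algebraMap ℝ ℂ (y j))).im := by
    rw [h, Complex.add_im, Complex.im_sum]
    refine le_add_of_nonneg_right (Finset.sum_nonneg fun j _ => ?_)
    rw [Complex.sub_im, Complex.coe_algebraMap, Complex.im_ofReal_mul, ← Complex.coe_algebraMap,
      im_inv_ofReal_sub]
    simp only [Complex.coe_algebraMap, Complex.ofReal_im, sub_zero]
    have := hlam j
    have := hy j
    positivity
  exact him.trans ((le_abs_self _).trans (Complex.abs_im_le_norm _))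

theorem one_add_ne_zero (hw : 0 < w.im) (hlam : ∀ j, 0 ≤ lam j) {y : Fin n → ℝ}
    (hy : ∀ j, 0 ≤ y j) :
    1 + ∑ j, (algebraMap ℝ ℂ (lam j) - w)⁻¹ * algebraMap ℝ ℂ (y j) ≠ 0 := fun h => by
  have := im_le_norm_mul_norm_one_add hw hlam hy
  rw [h, norm_zero, mul_zero] at this
  linarith

theorem im_sum_inv_mul (y : Fin n → ℝ) :
    (∑ j, (algebraMap ℝ ℂ (lam j) - w)⁻¹ * algebraMap ℝ ℂ (y j)).im
      = w.im * ∑ j, ‖(algebraMap ℝ ℂ (lam j) - w)⁻¹‖ ^ 2 * y j := by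
  rw [Complex.im_sum, Finset.mul_sum]
  refine Finset.sum_congr rfl fun j _ => ?_
  rw [Complex.coe_algebraMap, Complex.im_mul_ofReal, ← Complex.coe_algebraMap, im_inv_ofReal_sub]
  ring

/-- The numerator is at most Σ |d_j|² y_j with d_j = (λ_j - w)⁻¹, and Im w times this sum is the
imaginary part of the denominator. Hence a rank-one update moves the trace by at most 1/Im w,
however large the row is. -/
theorem norm_sum_sq_div_le (hw : 0 < w.im) {y : Fin n → ℝ} (hy : ∀ j, 0 ≤ y j) :
    ‖(∑ j, (algebraMap ℝ ℂ (lam j) - w)⁻¹ ^ 2 * algebraMap ℝ ℂ (y j))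
        / (1 + ∑ j, (algebraMap ℝ ℂ (lam j) - w)⁻¹ * algebraMap ℝ ℂ (y j))‖ ≤ w.im⁻¹ := by
  rw [norm_div]
  refine div_le_of_le_mul₀ (norm_nonneg _) (by positivity) ?_
  have h1 : ‖∑ j, (algebraMap ℝ ℂ (lam j) - w)⁻¹ ^ 2 * algebraMap ℝ ℂ (y j)‖
      ≤ ∑ j, ‖(algebraMap ℝ ℂ (lam j) - w)⁻¹‖ ^ 2 * y j := by
    refine (norm_sum_le _ _).trans (Finset.sum_le_sum fun j _ => ?_)
    rw [norm_mul, norm_pow, norm_algebraMap', Real.norm_of_nonneg (hy j)]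
  have h2 := im_sum_inv_mul (lam := lam) (w := w) y
  have h3 := Complex.abs_im_le_norm
    (1 + ∑ j, (algebraMap ℝ ℂ (lam j) - w)⁻¹ * algebraMap ℝ ℂ (y j))
  rw [Complex.add_im, h2, Complex.one_im, zero_add] at h3
  have h4 := (le_abs_self _).trans h3
  rw [inv_mul_eq_div, le_div_iff₀ hw, mul_comm]
  exact (mul_le_mul_of_nonneg_left h1 hw.le).trans h4

end

theorem exists_specMat_of_lowerBounded {S : Matrix (Fin n) (Fin n) ℝ} (hS : Sᵀ = S) {t : ℝ}
    (h : LowerBounded S t) : ∃ (U : Matrix (Fin n) (Fin n) ℝ) (lam : Fin n → ℝ),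
      Uᵀ * U = 1 ∧ S = specMat U lam ∧ ∀ j, t ≤ lam j := by
  obtain ⟨U, lam, hU, rfl⟩ := exists_eq_specMat hS
  exact ⟨U, lam, hU, rfl, h.le_eigenvalue hU⟩

theorem map_add_vecMulVec_sub_smul (S : Matrix (Fin n) (Fin n) ℝ) (x : Fin n → ℝ) (w : ℂ) :
    (S + vecMulVec x x).map (algebraMap ℝ ℂ) - w • 1
      = S.map (algebraMap ℝ ℂ) - w • 1 + vecMulVec (liftVec ℂ x) (liftVec ℂ x) := by
  have : (vecMulVec x x).map (algebraMap ℝ ℂ) = vecMulVec (liftVec ℂ x) (liftVec ℂ x) := by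
    ext i j; simp [vecMulVec_apply, liftVec]
  rw [Matrix.map_add _ (map_add _), this]
  abel

variable {S : Matrix (Fin n) (Fin n) ℝ} {w : ℂ}

theorem im_le_norm_mul_norm_one_add_resolventForm (hS : Sᵀ = S) (h0 : LowerBounded S 0)
    (hw : 0 < w.im) (x : Fin n → ℝ) : w.im ≤ ‖w‖ * ‖1 + resolventForm S w x‖ := by
  obtain ⟨U, lam, hU, rfl, hlam⟩ := exists_specMat_of_lowerBounded hS h0
  rw [resolventForm_specMat hU hw]
  exact im_le_norm_mul_norm_one_add hw hlam fun j => sq_nonneg _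

theorem im_le_norm_mul_norm_one_add_trace (hS : Sᵀ = S) (h0 : LowerBounded S 0)
    (hw : 0 < w.im) {a : ℝ} (ha : 0 ≤ a) :
    w.im ≤ ‖w‖ * ‖1 + (a : ℂ) * (resolventAt S w).trace‖ := by
  obtain ⟨U, lam, hU, rfl, hlam⟩ := exists_specMat_of_lowerBounded hS h0
  rw [trace_resolvent_specMat hU hw]
  have := im_le_norm_mul_norm_one_add (y := fun _ => a) hw hlam fun j => ha
  rwa [← Finset.sum_mul, mul_comm _ (algebraMap ℝ ℂ a)] at this

theorem norm_trace_resolvent_le (hS : Sᵀ = S) (hw : 0 < w.im) :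
    ‖(resolventAt S w).trace‖ ≤ n * w.im⁻¹ := by
  obtain ⟨U, lam, hU, rfl⟩ := exists_eq_specMat hS
  rw [trace_resolvent_specMat hU hw]
  refine (norm_sum_le_of_le _ fun j _ => norm_inv_ofReal_sub_le hw _).trans ?_
  simp

theorem norm_trace_resolvent_add_sub_le (hS : Sᵀ = S) (h0 : LowerBounded S 0)
    (hw : 0 < w.im) (x : Fin n → ℝ) :
    ‖(resolventAt (S + vecMulVec x x) w).trace - (resolventAt S w).trace‖ ≤ w.im⁻¹ := by
  obtain ⟨U, lam, hU, rfl, hlam⟩ := exists_specMat_of_lowerBounded hS h0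
  rw [trace_resolvent_specMat hU hw, resolventAt, map_add_vecMulVec_sub_smul,
    map_specMat_sub_smul hU, (trace_inv_add_vecMulVec hU (fun j => ofReal_sub_ne_zero hw _) x
      (one_add_ne_zero hw hlam fun j => sq_nonneg _)).1, sub_sub_cancel_left, norm_neg]
  exact norm_sum_sq_div_le hw fun j => sq_nonneg _

theorem resolventForm_add_vecMulVec (hS : Sᵀ = S) (h0 : LowerBounded S 0)
    (hw : 0 < w.im) (x : Fin n → ℝ) :
    resolventForm (S + vecMulVec x x) w x = 1 - 1 / (1 + resolventForm S w x) := by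
  obtain ⟨U, lam, hU, rfl, hlam⟩ := exists_specMat_of_lowerBounded hS h0
  rw [resolventForm_specMat hU hw, resolventForm, resolventAt, map_add_vecMulVec_sub_smul,
    map_specMat_sub_smul hU, (trace_inv_add_vecMulVec hU (fun j => ofReal_sub_ne_zero hw _) x
      (one_add_ne_zero hw hlam fun j => sq_nonneg _)).2.1]

/-- Both sides are the trace of R times the Gram matrix, that product being 1 + w R. -/
theorem sum_resolventForm_rowGram (hw : 0 < w.im) (X : Fin N → Fin n → ℝ) :
    ∑ i, resolventForm (rowGram X) w (X i) = n + w * (resolventAt (rowGram X) w).trace := by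
  have h1 : ∀ i, resolventForm (rowGram X) w (X i)
      = (resolventAt (rowGram X) w * vecMulVec (liftVec ℂ (X i)) (liftVec ℂ (X i))).trace := fun i => by
    rw [Matrix.mul_vecMulVec, Matrix.trace_vecMulVec, resolventForm, dotProduct_comm]
  have h2 : ∑ i, vecMulVec (liftVec ℂ (X i)) (liftVec ℂ (X i))
      = (rowGram X).map (algebraMap ℝ ℂ) - w • 1 + w • 1 := by
    rw [sub_add_cancel, rowGram]
    ext a b
    simp [Matrix.sum_apply, vecMulVec_apply, liftVec]
  simp_rw [h1]
  rw [← Matrix.trace_sum, ← Matrix.mul_sum, h2, Matrix.mul_add, Matrix.trace_add]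
  have h3 : IsUnit ((rowGram X).map (algebraMap ℝ ℂ) - w • 1) := by
    obtain ⟨U, lam, hU, h⟩ := exists_eq_specMat (transpose_rowGram X)
    rw [h, map_specMat_sub_smul hU]
    exact isUnit_specMat hU fun j => ofReal_sub_ne_zero hw _
  rw [resolventAt, Matrix.nonsing_inv_mul _ ((Matrix.isUnit_iff_isUnit_det _).mp h3)]
  simp

/-- The error in the self-consistent equation for the trace of the resolvent. -/
noncomputable def selfConsistentError (N n : ℕ) (a : ℝ) (w m : ℂ) : ℂ :=
  w * m + n - N + N / (1 + a * m)

/-- Each row satisfies X_iᵀRX_i = 1 - 1/(1 + X_iᵀR_iX_i), where R_i is the resolvent without row i.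
Summing these against the trace identity leaves the differences on the right. -/
theorem selfConsistentError_rowGram {a : ℝ} (hw : 0 < w.im)
    (X : Fin (N + 1) → Fin n → ℝ) :
    selfConsistentError (N + 1) n a w (resolventAt (rowGram X) w).trace
      = ∑ i, (1 / (1 + a * (resolventAt (rowGram X) w).trace)
        - 1 / (1 + resolventForm (rowGram (i.removeNth X)) w (X i))) := by
  have h := sum_resolventForm_rowGram hw X
  have h1 : ∀ i, resolventForm (rowGram X) w (X i)
      = 1 - 1 / (1 + resolventForm (rowGram (i.removeNth X)) w (X i)) := fun i => by
    rw [← resolventForm_add_vecMulVec (transpose_rowGram _) (lowerBounded_rowGram _) hw,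
      ← rowGram_insertNth, Fin.insertNth_self_removeNth]
  simp_rw [h1] at h
  rw [Finset.sum_sub_distrib] at h ⊢
  simp only [Finset.sum_const, Finset.card_univ, Fintype.card_fin, nsmul_eq_mul, mul_one] at h ⊢
  rw [selfConsistentError]
  linear_combination -h

/-- The lower bounds on |1 + x| and |1 + y| make z ↦ 1/(1 + z) Lipschitz, with a constant that stays
bounded when |w| and Im w are of the same order. -/
theorem norm_one_div_sub_one_div_le {w x y : ℂ} (hw : 0 < w.im) (hx : w.im ≤ ‖w‖ * ‖1 + x‖)
    (hy : w.im ≤ ‖w‖ * ‖1 + y‖) :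
    ‖1 / (1 + x) - 1 / (1 + y)‖ ≤ (‖w‖ / w.im) ^ 2 * ‖x - y‖ := by
  have hx0 : 0 < ‖1 + x‖ := by
    by_contra h
    have h0 : ‖1 + x‖ = 0 := le_antisymm (not_lt.mp h) (norm_nonneg _)
    rw [h0] at hx; linarith
  have hy0 : 0 < ‖1 + y‖ := by
    by_contra h
    have h0 : ‖1 + y‖ = 0 := le_antisymm (not_lt.mp h) (norm_nonneg _)
    rw [h0] at hy; linarith
  have e : 1 / (1 + x) - 1 / (1 + y) = -((1 + x)⁻¹ * (1 + y)⁻¹ * (x - y)) := by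
    have := norm_pos_iff.mp hx0
    have := norm_pos_iff.mp hy0
    field_simp
    ring
  have key : ∀ z : ℂ, w.im ≤ ‖w‖ * ‖z‖ → 0 < ‖z‖ → ‖z‖⁻¹ ≤ ‖w‖ / w.im := fun z hz hz0 => by
    rw [inv_eq_one_div, div_le_div_iff₀ hz0 hw, one_mul]; exact hz
  rw [e, norm_neg, norm_mul, norm_mul, norm_inv, norm_inv, sq]
  exact mul_le_mul_of_nonneg_right (mul_le_mul (key _ hx hx0) (key _ hy hy0) (by positivity)
    (by positivity)) (norm_nonneg _)

/-- For independent rows, R_i is independent of X_i, so the first term is a fluctuation of a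
quadratic form; the second is the price of replacing tr R by tr R_i. -/
theorem norm_selfConsistentError_rowGram_le {a : ℝ} (ha : 0 ≤ a) (hw : 0 < w.im)
    (X : Fin (N + 1) → Fin n → ℝ) :
    ‖selfConsistentError (N + 1) n a w (resolventAt (rowGram X) w).trace‖
      ≤ ∑ i, (‖w‖ / w.im) ^ 2 * (‖resolventForm (rowGram (i.removeNth X)) w (X i)
          - a * (resolventAt (rowGram (i.removeNth X)) w).trace‖ + a * w.im⁻¹) := by
  rw [selfConsistentError_rowGram hw]
  refine norm_sum_le_of_le _ fun i _ => ?_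
  refine (norm_one_div_sub_one_div_le hw
    (im_le_norm_mul_norm_one_add_trace (transpose_rowGram _) (lowerBounded_rowGram _) hw ha)
    (im_le_norm_mul_norm_one_add_resolventForm (transpose_rowGram _) (lowerBounded_rowGram _) hw
      _)).trans (mul_le_mul_of_nonneg_left ?_ (by positivity))
  have h1 := norm_trace_resolvent_add_sub_le (transpose_rowGram (i.removeNth X))
    (lowerBounded_rowGram _) hw (X i)
  rw [← rowGram_insertNth, Fin.insertNth_self_removeNth] at h1
  have h2 : (a : ℂ) * (resolventAt (rowGram X) w).trace
        - resolventForm (rowGram (i.removeNth X)) w (X i)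
      = -(resolventForm (rowGram (i.removeNth X)) w (X i)
          - a * (resolventAt (rowGram (i.removeNth X)) w).trace)
        + a * ((resolventAt (rowGram X) w).trace - (resolventAt (rowGram (i.removeNth X)) w).trace) := by
    ring
  rw [h2]
  refine (norm_add_le _ _).trans (add_le_add (norm_neg _).le ?_)
  rw [norm_mul, Complex.norm_real, Real.norm_of_nonneg ha]
  exact mul_le_mul_of_nonneg_left h1 ha

/-- The norm of the self-consistent error has bounded differences. -/
theorem abs_norm_selfConsistentError_sub_le {a : ℝ} (ha : 0 ≤ a) (ha1 : a ≤ 1) (hw : 0 < w.im)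
    (X : Fin N → Fin n → ℝ) (i : Fin N) (x : Fin n → ℝ) :
    |‖selfConsistentError N n a w (resolventAt (rowGram (Function.update X i x)) w).trace‖
      - ‖selfConsistentError N n a w (resolventAt (rowGram X) w).trace‖|
      ≤ (‖w‖ + N * (‖w‖ / w.im) ^ 2) * (2 * w.im⁻¹) := by
  obtain ⟨N, rfl⟩ : ∃ N', N = N' + 1 := ⟨N - 1, by have := i.pos; omega⟩
  refine (abs_norm_sub_norm_le _ _).trans ?_
  set m := (resolventAt (rowGram (Function.update X i x)) w).trace with hm
  set m' := (resolventAt (rowGram X) w).trace with hm'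
  have hd : ‖m - m'‖ ≤ 2 * w.im⁻¹ := by
    have h1 := norm_trace_resolvent_add_sub_le (transpose_rowGram (i.removeNth X))
      (lowerBounded_rowGram _) hw (X i)
    have h2 := norm_trace_resolvent_add_sub_le (transpose_rowGram (i.removeNth X))
      (lowerBounded_rowGram _) hw x
    rw [← rowGram_insertNth, Fin.insertNth_self_removeNth] at h1
    rw [← rowGram_insertNth, Fin.insertNth_removeNth] at h2
    have e : m - m' = (m - (resolventAt (rowGram (i.removeNth X)) w).trace)
      - (m' - (resolventAt (rowGram (i.removeNth X)) w).trace) := by ring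
    rw [e]
    refine (norm_sub_le _ _).trans ?_
    linarith
  have e : selfConsistentError (N + 1) n a w m - selfConsistentError (N + 1) n a w m'
      = w * (m - m') + (N + 1 : ℕ) * (1 / (1 + a * m) - 1 / (1 + a * m')) := by
    simp only [selfConsistentError]; ring
  rw [e, add_mul]
  refine (norm_add_le _ _).trans (add_le_add ?_ ?_)
  · rw [norm_mul]
    exact mul_le_mul_of_nonneg_left hd (norm_nonneg _)
  · rw [norm_mul, Complex.norm_natCast, mul_assoc]
    refine mul_le_mul_of_nonneg_left ((norm_one_div_sub_one_div_le hw
      (im_le_norm_mul_norm_one_add_trace (transpose_rowGram _) (lowerBounded_rowGram _) hw ha)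
      (im_le_norm_mul_norm_one_add_trace (transpose_rowGram _) (lowerBounded_rowGram _) hw
        ha)).trans (mul_le_mul_of_nonneg_left ?_ (by positivity))) (by positivity)
    rw [← mul_sub, norm_mul, Complex.norm_real, Real.norm_of_nonneg ha]
    exact (mul_le_of_le_one_left (norm_nonneg _) ha1).trans hd

end Stieltjes

/-! ### Deterministic and mean estimates for the self-consistent equation -/

section UpperTail

open Matrix

variable {n N : ℕ}

theorem measurable_resolventAt_rowGram (w : ℂ) (i j : Fin n) :
    Measurable fun X : Fin N → Fin n → ℝ => resolventAt (rowGram X) w i j := by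
  have hc : Continuous fun X : Fin N → Fin n → ℝ =>
      (rowGram X).map (algebraMap ℝ ℂ) - w • (1 : Matrix (Fin n) (Fin n) ℂ) := by
    refine Continuous.sub (continuous_matrix fun a b => ?_) continuous_const
    simp only [rowGram, Matrix.map_apply, Matrix.sum_apply, vecMulVec_apply, Complex.coe_algebraMap]
    fun_prop
  have h1 := hc.matrix_det.measurable
  have h2 := (hc.matrix_adjugate.matrix_elem i j).measurable
  simp only [resolventAt, Matrix.inv_def, Ring.inverse_eq_inv', Matrix.smul_apply, smul_eq_mul]
  exact h1.inv.mul h2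

theorem measurable_trace_resolventAt (w : ℂ) :
    Measurable fun X : Fin N → Fin n → ℝ => (resolventAt (rowGram X) w).trace := by
  simp only [Matrix.trace, Matrix.diag]
  exact Finset.measurable_sum _ fun i _ => measurable_resolventAt_rowGram w i i

theorem measurable_resolventForm (w : ℂ) :
    Measurable fun p : (Fin N → Fin n → ℝ) × (Fin n → ℝ) =>
      resolventForm (rowGram p.1) w p.2 := by
  simp only [resolventForm, dotProduct, Matrix.mulVec, liftVec, Complex.coe_algebraMap]
  refine Finset.measurable_sum _ fun i _ => Measurable.mul (by fun_prop) ?_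
  refine Finset.measurable_sum _ fun j _ => Measurable.mul ?_ (by fun_prop)
  exact (measurable_resolventAt_rowGram w i j).comp measurable_fst

/-- The difference of 1/A and the right side is b²/(A(A² + b²)), at most b. This makes the imaginary
part of the trace a perturbation of the real equation. -/
theorem inv_add_mul_le {A b : ℝ} (hA : 1 ≤ A) (hb : 0 ≤ b) : 1 / A - b ≤ A / (A ^ 2 + b ^ 2) := by
  have h1 : 0 < A ^ 2 + b ^ 2 := by positivity
  rw [sub_le_iff_le_add, div_add' _ _ _ h1.ne', div_le_div_iff₀ (by linarith) h1]
  have h2 : b ≤ A * (A ^ 2 + b ^ 2) := by nlinarith [sq_nonneg (b - 1)]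
  nlinarith

/-- After multiplication by 1 + μ the two sides differ by (sn - (sN - sn)μ)². The double root marks
(sN - sn)² as the lower spectral edge. -/
theorem marchenkoPastur_edge {sN sn μ : ℝ} (hμ : 0 ≤ μ) :
    sN ^ 2 * (1 - 1 / (1 + μ)) ≤ sn ^ 2 + (sN - sn) ^ 2 * μ := by
  have h : 0 < 1 + μ := by linarith
  have e : 1 - 1 / (1 + μ) = μ / (1 + μ) := by field_simp; ring
  rw [e, mul_div_assoc', div_le_iff₀ h]
  nlinarith [sq_nonneg (sn - (sN - sn) * μ)]

/-- An approximate solution of the self-consistent equation to the right of the edge is possible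
only for few columns. -/
theorem le_of_selfConsistentError_le {η κ a u ε sN sn : ℝ} {m w : ℂ} (hη : 0 < η)
    (ha : 0 ≤ a) (ha1 : a ≤ 1) (hN : 0 < N) (hsN : sN ^ 2 = N) (hsn : sn ^ 2 = n)
    (hu : u = (sN - sn) ^ 2 + η * N / 2) (hwre : w.re = u) (hwim : w.im = κ * N)
    (hre : 0 ≤ m.re) (him : 0 ≤ m.im) (herr : ‖selfConsistentError N n a w m‖ ≤ ε * N) :
    n ≤ (ε + (1 + κ) * m.im) * (1 + 2 / η) * N := by
  have hN' : (0 : ℝ) < N := by exact_mod_cast hN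
  obtain ⟨μ, hμ⟩ : ∃ μ, μ = m.re := ⟨_, rfl⟩
  obtain ⟨ι, hι⟩ : ∃ ι, ι = m.im := ⟨_, rfl⟩
  rw [← hμ] at hre
  rw [← hι] at him ⊢
  have h1 : (selfConsistentError N n a w m).re
      = u * μ - κ * N * ι + n - N + N * ((1 + a * μ) / ((1 + a * μ) ^ 2 + (a * ι) ^ 2)) := by
    have : (1 / (1 + (a : ℂ) * m)).re = (1 + a * μ) / ((1 + a * μ) ^ 2 + (a * ι) ^ 2) := by
      rw [one_div, Complex.inv_re, Complex.normSq_apply]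
      simp [hμ, hι, sq]
    have hdiv : ((N : ℂ) / (1 + (a : ℂ) * m)).re
        = N * ((1 + a * μ) / ((1 + a * μ) ^ 2 + (a * ι) ^ 2)) := by
      rw [div_eq_mul_one_div, ← Complex.ofReal_natCast, Complex.re_ofReal_mul, this]
    rw [selfConsistentError, Complex.add_re, hdiv]
    simp [hμ, hι, hwre, hwim]
  have h2 := (Complex.re_le_norm _).trans herr
  rw [h1] at h2
  have haμ : 0 ≤ a * μ := mul_nonneg ha hre
  have h3 := inv_add_mul_le (A := 1 + a * μ) (b := a * ι) (by linarith) (mul_nonneg ha him)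
  -- Variance below one only helps, so the edge for a = 1 suffices.
  have h4 : 1 / (1 + μ) ≤ 1 / (1 + a * μ) :=
    one_div_le_one_div_of_le (by linarith) (by have := mul_le_of_le_one_left hre ha1; linarith)
  have h5 : a * ι ≤ ι := mul_le_of_le_one_left him ha1
  obtain ⟨r, hr⟩ : ∃ r, r = (1 + a * μ) / ((1 + a * μ) ^ 2 + (a * ι) ^ 2) := ⟨_, rfl⟩
  rw [← hr] at h2 h3
  have h6 := mul_le_mul_of_nonneg_left (show 1 / (1 + μ) - ι ≤ r by linarith) hN'.le
  have h7 := marchenkoPastur_edge (sN := sN) (sn := sn) hre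
  rw [hsN, hsn] at h7
  obtain ⟨e, he⟩ : ∃ e, e = ε + (1 + κ) * ι := ⟨_, rfl⟩
  have h8 : u * μ + n ≤ e * N + N * (1 - 1 / (1 + μ)) := by rw [he]; linarith
  have h9 : μ ≤ 2 * e / η := by
    rw [le_div_iff₀ hη]
    have : (η * N / 2) * μ ≤ e * N := by rw [hu] at h8; linarith
    have h10 : (μ * η) * N ≤ (2 * e) * N := by linarith
    exact le_of_mul_le_mul_right h10 hN'
  have h10 : 1 - 1 / (1 + μ) ≤ μ := by
    have : 1 - 1 / (1 + μ) = μ / (1 + μ) := by field_simp; ring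
    rw [this]; exact div_le_self hre (by linarith)
  have hu0 : 0 ≤ u * μ := mul_nonneg (by rw [hu]; positivity) hre
  have h11 := mul_le_mul_of_nonneg_left (h10.trans h9) hN'.le
  rw [← he]
  have h12 : e * (1 + 2 / η) * N = e * N + N * (2 * e / η) := by ring
  linarith

theorem trace_resolventAt_bounds {S : Matrix (Fin n) (Fin n) ℝ} (hS : Sᵀ = S) {b : ℝ} {w : ℂ}
    (hb : LowerBounded S b) (hw : 0 < w.im) (hwb : w.re < b) :
    0 ≤ (resolventAt S w).trace.re ∧ 0 ≤ (resolventAt S w).trace.im ∧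
      (resolventAt S w).trace.im ≤ w.im * (n * ((b - w.re)⁻¹) ^ 2) := by
  obtain ⟨U, lam, hU, rfl, hlam⟩ := exists_specMat_of_lowerBounded hS hb
  rw [trace_resolvent_specMat hU hw, Complex.re_sum, Complex.im_sum]
  have hpos : 0 < b - w.re := by linarith
  refine ⟨Finset.sum_nonneg fun j _ => ?_, Finset.sum_nonneg fun j _ => ?_, ?_⟩
  · rw [Complex.inv_re]
    refine div_nonneg ?_ (Complex.normSq_nonneg _)
    have := hlam j
    simp; linarith
  · rw [im_inv_ofReal_sub]; positivity
  · have h : ∀ j ∈ Finset.univ, ((algebraMap ℝ ℂ (lam j) - w)⁻¹).im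
        ≤ w.im * ((b - w.re)⁻¹) ^ 2 := fun j _ => by
      rw [im_inv_ofReal_sub, norm_inv]
      refine mul_le_mul_of_nonneg_left (pow_le_pow_left₀ (by positivity) (inv_anti₀ hpos ?_) 2) hw.le
      have h1 := Complex.re_le_norm (algebraMap ℝ ℂ (lam j) - w)
      have := hlam j
      simp only [Complex.coe_algebraMap, Complex.sub_re, Complex.ofReal_re] at h1 ⊢
      linarith
    refine (Finset.sum_le_sum h).trans_eq ?_
    simp; ring

/-- Concentration of quadratic forms of the resolvent. -/
theorem lintegral_norm_resolventForm_sub_le {ν : Measure ℝ} [IsProbabilityMeasure ν]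
    {g : ℝ → ℝ} (hm : Measurable g) {L : ℝ} (hL : ∀ t, |g t| ≤ L) (h0 : ∫ t, g t ∂ν = 0)
    {S : Matrix (Fin n) (Fin n) ℝ} (hS : Sᵀ = S) {w : ℂ} (hw : 0 < w.im) {τ c e : ℝ} (hτ : 0 < τ)
    (hc : 0 ≤ c) (he : 0 ≤ e) :
    ∫⁻ x, ENNReal.ofReal (c * (‖resolventForm S w (fun i => g (x i))
        - (∫ t, g t ^ 2 ∂ν : ℝ) * (resolventAt S w).trace‖ + e)) ∂(Measure.pi fun _ : Fin n => ν)
      ≤ ENNReal.ofReal (c * (L ^ 4 * (n * w.im⁻¹ ^ 2) / τ + τ / 2 + e)) := by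
  obtain ⟨U, lam, hU, rfl⟩ := exists_eq_specMat hS
  set a := ∫ t, g t ^ 2 ∂ν with ha
  obtain ⟨d, hd⟩ : ∃ d : Fin n → ℂ, ∀ j, d j = (algebraMap ℝ ℂ (lam j) - w)⁻¹ := ⟨_, fun _ => rfl⟩
  rw [trace_resolvent_specMat hU hw]
  simp_rw [resolventForm_specMat hU hw, ← hd]
  obtain ⟨i1, b1⟩ := integral_specQuad_sub_sq_le (d := fun j => (d j).re) hm hL h0 hU
  obtain ⟨i2, b2⟩ := integral_specQuad_sub_sq_le (d := fun j => (d j).im) hm hL h0 hU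
  rw [← ha] at i1 b1 i2 b2
  obtain ⟨q1, hq1⟩ : ∃ q1 : (Fin n → ℝ) → ℝ, ∀ x, q1 x = (specQuad U (fun j => (d j).re)
    (fun i => g (x i)) - a * ∑ j, (d j).re) ^ 2 := ⟨_, fun _ => rfl⟩
  obtain ⟨q2, hq2⟩ : ∃ q2 : (Fin n → ℝ) → ℝ, ∀ x, q2 x = (specQuad U (fun j => (d j).im)
    (fun i => g (x i)) - a * ∑ j, (d j).im) ^ 2 := ⟨_, fun _ => rfl⟩
  simp_rw [← hq1] at i1 b1
  simp_rw [← hq2] at i2 b2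
  -- AM–GM in the form |z| ≤ |z|²/(2τ) + τ/2 reduces the first moment to the variance bound for the
  -- real and imaginary parts.
  have hpt : ∀ x : Fin n → ℝ, ‖∑ j, d j * algebraMap ℝ ℂ ((Uᵀ *ᵥ fun i => g (x i)) j ^ 2)
      - (a : ℂ) * ∑ j, d j‖ ≤ (q1 x + q2 x) / (2 * τ) + τ / 2 := fun x => by
    set z := ∑ j, d j * algebraMap ℝ ℂ ((Uᵀ *ᵥ fun i => g (x i)) j ^ 2) - (a : ℂ) * ∑ j, d j with hz
    have e1 : z.re ^ 2 = q1 x := by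
      rw [hq1, hz, specQuad, Complex.sub_re, Complex.re_sum, Complex.re_ofReal_mul, Complex.re_sum]
      simp only [Complex.coe_algebraMap, Complex.re_mul_ofReal]
    have e2 : z.im ^ 2 = q2 x := by
      rw [hq2, hz, specQuad, Complex.sub_im, Complex.im_sum, Complex.im_ofReal_mul, Complex.im_sum]
      simp only [Complex.coe_algebraMap, Complex.im_mul_ofReal]
    have e3 : ‖z‖ ^ 2 = q1 x + q2 x := by
      rw [← e1, ← e2, ← Complex.normSq_eq_norm_sq, Complex.normSq_apply]; ring
    rw [← e3, div_add' _ _ _ (by positivity), le_div_iff₀ (by positivity)]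
    nlinarith [sq_nonneg (‖z‖ - τ)]
  have hint : Integrable (fun x => c * ((q1 x + q2 x) / (2 * τ) + τ / 2 + e))
      (Measure.pi fun _ : Fin n => ν) :=
    ((((i1.add i2).div_const _).add (integrable_const _)).add (integrable_const _)).const_mul _
  refine (lintegral_mono fun x => ENNReal.ofReal_le_ofReal (mul_le_mul_of_nonneg_left
    (add_le_add (hpt x) le_rfl) hc)).trans ?_
  rw [← ofReal_integral_eq_lintegral_ofReal hint (Filter.Eventually.of_forall fun x => by
    have : 0 ≤ q1 x := by rw [hq1]; positivity
    have : 0 ≤ q2 x := by rw [hq2]; positivity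
    simp only [Pi.zero_apply]; positivity)]
  refine ENNReal.ofReal_le_ofReal ?_
  rw [integral_const_mul]
  refine mul_le_mul_of_nonneg_left ?_ hc
  have i3 : Integrable (fun x => (q1 x + q2 x) / (2 * τ)) (Measure.pi fun _ : Fin n => ν) :=
    (i1.add i2).div_const _
  rw [integral_add (i3.fun_add (integrable_const _)) (integrable_const _),
    integral_add i3 (integrable_const _), integral_div, integral_add i1 i2]
  simp only [integral_const, probReal_univ, one_smul]
  refine add_le_add (add_le_add ?_ le_rfl) le_rfl
  rw [div_le_div_iff₀ (by positivity) hτ]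
  have hsum : ∑ j, (d j).re ^ 2 + ∑ j, (d j).im ^ 2 ≤ n * w.im⁻¹ ^ 2 := by
    rw [← Finset.sum_add_distrib]
    have : ∀ j ∈ Finset.univ, (d j).re ^ 2 + (d j).im ^ 2 ≤ w.im⁻¹ ^ 2 := fun j _ => by
      have h1 : (d j).re ^ 2 + (d j).im ^ 2 = ‖d j‖ ^ 2 := by
        rw [← Complex.normSq_eq_norm_sq, Complex.normSq_apply]; ring
      rw [h1, hd]
      exact pow_le_pow_left₀ (norm_nonneg _) (norm_inv_ofReal_sub_le hw _) 2
    refine (Finset.sum_le_sum this).trans_eq ?_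
    simp
  have hL4 : 0 ≤ L ^ 4 := by positivity
  have := mul_le_mul_of_nonneg_left hsum hL4
  have h3 := mul_le_mul_of_nonneg_right (show ∫ x, q1 x ∂(Measure.pi fun _ : Fin n => ν)
    + ∫ x, q2 x ∂(Measure.pi fun _ : Fin n => ν) ≤ 2 * (L ^ 4 * (n * w.im⁻¹ ^ 2)) by linarith) hτ.le
  linarith

theorem bddMeas_norm_selfConsistentError {a : ℝ} (ha : 0 ≤ a) {w : ℂ} (hw : 0 < w.im) {g : ℝ → ℝ}
    (hm : Measurable g) :
    BddMeas fun X : Fin N → Fin n → ℝ => ‖selfConsistentError N n a w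
      (resolventAt (rowGram fun i j => g (X i j)) w).trace‖ := by
  refine ⟨?_, ‖w‖ * (n * w.im⁻¹) + n + N + N * (‖w‖ / w.im), fun X => ?_⟩
  · have h1 : Measurable fun X : Fin N → Fin n → ℝ =>
        (resolventAt (rowGram fun i j => g (X i j)) w).trace :=
      (measurable_trace_resolventAt w).comp (by fun_prop)
    unfold selfConsistentError
    exact (((measurable_const.mul h1).add_const _).sub_const _ |>.add
      (measurable_const.div (measurable_const.add (measurable_const.mul h1)))).norm
  · rw [abs_of_nonneg (norm_nonneg _), selfConsistentError]
    have h1 := norm_trace_resolvent_le (transpose_rowGram fun i j => g (X i j)) hw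
    have h2 := im_le_norm_mul_norm_one_add_trace (transpose_rowGram fun i j => g (X i j))
      (lowerBounded_rowGram _) hw ha
    set m := (resolventAt (rowGram fun i j => g (X i j)) w).trace
    have hz : 0 < ‖1 + (a : ℂ) * m‖ := by
      by_contra h
      have h0 : ‖1 + (a : ℂ) * m‖ = 0 := le_antisymm (not_lt.mp h) (norm_nonneg _)
      rw [h0] at h2; linarith
    refine (norm_add_le _ _).trans (add_le_add ((norm_sub_le _ _).trans (add_le_add
      ((norm_add_le _ _).trans (add_le_add ?_ ?_)) ?_)) ?_)
    · rw [norm_mul]; exact mul_le_mul_of_nonneg_left h1 (norm_nonneg _)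
    · simp
    · simp
    · rw [norm_div, Complex.norm_natCast, div_eq_mul_inv]
      refine mul_le_mul_of_nonneg_left ?_ (by positivity)
      rw [inv_eq_one_div, div_le_div_iff₀ hz hw, one_mul]; exact h2

/-- Row i is integrated first with the others frozen, so the resolvent in its quadratic form is
deterministic and the variance bound applies. -/
theorem integral_norm_selfConsistentError_le {ν : Measure ℝ} [IsProbabilityMeasure ν]
    {g : ℝ → ℝ} (hm : Measurable g) {L : ℝ} (hL : ∀ t, |g t| ≤ L) (h0 : ∫ t, g t ∂ν = 0)
    {a : ℝ} (ha : a = ∫ t, g t ^ 2 ∂ν) {w : ℂ} (hw : 0 < w.im) {τ : ℝ} (hτ : 0 < τ) (hN : 0 < N) :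
    ∫ X, ‖selfConsistentError N n a w (resolventAt (rowGram fun i j => g (X i j)) w).trace‖
        ∂(Measure.pi fun _ : Fin N => Measure.pi fun _ : Fin n => ν)
      ≤ N * ((‖w‖ / w.im) ^ 2 * (L ^ 4 * (n * w.im⁻¹ ^ 2) / τ + τ / 2 + a * w.im⁻¹)) := by
  obtain ⟨N, rfl⟩ : ∃ N', N = N' + 1 := ⟨N - 1, by omega⟩
  have ha0 : 0 ≤ a := by rw [ha]; exact integral_nonneg fun t => sq_nonneg _
  have hb := bddMeas_norm_selfConsistentError (N := N + 1) (n := n) ha0 hw hm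
  have hL4 : 0 ≤ L ^ 4 := by positivity
  have hR : 0 ≤ (‖w‖ / w.im) ^ 2 * (L ^ 4 * (n * w.im⁻¹ ^ 2) / τ + τ / 2 + a * w.im⁻¹) := by
    positivity
  rw [← ENNReal.ofReal_le_ofReal_iff (by positivity), ofReal_integral_eq_lintegral_ofReal
    (hb.integrable _) (Filter.Eventually.of_forall fun X => norm_nonneg _)]
  set c := (‖w‖ / w.im) ^ 2
  obtain ⟨T, hT⟩ : ∃ T : (Fin N → Fin n → ℝ) → (Fin n → ℝ) → ℝ, ∀ Y x, T Y x
      = c * (‖resolventForm (rowGram fun i j => g (Y i j)) w (fun i => g (x i))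
          - a * (resolventAt (rowGram fun i j => g (Y i j)) w).trace‖ + a * w.im⁻¹) :=
    ⟨_, fun _ _ => rfl⟩
  have hT0 : ∀ Y x, 0 ≤ T Y x := fun Y x => by rw [hT]; positivity
  have hTm : Measurable fun p : (Fin N → Fin n → ℝ) × (Fin n → ℝ) => T p.1 p.2 := by
    simp_rw [hT]
    have h1 : Measurable fun p : (Fin N → Fin n → ℝ) × (Fin n → ℝ) =>
        resolventForm (rowGram fun i j => g (p.1 i j)) w (fun i => g (p.2 i)) :=
      (measurable_resolventForm (N := N) w).comp (f := fun p : (Fin N → Fin n → ℝ) × (Fin n → ℝ) =>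
        ((fun i j => g (p.1 i j)), (fun i => g (p.2 i)))) (by fun_prop)
    have h2 : Measurable fun p : (Fin N → Fin n → ℝ) × (Fin n → ℝ) =>
        (resolventAt (rowGram fun i j => g (p.1 i j)) w).trace :=
      (measurable_trace_resolventAt (N := N) w).comp
        (f := fun p : (Fin N → Fin n → ℝ) × (Fin n → ℝ) => fun i j => g (p.1 i j)) (by fun_prop)
    exact ((h1.sub (h2.const_mul _)).norm.add_const _).const_mul _
  have hpt : ∀ X : Fin (N + 1) → Fin n → ℝ,
      ENNReal.ofReal ‖selfConsistentError (N + 1) n a w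
        (resolventAt (rowGram fun i j => g (X i j)) w).trace‖
      ≤ ∑ i, ENNReal.ofReal (T (i.removeNth X) (X i)) := fun X => by
    rw [← ENNReal.ofReal_sum_of_nonneg fun i _ => hT0 _ _]
    refine ENNReal.ofReal_le_ofReal ?_
    refine (norm_selfConsistentError_rowGram_le ha0 hw fun i j => g (X i j)).trans_eq ?_
    refine Finset.sum_congr rfl fun i _ => ?_
    rw [hT]
    rfl
  have hTi : ∀ i : Fin (N + 1), Measurable fun X : Fin (N + 1) → Fin n → ℝ =>
      ENNReal.ofReal (T (i.removeNth X) (X i)) := fun i => by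
    have : Measurable fun X : Fin (N + 1) → Fin n → ℝ => (i.removeNth X, X i) := by
      refine Measurable.prodMk ?_ (measurable_pi_apply i)
      exact measurable_pi_iff.mpr fun k => measurable_pi_apply (i.succAbove k)
    exact (hTm.comp this).ennreal_ofReal
  refine (lintegral_mono hpt).trans ?_
  rw [lintegral_finsetSum _ fun i _ => hTi i]
  have hi : ∀ i ∈ Finset.univ, ∫⁻ X, ENNReal.ofReal (T (Fin.removeNth i X) (X i))
        ∂(Measure.pi fun _ : Fin (N + 1) => Measure.pi fun _ : Fin n => ν)
      ≤ ENNReal.ofReal (c * (L ^ 4 * (n * w.im⁻¹ ^ 2) / τ + τ / 2 + a * w.im⁻¹)) := fun i _ => by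
    rw [lintegral_pi_insertNth_symm _ i (hTi i)]
    have hY : ∀ Y : Fin N → Fin n → ℝ, ∫⁻ x, ENNReal.ofReal
          (T (i.removeNth (i.insertNth (α := fun _ => Fin n → ℝ) x Y))
            (i.insertNth (α := fun _ => Fin n → ℝ) x Y i)) ∂(Measure.pi fun _ : Fin n => ν)
        ≤ ENNReal.ofReal (c * (L ^ 4 * (n * w.im⁻¹ ^ 2) / τ + τ / 2 + a * w.im⁻¹)) := fun Y => by
      simp_rw [Fin.removeNth_insertNth, Fin.insertNth_apply_same, hT, ha]
      exact lintegral_norm_resolventForm_sub_le hm hL h0 (transpose_rowGram _) hw hτ (by positivity)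
        (by rw [← ha]; positivity)
    refine (lintegral_mono hY).trans ?_
    simp
  refine (Finset.sum_le_sum hi).trans_eq ?_
  rw [Finset.sum_const, Finset.card_univ, Fintype.card_fin, nsmul_eq_mul,
    ENNReal.ofReal_mul (p := ((N + 1 : ℕ) : ℝ)) (by positivity), ENNReal.ofReal_natCast]

end UpperTail

/-! ### Upper tail of the smallest eigenvalue -/

section UpperTail

open Matrix

variable {n N : ℕ}

/-- The point `w` lies ηN/2 to the left of the supposed spectrum, so Im m ≤ Im w · n (ηN/2)⁻² ≤
η³/200. A small error would then force n ≤ η²N/16. -/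
theorem not_lowerBounded_of_selfConsistentError_le {η a sN sn : ℝ} (hη : 0 < η) (hη1 : η ≤ 1)
    (ha : 0 ≤ a) (ha1 : a ≤ 1) (hN : 0 < N) (hnN : n ≤ N) (hsN : sN ^ 2 = N) (hsn : sn ^ 2 = n)
    {S : Matrix (Fin n) (Fin n) ℝ} (hS : Sᵀ = S)
    (hn : η ^ 2 * N < 16 * n) (hb : LowerBounded S ((sN - sn) ^ 2 + η * N))
    {w : ℂ} (hw : w = ⟨(sN - sn) ^ 2 + η * N / 2, η ^ 5 / 800 * N⟩) :
    η ^ 3 / 100 * N < ‖selfConsistentError N n a w (resolventAt S w).trace‖ := by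
  by_contra herr
  push Not at herr
  have hN' : (0 : ℝ) < N := by exact_mod_cast hN
  have hnN' : (n : ℝ) ≤ N := by exact_mod_cast hnN
  have hwim : w.im = η ^ 5 / 800 * N := by rw [hw]
  have hwre : w.re = (sN - sn) ^ 2 + η * N / 2 := by rw [hw]
  have hηN : 0 < η * N := by positivity
  obtain ⟨h1, h2, h3⟩ := trace_resolventAt_bounds hS hb (w := w) (by rw [hwim]; positivity)
    (by rw [hwre]; linarith)
  have h4 : (resolventAt S w).trace.im ≤ η ^ 3 / 200 := by
    refine h3.trans ?_
    rw [hwim, hwre]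
    have e : (sN - sn) ^ 2 + η * N - ((sN - sn) ^ 2 + η * N / 2) = η * N / 2 := by ring
    rw [e]
    have h5 : (n : ℝ) * (η * N / 2)⁻¹ ^ 2 ≤ N * (η * N / 2)⁻¹ ^ 2 :=
      mul_le_mul_of_nonneg_right hnN' (by positivity)
    refine (mul_le_mul_of_nonneg_left h5 (by positivity)).trans_eq ?_
    field_simp
    norm_num
  have h5 := le_of_selfConsistentError_le (κ := η ^ 5 / 800) hη ha ha1 hN hsN hsn
    rfl hwre hwim h1 h2 herr
  have hη5 : η ^ 5 ≤ 1 := pow_le_one₀ hη.le hη1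
  have h6 : (1 + η ^ 5 / 800) * (resolventAt S w).trace.im ≤ 2 * (η ^ 3 / 200) :=
    mul_le_mul (by linarith) h4 h2 (by norm_num)
  have h7 : (η ^ 3 / 100 + (1 + η ^ 5 / 800) * (resolventAt S w).trace.im) * (1 + 2 / η)
      ≤ η ^ 2 / 16 := by
    have h8 : 1 + 2 / η ≤ 3 / η := by
      rw [← sub_nonneg]
      have : 3 / η - (1 + 2 / η) = (1 - η) / η := by field_simp; ring
      rw [this]; exact div_nonneg (by linarith) hη.le
    calc _ ≤ (η ^ 3 / 50) * (3 / η) :=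
          mul_le_mul (by linarith) h8 (by positivity) (by positivity)
      _ = 3 * η ^ 2 / 50 := by field_simp
      _ ≤ _ := by have := sq_nonneg η; linarith
  have h8 := mul_le_mul_of_nonneg_right h7 hN'.le
  linarith

/-- With many columns, `XᵀX` has an eigenvalue near the Marchenko–Pastur edge. -/
theorem measure_lowerBounded_le_of_many_columns {η L : ℝ} (hη : 0 < η) (hη1 : η ≤ 1) (hL0 : 0 < L) :
    ∃ w : ℝ, 0 < w ∧ ∃ N₀ : ℕ, ∀ (ν : Measure ℝ) [IsProbabilityMeasure ν] (g : ℝ → ℝ),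
      Measurable g → (∀ t, |g t| ≤ L) → ∫ t, g t ∂ν = 0 → ∫ t, g t ^ 2 ∂ν ≤ 1 →
      ∀ N : ℕ, N₀ ≤ N → ∀ n : ℕ, 1 ≤ n → n ≤ N → η ^ 2 * N < 16 * n →
        (Measure.pi fun _ : Fin N => Measure.pi fun _ : Fin n => ν).real
            {X | LowerBounded (rowGram fun i j => g (X i j)) ((√N - √n) ^ 2 + η * N)}
          ≤ Real.exp (-(w * N)) := by
  obtain ⟨κ, hκ⟩ : ∃ κ, κ = η ^ 5 / 800 := ⟨_, rfl⟩
  have hκ0 : 0 < κ := by rw [hκ]; positivity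
  have hκ1 : κ ≤ 1 := by rw [hκ]; have := pow_le_one₀ (n := 5) hη.le hη1; linarith
  -- Makes (9/κ²)τ = η³/200, so that the mean error is at most half of the level η³/100 · N; the
  -- other half is left to the deviation.
  obtain ⟨τ, hτ⟩ : ∃ τ, τ = κ ^ 2 * η ^ 3 / 1800 := ⟨_, rfl⟩
  have hτ0 : 0 < τ := by rw [hτ]; positivity
  -- The change under replacement of one row, from |w| ≤ 3N and Im w = κN; N cancels.
  obtain ⟨c, hc⟩ : ∃ c, c = (3 + 9 / κ ^ 2) * (2 / κ) := ⟨_, rfl⟩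
  have hc0 : 0 < c := by rw [hc]; positivity
  obtain ⟨N₀, hN₀⟩ := exists_nat_ge ((L ^ 4 / (τ * κ ^ 2) + 1 / κ) / (τ / 2))
  refine ⟨(η ^ 3 / 200) ^ 2 / (2 * c ^ 2), by positivity, N₀, ?_⟩
  intro ν _ g hm hL h0 ha1 N hN n hn1 hnN hn
  obtain ⟨a, ha⟩ : ∃ a, a = ∫ t, g t ^ 2 ∂ν := ⟨_, rfl⟩
  rw [← ha] at ha1
  have ha0 : 0 ≤ a := by rw [ha]; exact integral_nonneg fun t => sq_nonneg _
  have hNpos : 0 < N := by omega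
  have hN' : (0 : ℝ) < N := by exact_mod_cast hNpos
  have hnN' : (n : ℝ) ≤ N := by exact_mod_cast hnN
  obtain ⟨sN, hsN⟩ : ∃ s, s = √(N : ℝ) := ⟨_, rfl⟩
  obtain ⟨sn, hsn⟩ : ∃ s, s = √(n : ℝ) := ⟨_, rfl⟩
  have hsnN : sn ≤ sN := by rw [hsn, hsN]; exact Real.sqrt_le_sqrt hnN'
  have hsn0 : 0 ≤ sn := by rw [hsn]; positivity
  have hsN2 : sN ^ 2 = N := by rw [hsN]; exact Real.sq_sqrt hN'.le
  have hsn2 : sn ^ 2 = n := by rw [hsn]; exact Real.sq_sqrt (by positivity)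
  rw [← hsN, ← hsn]
  obtain ⟨w, hw⟩ : ∃ w : ℂ, w = ⟨(sN - sn) ^ 2 + η * N / 2, κ * N⟩ := ⟨_, rfl⟩
  have hwim : w.im = κ * N := by rw [hw]
  have hwre : w.re = (sN - sn) ^ 2 + η * N / 2 := by rw [hw]
  have hw0 : 0 < w.im := by rw [hwim]; positivity
  have hwnorm : ‖w‖ ≤ 3 * N := by
    refine (Complex.norm_le_abs_re_add_abs_im w).trans ?_
    rw [abs_of_pos hw0, hwim, hwre, abs_of_nonneg (by positivity)]
    have h1 : (sN - sn) ^ 2 ≤ sN ^ 2 := pow_le_pow_left₀ (by linarith) (by linarith) 2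
    have h2 : κ * N ≤ 1 * N := mul_le_mul_of_nonneg_right hκ1 hN'.le
    have h3 : η * N ≤ 1 * N := mul_le_mul_of_nonneg_right hη1 hN'.le
    linarith
  have hB : (‖w‖ / w.im) ^ 2 ≤ 9 / κ ^ 2 := by
    have : ‖w‖ / w.im ≤ 3 / κ := by
      rw [hwim, div_le_div_iff₀ (by positivity) hκ0]
      have := mul_le_mul_of_nonneg_right hwnorm hκ0.le
      linarith
    refine (pow_le_pow_left₀ (by positivity) this 2).trans_eq ?_
    rw [div_pow]; norm_num
  have hinv : w.im⁻¹ = 1 / κ / N := by rw [hwim]; field_simp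
  obtain ⟨f, hf⟩ : ∃ f : (Fin N → Fin n → ℝ) → ℝ, f = fun X => ‖selfConsistentError N n a w
      (resolventAt (rowGram fun i j => g (X i j)) w).trace‖ := ⟨_, rfl⟩
  have hfb : BddMeas f := by rw [hf]; exact bddMeas_norm_selfConsistentError ha0 hw0 hm
  have hfc : ∀ X i x, |f (Function.update X i x) - f X| ≤ c := fun X i x => by
    have h1 := abs_norm_selfConsistentError_sub_le ha0 ha1 hw0 (fun i j => g (X i j)) i
      (fun j => g (x j))
    have h2 : Function.update (fun i j => g (X i j)) i (fun j => g (x j))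
        = fun i' j => g (Function.update X i x i' j) := by
      ext i' j
      by_cases h : i' = i
      · subst h; simp
      · simp [h]
    rw [h2] at h1
    rw [hf]
    refine h1.trans ?_
    rw [hinv]
    have h3 : ‖w‖ + N * (‖w‖ / w.im) ^ 2 ≤ (3 + 9 / κ ^ 2) * N := by
      have := mul_le_mul_of_nonneg_left hB hN'.le
      linarith
    refine (mul_le_mul_of_nonneg_right h3 (by positivity)).trans_eq ?_
    rw [hc]; field_simp
  have hE : ∫ X, f X ∂(Measure.pi fun _ : Fin N => Measure.pi fun _ : Fin n => ν)
      ≤ η ^ 3 / 200 * N := by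
    have h1 := integral_norm_selfConsistentError_le (n := n) hm hL h0 ha hw0 hτ0 hNpos
    rw [hf]
    refine h1.trans ?_
    have hN0 : (L ^ 4 / (τ * κ ^ 2) + 1 / κ) / N ≤ τ / 2 := by
      have h2 := hN₀.trans (Nat.cast_le.mpr hN : (N₀ : ℝ) ≤ N)
      rw [div_le_iff₀ (by positivity)] at h2 ⊢
      linarith
    have h2 : L ^ 4 * (n * w.im⁻¹ ^ 2) / τ + τ / 2 + a * w.im⁻¹ ≤ τ := by
      have h3 : L ^ 4 * (n * w.im⁻¹ ^ 2) / τ ≤ L ^ 4 * (N * w.im⁻¹ ^ 2) / τ := by gcongr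
      have h4 : a * w.im⁻¹ ≤ 1 * w.im⁻¹ := mul_le_mul_of_nonneg_right ha1 (by positivity)
      have h5 : L ^ 4 * (N * w.im⁻¹ ^ 2) / τ + 1 * w.im⁻¹
          = (L ^ 4 / (τ * κ ^ 2) + 1 / κ) / N := by
        rw [hinv]; field_simp
      linarith
    have h3 : (‖w‖ / w.im) ^ 2 * (L ^ 4 * (n * w.im⁻¹ ^ 2) / τ + τ / 2 + a * w.im⁻¹)
        ≤ 9 / κ ^ 2 * τ := by
      refine mul_le_mul hB h2 ?_ (by positivity)
      have : 0 ≤ L ^ 4 := by positivity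
      positivity
    refine (mul_le_mul_of_nonneg_left h3 hN'.le).trans_eq ?_
    rw [hτ]; field_simp; norm_num
  have hmain := measureReal_pi_ge_le_of_bounded_differences (μ := Measure.pi fun _ : Fin n => ν)
    hc0 hNpos hfb hfc (s := η ^ 3 / 200 * N) (by positivity)
  refine (measureReal_mono (fun X hX => ?_)).trans (hmain.trans_eq ?_)
  · rw [Set.mem_ofPred_eq] at hX ⊢
    have := not_lowerBounded_of_selfConsistentError_le hη hη1 ha0 ha1 hNpos hnN hsN2 hsn2
      (transpose_rowGram _) hn hX (hw.trans (by rw [hκ]))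
    rw [hf] at hE ⊢
    simp only
    linarith
  · congr 2
    field_simp

/-- With few columns, the first column already gives an upper bound. -/
theorem measure_lowerBounded_le_of_few_columns {η L : ℝ} (hη : 0 < η) (hη1 : η ≤ 1) (hL0 : 0 < L)
    (ν : Measure ℝ) [IsProbabilityMeasure ν] (g : ℝ → ℝ) (hm : Measurable g)
    (hL : ∀ t, |g t| ≤ L) (ha1 : ∫ t, g t ^ 2 ∂ν ≤ 1) {N n : ℕ} (hn : 1 ≤ n) (hnN : n ≤ N)
    (hn16 : 16 * n ≤ η ^ 2 * N) :
    (Measure.pi fun _ : Fin N => Measure.pi fun _ : Fin n => ν).real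
        {X | LowerBounded (rowGram fun i j => g (X i j)) ((√N - √n) ^ 2 + η * N)}
      ≤ Real.exp (-(η ^ 2 / (8 * (L ^ 2) ^ 2) * N)) := by
  have hNpos : 0 < N := by omega
  have hN' : (0 : ℝ) < N := by exact_mod_cast hNpos
  obtain ⟨j₀⟩ : Nonempty (Fin n) := ⟨⟨0, hn⟩⟩
  have hgb : BddMeas fun t => g t ^ 2 := BddMeas.pow ⟨hm, L, hL⟩ 2
  obtain ⟨f, hf⟩ : ∃ f : (Fin N → Fin n → ℝ) → ℝ, f = fun X => ∑ i, g (X i j₀) ^ 2 := ⟨_, rfl⟩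
  have hfi : ∀ i : Fin N, BddMeas fun X : Fin N → Fin n → ℝ => g (X i j₀) ^ 2 := fun i =>
    hgb.comp (φ := fun X : Fin N → Fin n → ℝ => X i j₀) (by fun_prop)
  have hfb : BddMeas f := by rw [hf]; exact BddMeas.sum _ hfi
  have hfc : ∀ X i x, |f (Function.update X i x) - f X| ≤ L ^ 2 := fun X i x => by
    rw [hf]
    simp only
    rw [← Finset.sum_sub_distrib, Finset.sum_eq_single i]
    · rw [Function.update_self]
      have h1 := sq_le_sq' (neg_le_of_abs_le (hL (x j₀))) (le_of_abs_le (hL (x j₀)))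
      have h2 := sq_le_sq' (neg_le_of_abs_le (hL (X i j₀))) (le_of_abs_le (hL (X i j₀)))
      have h3 := sq_nonneg (g (x j₀))
      have h4 := sq_nonneg (g (X i j₀))
      rw [abs_le]; constructor <;> linarith
    · intro k _ hk
      rw [Function.update_of_ne hk, sub_self]
    · simp
  have hE : ∫ X, f X ∂(Measure.pi fun _ : Fin N => Measure.pi fun _ : Fin n => ν) ≤ N := by
    rw [hf, integral_finsetSum _ fun i _ => (hfi i).integrable _]
    have : ∀ i ∈ Finset.univ, ∫ X : Fin N → Fin n → ℝ, g (X i j₀) ^ 2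
        ∂(Measure.pi fun _ : Fin N => Measure.pi fun _ : Fin n => ν) ≤ 1 := fun i _ => by
      refine le_trans (le_of_eq ?_) ha1
      have h1 := integral_comp_eval (μ := fun _ : Fin N => Measure.pi fun _ : Fin n => ν) (i := i)
        (f := fun x : Fin n → ℝ => g (x j₀) ^ 2)
        (by have : Measurable fun x : Fin n → ℝ => g (x j₀) ^ 2 := by fun_prop
            exact this.aestronglyMeasurable)
      have h2 := integral_comp_eval (μ := fun _ : Fin n => ν) (i := j₀)
        (f := fun t : ℝ => g t ^ 2) (by exact (hm.pow_const 2).aestronglyMeasurable)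
      exact h1.trans h2
    refine (Finset.sum_le_sum this).trans_eq ?_
    simp
  have hmain := measureReal_pi_ge_le_of_bounded_differences (μ := Measure.pi fun _ : Fin n => ν)
    (c := L ^ 2) (by positivity) hNpos hfb hfc (s := η / 2 * N) (by positivity)
  refine (measureReal_mono (fun X hX => ?_)).trans (hmain.trans_eq ?_)
  · rw [Set.mem_ofPred_eq] at hX ⊢
    have h1 := hX (Pi.single j₀ 1)
    rw [dotProduct_rowGram] at h1
    simp only [dotProduct_single, mul_one, Pi.single_eq_same] at h1
    -- Hence the threshold is at least (1 + η/2)N, whereas the squared norm of a column has mean at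
    -- most N.
    have hs : √(n : ℝ) ≤ η / 4 * √(N : ℝ) := by
      rw [← Real.sqrt_sq (show 0 ≤ η / 4 by positivity), ← Real.sqrt_mul (by positivity)]
      exact Real.sqrt_le_sqrt (by linarith)
    have h2 : ((1 - η / 4) * √(N : ℝ)) ^ 2 ≤ (√(N : ℝ) - √(n : ℝ)) ^ 2 :=
      pow_le_pow_left₀ (mul_nonneg (by linarith) (Real.sqrt_nonneg _)) (by linarith) 2
    rw [mul_pow, Real.sq_sqrt hN'.le] at h2
    have h3 : (1 - η / 2) * N ≤ (1 - η / 4) ^ 2 * N :=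
      mul_le_mul_of_nonneg_right (by nlinarith [sq_nonneg η]) hN'.le
    rw [hf] at hE ⊢
    simp only
    linarith
  · congr 2
    field_simp
    norm_num

theorem LowerBounded.measurableSet_rowGram_comp {g : ℝ → ℝ} (hm : Measurable g) (t : ℝ) :
    MeasurableSet {X : Fin N → Fin n → ℝ | LowerBounded (rowGram fun i j => g (X i j)) t} := by
  have h := measurableSet_lowerBounded (N := N) (0 : Matrix (Fin n) (Fin n) ℝ) t
  simp only [zero_add] at h
  exact h.preimage (f := fun X : Fin N → Fin n → ℝ => fun i j => g (X i j)) (by fun_prop)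

/-- Upper tail of the smallest eigenvalue of `XᵀX` for i.i.d. bounded centred entries with variance
at most one. -/
theorem exists_upper_tail {η L : ℝ} (hη : 0 < η) (hL0 : 0 < L) :
    ∃ w : ℝ, 0 < w ∧ ∃ N₀ : ℕ, ∀ (ν : Measure ℝ) [IsProbabilityMeasure ν] (g : ℝ → ℝ),
      Measurable g → (∀ t, |g t| ≤ L) → ∫ t, g t ∂ν = 0 → ∫ t, g t ^ 2 ∂ν ≤ 1 →
      ∀ N : ℕ, N₀ ≤ N → ∀ n : ℕ, 1 ≤ n → n ≤ N →
        (Measure.pi fun _ : Fin N => Measure.pi fun _ : Fin n => ν).real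
            {X | LowerBounded (rowGram fun i j => g (X i j)) ((√N - √n) ^ 2 + η * N)}
          ≤ Real.exp (-(w * N)) := by
  wlog hη1 : η ≤ 1 generalizing η
  · obtain ⟨w, hw, N₀, h⟩ := this one_pos le_rfl
    refine ⟨w, hw, N₀, fun ν _ g hm hL h0 ha N hN n hn hnN =>
      (measureReal_mono fun X hX => ?_).trans (h ν g hm hL h0 ha N hN n hn hnN)⟩
    push Not at hη1
    exact LowerBounded.mono hX (by gcongr)
  obtain ⟨w, hw, N₀, h⟩ := measure_lowerBounded_le_of_many_columns hη hη1 hL0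
  refine ⟨min w (η ^ 2 / (8 * (L ^ 2) ^ 2)), lt_min hw (by positivity), N₀,
    fun ν _ g hm hL h0 ha N hN n hn hnN => ?_⟩
  have hmono : ∀ v, min w (η ^ 2 / (8 * (L ^ 2) ^ 2)) ≤ v → Real.exp (-(v * N))
      ≤ Real.exp (-(min w (η ^ 2 / (8 * (L ^ 2) ^ 2)) * N)) := fun v hv =>
    Real.exp_le_exp.mpr (neg_le_neg (mul_le_mul_of_nonneg_right hv (Nat.cast_nonneg _)))
  rcases lt_or_ge (η ^ 2 * (N : ℝ)) (16 * n) with hc | hc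
  · exact (h ν g hm hL h0 ha N hN n hn hnN hc).trans (hmono _ (min_le_left _ _))
  · exact (measure_lowerBounded_le_of_few_columns hη hη1 hL0 ν g hm hL ha hn hnN hc).trans
      (hmono _ (min_le_right _ _))

end UpperTail

/-! ### Smallest singular value and the Gram matrix -/

section SmallestSingularValue

open Matrix

variable {n N : ℕ}

theorem norm_sq_toEuclideanLin (X : Fin N → Fin n → ℝ) (v : EuclideanSpace ℝ (Fin n)) :
    ‖Matrix.toEuclideanLin (Matrix.of X) v‖ ^ 2 = v.ofLp ⬝ᵥ rowGram X *ᵥ v.ofLp := by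
  rw [dotProduct_rowGram, EuclideanSpace.real_norm_sq_eq]
  rfl

theorem norm_sq_eq_dotProduct (v : EuclideanSpace ℝ (Fin n)) : ‖v‖ ^ 2 = v.ofLp ⬝ᵥ v.ofLp := by
  rw [EuclideanSpace.real_norm_sq_eq]
  simp [dotProduct, sq]

theorem inner_adjoint_comp_self {E F : Type*} [NormedAddCommGroup E] [InnerProductSpace ℝ E]
    [FiniteDimensional ℝ E] [NormedAddCommGroup F] [InnerProductSpace ℝ F] [FiniteDimensional ℝ F]
    (T : E →ₗ[ℝ] F) (v : E) : inner ℝ v ((LinearMap.adjoint T ∘ₗ T) v) = ‖T v‖ ^ 2 := by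
  rw [LinearMap.comp_apply, LinearMap.adjoint_inner_right, real_inner_self_eq_norm_sq]

/-- Tested on an eigenvector of the Gram operator for the squared singular value of index `n - 1`,
the last one when counting from zero. -/
theorem le_singularValue_of_lowerBounded (hn : 1 ≤ n) (X : Fin N → Fin n → ℝ) {t : ℝ}
    (h : LowerBounded (rowGram X) (t ^ 2)) : t ≤ singularValue (Matrix.of X) n := by
  set T := Matrix.toEuclideanLin (Matrix.of X) with hT
  have hs := T.hasEigenvalue_adjoint_comp_self_sq_singularValues (n := n - 1)
    (by rw [finrank_euclideanSpace_fin]; omega)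
  obtain ⟨v, hv⟩ := hs.exists_hasEigenvector
  have h1 := inner_adjoint_comp_self T v
  rw [hv.apply_eq_smul, real_inner_smul_right, real_inner_self_eq_norm_sq, hT,
    norm_sq_toEuclideanLin] at h1
  have h2 := h v.ofLp
  rw [← h1, ← norm_sq_eq_dotProduct] at h2
  have hv0 : 0 < ‖v‖ ^ 2 := by have := norm_pos_iff.mpr hv.2; positivity
  exact le_of_sq_le_sq (le_of_mul_le_mul_right h2 hv0) (T.singularValues_nonneg _)

/-- Expansion in an eigenbasis of the Gram operator: each index is at most `n - 1`, so each
eigenvalue is at least the squared last singular value. -/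
theorem lowerBounded_sq_singularValue (hn : 1 ≤ n) (X : Fin N → Fin n → ℝ) :
    LowerBounded (rowGram X) (singularValue (Matrix.of X) n ^ 2) := fun x => by
  set T := Matrix.toEuclideanLin (Matrix.of X) with hT
  have hfin : Module.finrank ℝ (EuclideanSpace ℝ (Fin n)) = n := finrank_euclideanSpace_fin
  obtain ⟨v, rfl⟩ : ∃ v : EuclideanSpace ℝ (Fin n), v.ofLp = x := ⟨WithLp.toLp 2 x, rfl⟩
  rw [← norm_sq_toEuclideanLin, ← norm_sq_eq_dotProduct, ← hT, ← inner_adjoint_comp_self T v,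
    ← real_inner_self_eq_norm_sq]
  set b := T.isSymmetric_adjoint_comp_self.eigenvectorBasis hfin
  rw [← b.sum_inner_mul_inner v v, ← b.sum_inner_mul_inner v, Finset.mul_sum]
  refine Finset.sum_le_sum fun i _ => ?_
  rw [← T.isSymmetric_adjoint_comp_self (b i) v,
    T.isSymmetric_adjoint_comp_self.apply_eigenvectorBasis hfin i]
  have h1 : singularValue (Matrix.of X) n ^ 2
      ≤ T.isSymmetric_adjoint_comp_self.eigenvalues hfin i := by
    rw [← T.sq_singularValues_fin hfin]
    exact pow_le_pow_left₀ (T.singularValues_nonneg _)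
      (T.singularValues_antitone (by have := i.2; omega)) 2
  have h2 : inner ℝ (((T.isSymmetric_adjoint_comp_self.eigenvalues hfin i : ℝ)) • b i) v
      = T.isSymmetric_adjoint_comp_self.eigenvalues hfin i * inner ℝ v (b i) := by
    rw [real_inner_smul_left, real_inner_comm]
  have h3 : inner ℝ v (b i) * inner ℝ (b i) v = inner ℝ v (b i) ^ 2 := by
    rw [real_inner_comm v (b i), sq]
  calc _ ≤ T.isSymmetric_adjoint_comp_self.eigenvalues hfin i * inner ℝ v (b i) ^ 2 := by
        rw [h3]; exact mul_le_mul_of_nonneg_right h1 (sq_nonneg _)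
    _ = inner ℝ v (b i)
        * (T.isSymmetric_adjoint_comp_self.eigenvalues hfin i * inner ℝ v (b i)) := by ring
    _ = _ := by rw [← h2]; rfl

theorem singularValue_nonneg (X : Matrix (Fin N) (Fin n) ℝ) (k : ℕ) : 0 ≤ singularValue X k :=
  LinearMap.singularValues_nonneg _ _

theorem singularValue_lt_of_not_lowerBounded (hn : 1 ≤ n) (X : Fin N → Fin n → ℝ) {c : ℝ}
    (h : ¬ LowerBounded (rowGram X) c) : singularValue (Matrix.of X) n ^ 2 < c := by
  by_contra hc
  exact h ((lowerBounded_sq_singularValue hn X).mono (not_lt.mp hc))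

end SmallestSingularValue

/-! ### Transfer to the product law -/

section IIDMatrix

variable {Ω : Type*} [MeasurableSpace Ω] {P : Measure Ω} {ν : Measure ℝ} {N n : ℕ}
  {a : Fin N → Fin n → Ω → ℝ}

theorem IsIIDMatrix.aemeasurable (h : IsIIDMatrix P ν a) :
    AEMeasurable (fun ω i j => a i j ω) P :=
  aemeasurable_pi_iff.mpr fun i => aemeasurable_pi_iff.mpr fun j => (h.hasLaw i j).aemeasurable

/-- Independence is over index pairs; currying regroups the product measure into independent rows.
-/
theorem IsIIDMatrix.map_eq [IsProbabilityMeasure P] [IsProbabilityMeasure ν]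
    (h : IsIIDMatrix P ν a) :
    P.map (fun ω i j => a i j ω) = Measure.pi fun _ : Fin N => Measure.pi fun _ : Fin n => ν := by
  have hm : ∀ p : Fin N × Fin n, AEMeasurable (fun ω => a p.1 p.2 ω) P :=
    fun p => (h.hasLaw p.1 p.2).aemeasurable
  have h1 := (iIndepFun_iff_map_fun_eq_pi_map hm).mp h.indep
  have h2 : ∀ p : Fin N × Fin n, P.map (fun ω => a p.1 p.2 ω) = ν :=
    fun p => (h.hasLaw p.1 p.2).map_eq
  simp_rw [h2] at h1
  have h3 := Measure.infinitePi_map_curry (fun (_ : Fin N) (_ : Fin n) => ν)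
  rw [Measure.infinitePi_eq_pi, ← h1, Measure.infinitePi_eq_pi] at h3
  simp_rw [Measure.infinitePi_eq_pi] at h3
  rw [← h3, AEMeasurable.map_map_of_aemeasurable (MeasurableEquiv.measurable _).aemeasurable
    (aemeasurable_pi_iff.mpr hm)]
  rfl

theorem IsIIDMatrix.centeredTruncation_eq (h : IsIIDMatrix P ν a) (M : ℝ) (i : Fin N) (j : Fin n)
    (ω : Ω) : centeredTruncation P M (a i j) ω = centeredTruncation ν M id (a i j ω) := by
  have h1 : ∀ ω, cutBelow M (a i j) ω = cutBelow M id (a i j ω) := fun ω => by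
    simp [cutBelow, Set.indicator]
  have h2 := (h.hasLaw i j).integral_comp (f := cutBelow M id)
    (measurable_cutBelow M).aestronglyMeasurable
  simp only [centeredTruncation, h1]
  rw [← h2]
  rfl

/-- A deterministic statement holding off a measurable set of small probability. -/
theorem IsIIDMatrix.measureReal_ge [IsProbabilityMeasure P] [IsProbabilityMeasure ν]
    (h : IsIIDMatrix P ν a) {B : Set (Fin N → Fin n → ℝ)}
    (hB : MeasurableSet B) {p : ℝ}
    (hp : (Measure.pi fun _ : Fin N => Measure.pi fun _ : Fin n => ν).real B ≤ p) {G : Set Ω}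
    (hG : ∀ ω, (fun i j => a i j ω) ∉ B → ω ∈ G) : 1 - p ≤ P.real G := by
  have h1 : P.real ((fun ω i j => a i j ω) ⁻¹' B) ≤ p := by
    rwa [Measure.real, ← Measure.map_apply_of_aemeasurable h.aemeasurable hB, h.map_eq]
  have h2 : Set.univ ⊆ G ∪ (fun ω i j => a i j ω) ⁻¹' B := fun ω _ => by
    by_cases hω : (fun i j => a i j ω) ∈ B
    · exact Or.inr hω
    · exact Or.inl (hG ω hω)
  have h3 := (measureReal_mono (μ := P) h2).trans (measureReal_union_le _ _)
  rw [probReal_univ] at h3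
  linarith

end IIDMatrix

/-! ### Combination of the two tails -/

/-- The law `ν` plays the role of the distribution of `ξ`; `ξ` itself is realized as the identity
on the probability space `(ℝ, ν)`. -/
theorem theorem3 :
    ∃ C : ℝ, 0 < C ∧
      ∀ M : ℝ, 0 < M → ∀ η : ℝ, 0 < η →
        ∃ w : ℝ, 0 < w ∧
          ∀ ν : Measure ℝ, IsProbabilityMeasure ν → MemLp (id : ℝ → ℝ) 2 ν →
            ∫ x, x ∂ν = 0 → ∫ x, x ^ 2 ∂ν = 1 →
            ∃ N₀ : ℕ, ∀ N : ℕ, N₀ ≤ N → ∀ n : ℕ, 1 ≤ n → n ≤ N →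
              ∀ (Ω : Type*) [MeasurableSpace Ω] (P : Measure Ω) [IsProbabilityMeasure P]
                (a : Fin N → Fin n → Ω → ℝ), IsIIDMatrix P ν a →
                P.real {ω |
                    singularValue (Matrix.of fun i j => a i j ω) n ≥
                      singularValue (Matrix.of fun i j => centeredTruncation P M (a i j) ω) n
                        - η * √(N : ℝ)
                        - C * √((N : ℝ) * ∫ x, truncationTail ν M id x ^ 2 ∂ν)}
                  ≥ 1 - Real.exp (-w * (N : ℝ)) := by
  -- The constant is the coefficient of σ in the lower tail; the upper tail does not involve σ.
  refine ⟨2, two_pos, fun M hM η hη => ?_⟩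
  obtain ⟨w₁, hw₁, hlow⟩ := exists_lower_tail (M := M) (η := η / 2) hM (by positivity)
  obtain ⟨w₂, hw₂, N₂, hup⟩ := exists_upper_tail (η := (η / 2) ^ 2) (L := 2 * M) (by positivity)
    (by positivity)
  -- Halving the rate absorbs the union bound: 2 exp(-2wN) ≤ exp(-wN) once wN ≥ 1, which `N₃`
  -- guarantees.
  set w := min w₁ w₂ / 2 with hw
  have hw0 : 0 < w := by have := lt_min hw₁ hw₂; positivity
  refine ⟨w, hw0, fun ν hprob hLp hmean hvar => ?_⟩
  have hν : IsStandardLaw ν := ⟨hLp, hmean, hvar⟩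
  obtain ⟨N₁, hlow⟩ := hlow ν hprob hν
  obtain ⟨N₃, hN₃⟩ := exists_nat_ge (1 / w)
  refine ⟨max N₁ (max N₂ N₃), fun N hN n hn hnN Ω _ P _ a ha => ?_⟩
  have hN₁ : N₁ ≤ N := (le_max_left _ _).trans hN
  have hN₂ : N₂ ≤ N := (le_max_left _ _).trans ((le_max_right _ _).trans hN)
  have hN₃' : (N₃ : ℝ) ≤ N := by
    exact_mod_cast (le_max_right _ _).trans ((le_max_right _ _).trans hN)
  set σ := √(∫ x, truncationTail ν M id x ^ 2 ∂ν) with hσ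
  have hσN : √((N : ℝ) * ∫ x, truncationTail ν M id x ^ 2 ∂ν) = σ * √(N : ℝ) := by
    rw [Real.sqrt_mul (Nat.cast_nonneg _), mul_comm]
  set t := √(N : ℝ) - √n - (η / 2 + 2 * σ) * √N with ht
  set c := (√(N : ℝ) - √n) ^ 2 + (η / 2) ^ 2 * N with hc
  set μ := Measure.pi fun _ : Fin N => Measure.pi fun _ : Fin n => ν with hμ
  -- For negative `t` the squared level says nothing about `t`, and s_n(A) ≥ t holds trivially, so
  -- no event is excluded.
  set B₁ : Set (Fin N → Fin n → ℝ) := {X | 0 ≤ t ∧ ¬ LowerBounded (rowGram X) (t ^ 2)} with hB₁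
  set B₂ : Set (Fin N → Fin n → ℝ) :=
    {X | LowerBounded (rowGram fun i j => centeredTruncation ν M id (X i j)) c} with hB₂
  have hB₁m : MeasurableSet B₁ := by
    have h := measurableSet_lowerBounded (N := N) (0 : Matrix (Fin n) (Fin n) ℝ) (t ^ 2)
    simp only [zero_add] at h
    exact (MeasurableSet.const (0 ≤ t)).inter h.compl
  have hB₂m : MeasurableSet B₂ :=
    LowerBounded.measurableSet_rowGram_comp (measurable_centeredTruncation M) _
  have hP₁ : μ.real B₁ ≤ Real.exp (-(w₁ * N)) := by
    by_cases ht0 : 0 ≤ t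
    · refine ENNReal.toReal_le_of_le_ofReal (Real.exp_pos _).le ?_
      exact (measure_mono fun X hX => hX.2).trans (hlow N hN₁ n hn hnN t ht0 le_rfl)
    · have : B₁ = ∅ := by ext X; simp [hB₁, ht0]
      rw [this, measureReal_empty]
      exact (Real.exp_pos _).le
  have hP₂ : μ.real B₂ ≤ Real.exp (-(w₂ * N)) :=
    hup ν _ (measurable_centeredTruncation M) (abs_centeredTruncation_le hM.le)
      (integral_centeredTruncation hM.le) (hν.integral_centeredTruncation_sq_le hM.le) N hN₂ n hn hnN
  have hP : μ.real (B₁ ∪ B₂) ≤ Real.exp (-w * N) := by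
    refine (measureReal_union_le _ _).trans ((add_le_add hP₁ hP₂).trans ?_)
    have h1 : ∀ v, min w₁ w₂ ≤ v → Real.exp (-(v * N)) ≤ Real.exp (-w * N) * Real.exp (-w * N) := by
      intro v hv
      rw [← Real.exp_add]
      refine Real.exp_le_exp.mpr ?_
      have := mul_le_mul_of_nonneg_right hv (Nat.cast_nonneg N : (0 : ℝ) ≤ N)
      have e : min w₁ w₂ = 2 * w := by rw [hw]; ring
      rw [e] at this
      linarith
    have h2 : 1 ≤ w * N := by
      have := hN₃.trans hN₃'
      rwa [div_le_iff₀' hw0] at this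
    have h3 : Real.exp (-w * N) ≤ 1 / 2 := by
      have h4 := Real.add_one_le_exp (w * N)
      have h5 : Real.exp (-w * N) * Real.exp (w * N) = 1 := by rw [← Real.exp_add]; simp
      have h6 := mul_le_mul_of_nonneg_left (show 2 ≤ Real.exp (w * N) by linarith)
        (Real.exp_pos (-w * N)).le
      linarith
    have h4 := mul_le_mul_of_nonneg_left h3 (Real.exp_pos (-w * N)).le
    linarith [h1 w₁ (min_le_left _ _), h1 w₂ (min_le_right _ _)]
  refine ha.measureReal_ge (hB₁m.union hB₂m) hP fun ω hω => ?_
  rw [Set.mem_union, not_or] at hω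
  obtain ⟨hω₁, hω₂⟩ := hω
  rw [Set.mem_ofPred_eq, hσN]
  simp_rw [ha.centeredTruncation_eq M]
  have h1 := singularValue_lt_of_not_lowerBounded hn _ hω₂
  have hnN' : √(n : ℝ) ≤ √(N : ℝ) := Real.sqrt_le_sqrt (by exact_mod_cast hnN)
  have h2 : singularValue (Matrix.of fun i j => centeredTruncation ν M id (a i j ω)) n
      ≤ √(N : ℝ) - √n + η / 2 * √N := by
    have h3 : 0 ≤ η / 2 * √(N : ℝ) := by positivity
    refine le_of_sq_le_sq (h1.le.trans ?_) (by linarith)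
    have h4 : (η / 2 * √(N : ℝ)) ^ 2 = (η / 2) ^ 2 * N := by
      rw [mul_pow, Real.sq_sqrt (Nat.cast_nonneg _)]
    have h5 := mul_nonneg (sub_nonneg.mpr hnN') h3
    rw [hc, ← h4]
    linarith
  have h3 : t ≤ singularValue (Matrix.of fun i j => a i j ω) n := by
    by_cases ht0 : 0 ≤ t
    · refine le_singularValue_of_lowerBounded hn _ ?_
      by_contra hcon
      exact hω₁ ⟨ht0, hcon⟩
    · exact (not_le.mp ht0).le.trans (singularValue_nonneg _ _)
  linarith
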